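/- A translation surface is a compact connected Hausdorff surface $X$ with a finite set $\Sigma\subset X$ and an atlas of charts to $\mathbb C$ on $X\setminus\Sigma$ whose transition maps are (locally) translations, such that every $x\in\Sigma$ is a cone point of some angle $2\pi(k_x+1)$, $k_x\in\mathbb N$. For $A\in SL(2,\mathbb R)$, $AX$ denotes the same surface with every chart postcomposed with the linear map $A$ of $\mathbb C=\mathbb R^2$. An oriented saddle connection is an oriented straight segment with endpoints in $\Sigma$ and no point of $\Sigma$ in its interior. A saddle connection path is a non-empty finite sequence $\underline s=s_1\cdots s_m$ of oriented saddle connections such that $s_{i+1}$ starts where $s_i$ ends and the angle between $s_i$ and $s_{i+1}$ is at least $\pi$ on both sides; its length is $\ell(\underline s)=\sum_i\ell(s_i)$. The entropy is $h(X)=\lim_{T\to\infty}\frac1T\log\#\{\underline s:\ell(\underline s)\le T\}$. **Lemma.** Let $k\ge 1$ and let $X_0$ be a translation surface of unit area with exactly $n$ singularities, all of cone angle $2\pi(k+1)$, which is tiled by equal axis-parallel squares in such a way that the singularities are precisely the vertices of the squares. Put $$\Lambda=\Bigl\{\Bigl(\tfrac{a}{\sqrt{n(k+1)}},\tfrac{b}{\sqrt{n(k+1)}}\Bigr):(a,b)\in\mathbb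 Z^2\setminus\{(0,0)\}\Bigr\},\qquad f_t(A)=\sum_{v\in A(\Lambda)}e^{-t\|v\|}\quad(t>0,\ A\in SL(2,\mathbb R)),$$ where $\|\cdot\|$ is the Euclidean norm. Then for every $A\in SL(2,\mathbb R)$: 1. For every $t>0$ the series $f_t(A)$ converges, and $t\mapsto f_t(A)$ is differentiable on $(0,\infty)$ with $\frac{\partial f_t(A)}{\partial t}<0$; in particular it is strictly decreasing there. 2. For every $t>0$ with $f_t(A)<\frac1k$, the sum over all saddle connection paths of $AX_0$ converges and $$\sum_{\underline s}e^{-t\ell(\underline s)}=\frac{n(k+1)f_t(A)}{1-kf_t(A)}.$$ 3. The entropy $h(AX_0)$ exists (the counts are finite and the limit exists), is positive, and is the unique $t>0$ with $f_t(A)=\frac1k$. -/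

import Mathlib

open Filter Topology

/-- A flat structure with translation transition maps on a topological space `X`: a finite set
`sing` of marked points and an atlas of charts to `ℂ` on the complement of `sing` such that every
transition map is, locally, a translation.  Together with `X` being compact, Hausdorff and
connected, and every point of `sing` being a cone point (`IsConePoint`), this is a translation
surface with singularity set `sing`. -/
structure TranslationStructure (X : Type*) [TopologicalSpace X] where
  sing : Set X
  atlas : Set (OpenPartialHomeomorph X ℂ)
  finite_sing : sing.Finite
  source_subset : ∀ φ ∈ atlas, φ.source ⊆ singᶜ
  exists_chart : ∀ p ∈ singᶜ, ∃ φ ∈ atlas, p ∈ φ.source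
  transition : ∀ φ ∈ atlas, ∀ ψ ∈ atlas, ∀ p ∈ φ.source ∩ ψ.source,
    ∀ᶠ q in 𝓝 p, ψ q - ψ p = φ q - φ p

/-- The linear action of `SL(2, ℝ)` on the plane `ℂ = ℝ²`. -/
noncomputable def slPlane (A : Matrix.SpecialLinearGroup (Fin 2) ℝ) : ℂ ≃L[ℝ] ℂ :=
  LinearEquiv.toContinuousLinearEquiv
    { toFun := fun z => ⟨A 0 0 * z.re + A 0 1 * z.im, A 1 0 * z.re + A 1 1 * z.im⟩
      invFun := fun z => ⟨A 1 1 * z.re - A 0 1 * z.im, -(A 1 0) * z.re + A 0 0 * z.im⟩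
      map_add' := fun z w => by apply Complex.ext <;> simp <;> ring
      map_smul' := fun c z => by apply Complex.ext <;> simp <;> ring
      left_inv := fun z => by
        have h := A.det_coe
        rw [Matrix.det_fin_two] at h
        apply Complex.ext
        · simp only; linear_combination z.re * h
        · simp only; linear_combination z.im * h
      right_inv := fun z => by
        have h := A.det_coe
        rw [Matrix.det_fin_two] at h
        apply Complex.ext
        · simp only; linear_combination z.re * h
        · simp only; linear_combination z.im * h }

theorem slPlane_apply (A : Matrix.SpecialLinearGroup (Fin 2) ℝ) (z : ℂ) :
    slPlane A z = ⟨A 0 0 * z.re + A 0 1 * z.im, A 1 0 * z.re + A 1 1 * z.im⟩ := rfl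

namespace TranslationStructure

/-- The surface `A X`: the same space and singular set, with every chart postcomposed with `A`. -/
noncomputable def act {X : Type*} [TopologicalSpace X] (A : Matrix.SpecialLinearGroup (Fin 2) ℝ)
    (S : TranslationStructure X) : TranslationStructure X where
  sing := S.sing
  atlas := (fun φ => φ.transHomeomorph (slPlane A).toHomeomorph) '' S.atlas
  finite_sing := S.finite_sing
  source_subset := by
    rintro _ ⟨φ, hφ, rfl⟩
    exact S.source_subset φ hφ
  exists_chart := by
    intro p hp
    obtain ⟨φ, hφ, h⟩ := S.exists_chart p hp
    exact ⟨_, ⟨φ, hφ, rfl⟩, h⟩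
  transition := by
    rintro _ ⟨φ, hφ, rfl⟩ _ ⟨ψ, hψ, rfl⟩ p hp
    filter_upwards [S.transition φ hφ ψ hψ p hp] with q hq
    change slPlane A (ψ q) - slPlane A (ψ p) = slPlane A (φ q) - slPlane A (φ p)
    rw [← map_sub, ← map_sub, hq]

/-- On the set `D`, the map `g` into the surface is continuous, avoids the singularities, and when
read in the charts it coincides locally, up to translation, with the planar map `f`. -/
def DevelopsAs {X Y : Type*} [TopologicalSpace X] [TopologicalSpace Y]
    (S : TranslationStructure X) (g : Y → X) (f : Y → ℂ) (D : Set Y) : Prop :=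
  ContinuousOn g D ∧ ∀ y ∈ D, g y ∉ S.sing ∧
    ∀ φ ∈ S.atlas, g y ∈ φ.source → ∀ᶠ y' in 𝓝[D] y, φ (g y') - φ (g y) = f y' - f y

/-- Polar coordinates `(r, θ) ↦ r e^{iθ}`. -/
noncomputable def polar (q : ℝ × ℝ) : ℂ := (q.1 : ℂ) * Complex.exp ((q.2 : ℂ) * Complex.I)

/-- `x` is a cone point of angle `2π(k+1)`: the Euclidean cone of that angle, with polar
coordinates `(r, θ)`, `r ≥ 0`, `θ ∈ ℝ / 2π(k+1)ℤ` (equivalently, `k+1` upper and `k+1` lower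
half-planes glued cyclically along half-lines), has a disc of some radius `ε > 0` around its apex
that is homeomorphic, via `P`, to a neighbourhood of `x`, the apex going to `x`, and `P` is a
local isometry, indeed a translation in charts, away from the apex. -/
def IsConePoint {X : Type*} [TopologicalSpace X] (S : TranslationStructure X) (x : X) (k : ℕ) :
    Prop :=
  ∃ ε : ℝ, 0 < ε ∧ ∃ P : ℝ × ℝ → X,
    (∀ θ : ℝ, P (0, θ) = x) ∧
    ContinuousOn P (Set.Ico 0 ε ×ˢ Set.univ) ∧
    (∀ r ∈ Set.Ico 0 ε, ∀ r' ∈ Set.Ico 0 ε, ∀ θ θ' : ℝ, P (r, θ) = P (r', θ') ↔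
      r = r' ∧ (r = 0 ∨ ∃ m : ℤ, θ' - θ = m * (2 * Real.pi * (k + 1)))) ∧
    (∀ δ : ℝ, 0 < δ → δ ≤ ε → P '' (Set.Ico 0 δ ×ˢ Set.univ) ∈ 𝓝 x) ∧
    S.DevelopsAs P polar (Set.Ioo 0 ε ×ˢ Set.univ)

/-- The closed square `[0, s] × [0, s]`. -/
def square (s : ℝ) : Set ℂ := {z | z.re ∈ Set.Icc 0 s ∧ z.im ∈ Set.Icc 0 s}

/-- The four vertices of the square. -/
def corners (s : ℝ) : Set ℂ := {z | (z.re = 0 ∨ z.re = s) ∧ (z.im = 0 ∨ z.im = s)}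

/-- The surface is tiled by `N` axis-parallel squares of side `s > 0`, and the singularities are
precisely the vertices of the squares: the tiles cover the surface, the interior of a tile is
embedded and meets no other tile, away from the vertices every tile is a translation in charts
(and contains no singularity), and every vertex is a singularity. -/
def IsSquareTiled {X : Type*} [TopologicalSpace X] (S : TranslationStructure X) (N : ℕ) (s : ℝ) :
    Prop :=
  0 < s ∧ ∃ τ : Fin N → ℂ → X,
    (∀ i, ContinuousOn (τ i) (square s)) ∧
    (∀ p, ∃ i, p ∈ τ i '' square s) ∧
    (∀ i j, ∀ z ∈ interior (square s), ∀ w ∈ square s, τ i z = τ j w → i = j ∧ z = w) ∧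
    (∀ i, S.DevelopsAs (τ i) id (square s \ corners s)) ∧
    (∀ i, ∀ z ∈ corners s, τ i z ∈ S.sing)

/-- A surface of unit area tiled by axis-parallel squares (so that the number of squares times the
area of a square is `1`), the singularities being precisely the vertices of the squares. -/
def IsUnitAreaSquareTiled {X : Type*} [TopologicalSpace X] (S : TranslationStructure X) : Prop :=
  ∃ (N : ℕ) (s : ℝ), S.IsSquareTiled N s ∧ (N : ℝ) * s ^ 2 = 1

/-- An oriented saddle connection, parametrized at constant speed on `[0, 1]`: a straight line
with endpoints in the singular set and no singularity in its interior.  Its displacement in the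
charts, `hol`, is determined by the parametrized path. -/
structure SaddleConnection {X : Type*} [TopologicalSpace X] (S : TranslationStructure X) where
  path : C(unitInterval, X)
  hol : ℂ
  initial_mem : path 0 ∈ S.sing
  terminal_mem : path 1 ∈ S.sing
  straight : S.DevelopsAs path (fun t : unitInterval => ((t : ℝ) : ℂ) * hol) (Set.Ioo 0 1)

namespace SaddleConnection

variable {X : Type*} [TopologicalSpace X] {S : TranslationStructure X}

/-- The length of a saddle connection. -/
noncomputable def length (s : S.SaddleConnection) : ℝ := ‖s.hol‖

/-- The germ at the initial singularity, parametrized by the distance to that singularity. -/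
noncomputable def outRay (s : S.SaddleConnection) (r : ℝ) : X :=
  s.path (Set.projIcc 0 1 zero_le_one (r / s.length))

/-- The germ at the terminal singularity, parametrized by the distance to that singularity. -/
noncomputable def inRay (s : S.SaddleConnection) (r : ℝ) : X :=
  s.path (Set.projIcc 0 1 zero_le_one (1 - r / s.length))

end SaddleConnection

/-- Rotating counterclockwise about their common endpoint by the angle `α ≥ 0` takes the ray `ρ₁`
to the ray `ρ₂` (rays are parametrized by arc length from the endpoint): they are the two sides of
a circular sector of angle `α` on the surface.  At a cone point of angle `2π(k+1)`, `α` is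
determined modulo `2π(k+1)`. -/
def HasAngle {X : Type*} [TopologicalSpace X] (S : TranslationStructure X) (ρ₁ ρ₂ : ℝ → X)
    (α : ℝ) : Prop :=
  0 ≤ α ∧ ∃ (ε θ : ℝ) (P : ℝ × ℝ → X), 0 < ε ∧
    S.DevelopsAs P polar (Set.Ioo 0 ε ×ˢ Set.Icc θ (θ + α)) ∧
    ∀ r ∈ Set.Ioo 0 ε, P (r, θ) = ρ₁ r ∧ P (r, θ + α) = ρ₂ r

/-- `s'` starts where `s` ends, and the angle between them is at least `π` on both sides. -/
def IsGeodesicJoin {X : Type*} [TopologicalSpace X] {S : TranslationStructure X}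
    (s s' : S.SaddleConnection) : Prop :=
  s.path 1 = s'.path 0 ∧
    (∀ α, S.HasAngle s.inRay s'.outRay α → Real.pi ≤ α) ∧
    (∀ α, S.HasAngle s'.outRay s.inRay α → Real.pi ≤ α)

/-- Oriented saddle connection paths: non-empty sequences of oriented saddle connections, in which
consecutive ones form a geodesic. -/
def SaddlePath {X : Type*} [TopologicalSpace X] (S : TranslationStructure X) : Type _ :=
  {l : List S.SaddleConnection // l ≠ [] ∧ l.IsChain IsGeodesicJoin}

/-- The length of a saddle connection path. -/
noncomputable def SaddlePath.length {X : Type*} [TopologicalSpace X] {S : TranslationStructure X}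
    (p : S.SaddlePath) : ℝ :=
  (p.1.map SaddleConnection.length).sum

/-- The entropy of the surface is `h`: for every `T` the number of saddle connection paths of
length at most `T` is finite, and its exponential growth rate is a limit, equal to `h`. -/
def HasEntropy {X : Type*} [TopologicalSpace X] (S : TranslationStructure X) (h : ℝ) : Prop :=
  (∀ T : ℝ, {p : S.SaddlePath | p.length ≤ T}.Finite) ∧
    Tendsto (fun T : ℝ => 1 / T * Real.log ({p : S.SaddlePath | p.length ≤ T}.ncard : ℝ))
      atTop (𝓝 h)

end TranslationStructure

/-- The standard lattice scaled by `1 / √(n(k+1))`, without the origin. -/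
def scaledLattice (n k : ℕ) : Set ℂ :=
  {z | ∃ a b : ℤ, (a, b) ≠ (0, 0) ∧
    z = ⟨(a : ℝ) / Real.sqrt (n * (k + 1)), (b : ℝ) / Real.sqrt (n * (k + 1))⟩}

/-- `f_t(A)`, the sum of `exp (-t ‖v‖)` over `v ∈ A(Λ)`. -/
noncomputable def latticeSum (n k : ℕ) (t : ℝ) (A : Matrix.SpecialLinearGroup (Fin 2) ℝ) : ℝ :=
  ∑' v : slPlane A '' scaledLattice n k, Real.exp (-t * ‖(v : ℂ)‖)

namespace TranslationStructure

/-! ### Developing maps and unique continuation -/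

section Develops

variable {X Y Z : Type*} [TopologicalSpace X] [TopologicalSpace Y] [TopologicalSpace Z]
  {S : TranslationStructure X}

/-! Sending each tile to the standard square projects the surface to the square torus of side `s`.
The projection is a translation in charts, and its fibre over `0` is exactly the singular set.
Counting sheets near `0` gives `n(k+1)` tiles, so unit area forces `s = 1/√(n(k+1))`; after applying
`A` the kernel of the plane's map to the torus is `A(Λ) ∪ {0}`.

Away from `0` the projection is a covering, so straight segments lift. Hence holonomies of saddle
connections are primitive lattice vectors, and each primitive `v`, singularity and choice among the
`k+1` rays in direction `v` gives exactly one saddle connection (`exists_equiv_saddleConnection`):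
`n(k+1)` for each `v`. At the end of a saddle connection `e`, exactly one of the `k+1` rays in a
given direction makes an angle less than `π` with the incoming one, except in the direction of `e`
itself, where all `k+1` are admissible (`ncard_angles`). So a function `g` of the holonomy, summed
over the continuations of `e`, gives `k ∑ g(v) + g(hol e)` (`tsum_isGeodesicJoin`).

Put `x_v = exp(-t‖v‖)` and let `B_v` be the weight of all paths beginning with a given saddle
connection of holonomy `v`. Then `B_v = x_v (1 + k B + B_v)` with `B = ∑ B_v`, that is `B_v = y_v (1
+ k B)` where `y_v = x_v/(1-x_v) = x_v + x_v² + ⋯`. Every nonzero lattice vector is uniquely a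
positive multiple of a primitive one, so `∑ y_v = f_t`. Therefore `B = f_t/(1 - k f_t)`, and the
factor `n(k+1)` gives the formula (`hasSum_saddlePath`).

Termwise differentiation makes `f_t` continuous and strictly decreasing; it exceeds `1` for small
`t` and tends to `0`, so it equals `1/k` at a unique `h`. For `t > h` convergence of the path sum
bounds the counts by a multiple of `exp(tT)` (`ncard_saddlePath_le`). For `0 < t < h`, finitely many
primitive vectors already satisfy `k ∑ y_v > 1`, and the recursion for the counts gives a lower
bound of the same form (`exists_le_tsum_count`). -/

theorem DevelopsAs.mono {g : Y → X} {f : Y → ℂ} {D D' : Set Y} (h : S.DevelopsAs g f D)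
    (hD : D' ⊆ D) : S.DevelopsAs g f D' :=
  ⟨h.1.mono hD, fun y hy => ⟨(h.2 y (hD hy)).1, fun φ hφ hs =>
    ((h.2 y (hD hy)).2 φ hφ hs).filter_mono (nhdsWithin_mono _ hD)⟩⟩

theorem DevelopsAs.comp {g : Y → X} {f : Y → ℂ} {D : Set Y} (h : S.DevelopsAs g f D)
    {u : Z → Y} {D' : Set Z} (hu : ContinuousOn u D') (hm : Set.MapsTo u D' D) :
    S.DevelopsAs (g ∘ u) (f ∘ u) D' :=
  ⟨h.1.comp hu hm, fun z hz => ⟨(h.2 _ (hm hz)).1, fun φ hφ hs =>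
    ((hu z hz).tendsto_nhdsWithin hm).eventually ((h.2 _ (hm hz)).2 φ hφ hs)⟩⟩

theorem DevelopsAs.congr {g g' : Y → X} {f f' : Y → ℂ} {D : Set Y} (h : S.DevelopsAs g f D)
    (hg : Set.EqOn g' g D) {a : ℂ} (hf : ∀ y ∈ D, f' y = f y + a) : S.DevelopsAs g' f' D := by
  refine ⟨h.1.congr hg, fun y hy => ?_⟩
  rw [hg hy]
  refine ⟨(h.2 y hy).1, fun φ hφ hs => ?_⟩
  filter_upwards [(h.2 y hy).2 φ hφ hs, self_mem_nhdsWithin] with y' h1 hy'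
  rw [hg hy', hf y hy, hf y' hy', h1]
  ring

/-- Two maps into the surface that develop as the same planar map on a preconnected set coincide
as soon as they agree at one point. -/
theorem DevelopsAs.eqOn [T2Space X] {g₁ g₂ : Y → X} {f : Y → ℂ} {D : Set Y}
    (h₁ : S.DevelopsAs g₁ f D) (h₂ : S.DevelopsAs g₂ f D) (hD : IsPreconnected D) {y₀ : Y}
    (hy₀ : y₀ ∈ D) (h0 : g₁ y₀ = g₂ y₀) : Set.EqOn g₁ g₂ D := by
  have : PreconnectedSpace D := Subtype.preconnectedSpace hD
  have hclosed : IsClosed {y : D | g₁ y = g₂ y} :=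
    isClosed_eq (continuousOn_iff_continuous_domRestrict.1 h₁.1)
      (continuousOn_iff_continuous_domRestrict.1 h₂.1)
  have hopen : IsOpen {y : D | g₁ y = g₂ y} := by
    rw [isOpen_iff_mem_nhds]
    rintro ⟨y, hy⟩ (hyy : g₁ y = g₂ y)
    obtain ⟨φ, hφ, hs⟩ := S.exists_chart (g₁ y) (h₁.2 y hy).1
    have hs2 : g₂ y ∈ φ.source := hyy ▸ hs
    have key : {y | g₁ y = g₂ y} ∈ 𝓝[D] y := by
      filter_upwards [(h₁.2 y hy).2 φ hφ hs, (h₂.2 y hy).2 φ hφ hs2,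
        (h₁.1 y hy) (φ.open_source.mem_nhds hs), (h₂.1 y hy) (φ.open_source.mem_nhds hs2)]
        with y' e1 e2 m1 m2
      refine φ.injOn m1 m2 ?_
      rw [← e2, hyy] at e1
      exact sub_left_injective e1
    exact (preimage_coe_mem_nhds_subtype (a := ⟨y, hy⟩)).2 key
  have := IsClopen.eq_univ ⟨hclosed, hopen⟩ ⟨⟨y₀, hy₀⟩, h0⟩
  intro y hy
  exact (Set.eq_univ_iff_forall.1 this) ⟨y, hy⟩

theorem DevelopsAs.act {g : Y → X} {f : Y → ℂ} {D : Set Y} (h : S.DevelopsAs g f D)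
    (A : Matrix.SpecialLinearGroup (Fin 2) ℝ) :
    (S.act A).DevelopsAs g (fun y => slPlane A (f y)) D := by
  refine ⟨h.1, fun y hy => ⟨(h.2 y hy).1, ?_⟩⟩
  rintro _ ⟨φ, hφ, rfl⟩ hs
  filter_upwards [(h.2 y hy).2 φ hφ hs] with y' hy'
  change slPlane A (φ (g y')) - slPlane A (φ (g y)) = _
  rw [← map_sub, hy', map_sub]

end Develops

/-! ### Linear maps in polar coordinates and cone points of `A X` -/

section ConeAct

theorem polar_add_int (r θ : ℝ) (m : ℤ) : polar (r, θ + m * (2 * Real.pi)) = polar (r, θ) := by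
  simp only [polar]
  congr 1
  rw [Complex.exp_eq_exp_iff_exists_int]
  exact ⟨m, by push_cast; ring⟩

theorem norm_polar {r : ℝ} (hr : 0 ≤ r) (θ : ℝ) : ‖polar (r, θ)‖ = r := by
  simp [polar, Complex.norm_exp_ofReal_mul_I, abs_of_nonneg hr]

theorem continuous_polar : Continuous polar := by
  unfold polar; fun_prop

theorem polar_norm_arg (z : ℂ) : polar (‖z‖, z.arg) = z := Complex.norm_mul_exp_arg_mul_I z

theorem polar_eq_iff {r θ θ' : ℝ} (hr : 0 < r) :
    polar (r, θ') = polar (r, θ) ↔ ∃ m : ℤ, θ' = θ + m * (2 * Real.pi) := by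
  simp only [polar]
  have hr' : (r : ℂ) ≠ 0 := by exact_mod_cast hr.ne'
  rw [mul_right_inj' hr', Complex.exp_eq_exp_iff_exists_int]
  refine exists_congr fun m => ?_
  constructor
  · intro h
    have := congrArg Complex.im h
    simp at this
    linarith
  · rintro rfl
    push_cast; ring

theorem polar_neg_radius (r θ : ℝ) : polar (r, θ + Real.pi) = -polar (r, θ) := by
  simp only [polar]
  push_cast
  rw [add_mul, Complex.exp_add, Complex.exp_pi_mul_I]
  ring

theorem polar_smul (t r θ : ℝ) : polar (t * r, θ) = t * polar (r, θ) := by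
  simp only [polar]; push_cast; ring

/-- An orientation preserving linear map of the plane acts on polar coordinates by a radial
dilation depending on the angle and a homeomorphism of the angles that has degree one. -/
theorem exists_polar_lift (B : Matrix.SpecialLinearGroup (Fin 2) ℝ) :
    ∃ (lam ψ : ℝ → ℝ), Continuous lam ∧ Continuous ψ ∧ (∀ θ, 0 < lam θ) ∧
      (∃ c > 0, ∀ θ, c ≤ lam θ) ∧ (∃ C > 0, ∀ θ, lam θ ≤ C) ∧
      (∀ θ (m : ℤ), lam (θ + m * (2 * Real.pi)) = lam θ) ∧
      (∀ θ (m : ℤ), ψ (θ + m * (2 * Real.pi)) = ψ θ + m * (2 * Real.pi)) ∧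
      Function.Injective ψ ∧ Function.Surjective ψ ∧
      ∀ r θ, slPlane B (polar (r, θ)) = polar (r * lam θ, ψ θ) := by
  have hdet := B.det_coe
  rw [Matrix.det_fin_two] at hdet
  set a := B 0 0
  set b := B 0 1
  set c := B 1 0
  set d := B 1 1
  set α : ℂ := ⟨(a + d) / 2, (c - b) / 2⟩ with hα
  set β : ℂ := ⟨(a - d) / 2, (c + b) / 2⟩ with hβ
  have hB : ∀ z, slPlane B z = α * z + β * (starRingEnd ℂ) z := by
    intro z
    rw [slPlane_apply]
    apply Complex.ext
    · simp [hα, hβ]; ring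
    · simp [hα, hβ]; ring
  have hnorm : ‖α‖ ^ 2 - ‖β‖ ^ 2 = 1 := by
    rw [Complex.sq_norm, Complex.sq_norm, Complex.normSq_apply, Complex.normSq_apply]
    simp only [hα, hβ]
    linear_combination hdet
  have hlt : ‖β‖ < ‖α‖ := by
    refine lt_of_pow_lt_pow_left₀ 2 (norm_nonneg _) (by linarith)
  have hα0 : α ≠ 0 := norm_pos_iff.1 (lt_of_le_of_lt (norm_nonneg _) hlt)
  -- `B(r e^{iθ}) = r e^{iθ} α w(θ)`. Since `|β/α| < 1`, `w` stays in the right half-plane, so its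
  -- principal argument is continuous.
  set w : ℝ → ℂ := fun θ => 1 + β / α * Complex.exp (-(2 * θ : ℝ) * Complex.I) with hw
  have hwc : Continuous w := by rw [hw]; fun_prop
  have hwre : ∀ θ, 0 < (w θ).re := by
    intro θ
    have h1 : ‖β / α * Complex.exp (-(2 * θ : ℝ) * Complex.I)‖ < 1 := by
      rw [norm_mul, show (-(2 * θ : ℝ) * Complex.I : ℂ) = ((-(2 * θ) : ℝ) : ℂ) * Complex.I by
        push_cast; ring, Complex.norm_exp_ofReal_mul_I, mul_one, norm_div,
        div_lt_one (norm_pos_iff.2 hα0)]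
      exact hlt
    have h2 := (abs_le.1 (Complex.abs_re_le_norm (β / α * Complex.exp (-(2 * θ : ℝ) * Complex.I)))).1
    simp only [hw, Complex.add_re, Complex.one_re]
    linarith
  have hws : ∀ θ, w θ ∈ Complex.slitPlane := fun θ => Or.inl (hwre θ)
  set lam : ℝ → ℝ := fun θ => ‖α‖ * ‖w θ‖ with hlam
  set ψ : ℝ → ℝ := fun θ => θ + α.arg + (w θ).arg with hψ
  have hform : ∀ r θ, slPlane B (polar (r, θ)) = polar (r * lam θ, ψ θ) := by
    intro r θ
    have e1 : polar (r * lam θ, ψ θ) =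
        r * Complex.exp (θ * Complex.I) * (‖α‖ * Complex.exp (α.arg * Complex.I)) *
          (‖w θ‖ * Complex.exp ((w θ).arg * Complex.I)) := by
      simp only [polar, hlam, hψ]
      push_cast
      rw [add_mul, add_mul, Complex.exp_add, Complex.exp_add]
      ring
    rw [e1, Complex.norm_mul_exp_arg_mul_I, Complex.norm_mul_exp_arg_mul_I, hB]
    have e2 : (starRingEnd ℂ) (polar (r, θ)) =
        r * Complex.exp (θ * Complex.I) * Complex.exp (-(2 * θ : ℝ) * Complex.I) := by
      simp only [polar]
      rw [map_mul, ← Complex.exp_conj, mul_assoc, ← Complex.exp_add]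
      simp
      left
      congr 1
      ring
    rw [e2]
    simp only [polar, hw]
    field_simp
  have hper : ∀ θ (m : ℤ), ψ (θ + m * (2 * Real.pi)) = ψ θ + m * (2 * Real.pi) := by
    intro θ m
    have : w (θ + m * (2 * Real.pi)) = w θ := by
      simp only [hw]
      congr 2
      rw [Complex.exp_eq_exp_iff_exists_int]
      exact ⟨-(2 * m), by push_cast; ring⟩
    simp only [hψ, this]
    ring
  have hψc : Continuous ψ := by
    have : Continuous fun θ => (w θ).arg :=
      continuous_iff_continuousAt.2 fun θ =>
        (Complex.continuousAt_arg (hws θ)).comp hwc.continuousAt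
    simp only [hψ]; fun_prop
  have hpos : ∀ θ, 0 < lam θ := fun θ =>
    mul_pos (norm_pos_iff.2 hα0) (norm_pos_iff.2 (Complex.slitPlane_ne_zero (hws θ)))
  have hlp : ∀ θ (m : ℤ), lam (θ + m * (2 * Real.pi)) = lam θ := by
    intro θ m
    have h1 := hform 1 (θ + m * (2 * Real.pi))
    rw [polar_add_int, hform, hper, polar_add_int] at h1
    have := congrArg norm h1
    rw [norm_polar (by simpa using (hpos _).le), norm_polar (by simpa using (hpos _).le)] at this
    linarith
  have hlc : Continuous lam := by simp only [hlam]; fun_prop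
  have hbd : (∃ c > 0, ∀ θ, c ≤ lam θ) ∧ (∃ C > 0, ∀ θ, lam θ ≤ C) := by
    have hβα : ‖β / α‖ < 1 := by
      rw [norm_div, div_lt_one (norm_pos_iff.2 hα0)]; exact hlt
    have hn : ∀ θ, ‖β / α * Complex.exp (-(2 * θ : ℝ) * Complex.I)‖ = ‖β / α‖ := by
      intro θ
      rw [norm_mul, show (-(2 * θ : ℝ) * Complex.I : ℂ) = ((-(2 * θ) : ℝ) : ℂ) * Complex.I by
        push_cast; ring, Complex.norm_exp_ofReal_mul_I, mul_one]
    refine ⟨⟨‖α‖ * (1 - ‖β / α‖), mul_pos (norm_pos_iff.2 hα0) (by linarith), fun θ => ?_⟩,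
      ⟨‖α‖ * (1 + ‖β / α‖), mul_pos (norm_pos_iff.2 hα0) (by positivity), fun θ => ?_⟩⟩
    · refine mul_le_mul_of_nonneg_left ?_ (norm_nonneg _)
      have := norm_sub_norm_le (1 : ℂ) (-(β / α * Complex.exp (-(2 * θ : ℝ) * Complex.I)))
      rw [norm_neg, hn, sub_neg_eq_add, norm_one] at this
      exact this
    · refine mul_le_mul_of_nonneg_left ?_ (norm_nonneg _)
      have := norm_add_le (1 : ℂ) (β / α * Complex.exp (-(2 * θ : ℝ) * Complex.I))
      rw [hn, norm_one] at this
      exact this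
  refine ⟨lam, ψ, hlc, hψc, hpos, hbd.1, hbd.2, hlp, hper, ?_, ?_, hform⟩
  -- With radii chosen to give images of equal norm, injectivity of `B` yields `θ ≡ θ'` mod `2π`;
  -- the degree-one property of `ψ` then excludes a nonzero shift.
  · intro θ θ' h
    have h1 := hform (lam θ') θ
    have h2 := hform (lam θ) θ'
    rw [h, mul_comm, ← h2] at h1
    have h3 := (slPlane B).injective h1
    have h4 := congrArg norm h3
    rw [norm_polar (hpos _).le, norm_polar (hpos _).le] at h4
    rw [h4, polar_eq_iff (hpos _)] at h3
    obtain ⟨m, rfl⟩ := h3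
    rw [hper] at h
    linarith
  · have hp := Real.pi_pos
    have hbound : ∀ θ, |ψ θ - θ| ≤ 2 * Real.pi := by
      intro θ
      have h1 := Complex.abs_arg_le_pi α
      have h2 := Complex.abs_arg_le_pi (w θ)
      have : ψ θ - θ = α.arg + (w θ).arg := by simp only [hψ]; ring
      rw [this]
      exact (abs_add_le _ _).trans (by linarith)
    intro y
    have h1 := abs_le.1 (hbound (y - 2 * Real.pi))
    have h2 := abs_le.1 (hbound (y + 2 * Real.pi))
    have h3 : y ∈ Set.Icc (ψ (y - 2 * Real.pi)) (ψ (y + 2 * Real.pi)) :=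
      ⟨by linarith [h1.2], by linarith [h2.1]⟩
    obtain ⟨θ, -, hθ⟩ := intermediate_value_Icc (a := y - 2 * Real.pi) (b := y + 2 * Real.pi)
      (by linarith) hψc.continuousOn h3
    exact ⟨θ, hθ⟩

/-- Reparametrizing the cone by the polar lift of `A⁻¹` makes the development `A ∘ A⁻¹` in polar
coordinates, i.e. `polar` again. The lift has degree one, so it respects the period `2π(k+1)`; the
bounds on `lam` control the radii. -/
theorem IsConePoint.act {X : Type*} [TopologicalSpace X] {S : TranslationStructure X} {x : X}
    {k : ℕ} (h : S.IsConePoint x k) (A : Matrix.SpecialLinearGroup (Fin 2) ℝ) :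
    (S.act A).IsConePoint x k := by
  obtain ⟨ε, hε, P, hP0, hPc, hPi, hPn, hPd⟩ := h
  obtain ⟨lam, ψ, hlc, hψc, hpos, ⟨c, hc, hcl⟩, ⟨C, hC, hlC⟩, hlp, hper, hinj, hsurj, hform⟩ :=
    exists_polar_lift A⁻¹
  have hAA : ∀ z, slPlane A (slPlane A⁻¹ z) = z := by
    intro z
    have hdet := A.det_coe
    rw [Matrix.det_fin_two] at hdet
    rw [slPlane_apply, slPlane_apply]
    simp only [Matrix.SpecialLinearGroup.coe_inv, Matrix.adjugate_fin_two]
    apply Complex.ext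
    · simp; linear_combination z.re * hdet
    · simp; linear_combination z.im * hdet
  set u : ℝ × ℝ → ℝ × ℝ := fun q => (q.1 * lam q.2, ψ q.2) with hu
  have huc : Continuous u := by rw [hu]; fun_prop
  have hlt : ∀ r ∈ Set.Ico 0 (ε / C), ∀ θ, r * lam θ ∈ Set.Ico 0 ε := by
    intro r hr θ
    refine ⟨mul_nonneg hr.1 (hpos θ).le, ?_⟩
    calc r * lam θ ≤ r * C := mul_le_mul_of_nonneg_left (hlC θ) hr.1
      _ < ε := (lt_div_iff₀ hC).1 hr.2
  refine ⟨ε / C, div_pos hε hC, P ∘ u, ?_, ?_, ?_, ?_, ?_⟩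
  · intro θ
    simp [hu, hP0]
  · refine hPc.comp huc.continuousOn ?_
    rintro ⟨r, θ⟩ ⟨hr, -⟩
    exact ⟨hlt r hr θ, trivial⟩
  · intro r hr r' hr' θ θ'
    simp only [hu, Function.comp]
    rw [hPi _ (hlt r hr θ) _ (hlt r' hr' θ')]
    constructor
    · rintro ⟨h1, h2 | ⟨m, h2⟩⟩
      · have hr0 : r = 0 := (mul_eq_zero.1 h2).resolve_right (hpos θ).ne'
        rw [hr0, zero_mul] at h1
        have hr0' : r' = 0 := (mul_eq_zero.1 h1.symm).resolve_right (hpos θ').ne'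
        exact ⟨by rw [hr0, hr0'], Or.inl hr0⟩
      · have h3 : θ' = θ + ((m * (k + 1) : ℤ) : ℝ) * (2 * Real.pi) := by
          apply hinj
          rw [hper]
          push_cast
          linear_combination h2
        have h4 : lam θ' = lam θ := by rw [h3, hlp]
        rw [h4] at h1
        exact ⟨mul_right_cancel₀ (hpos θ).ne' h1, Or.inr ⟨m, by rw [h3]; push_cast; ring⟩⟩
    · rintro ⟨rfl, rfl | ⟨m, h2⟩⟩
      · simp
      · have h3 : θ' = θ + ((m * (k + 1) : ℤ) : ℝ) * (2 * Real.pi) := by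
          push_cast
          linear_combination h2
        have h4 : lam θ' = lam θ := by rw [h3, hlp]
        refine ⟨by rw [h4], Or.inr ⟨m, ?_⟩⟩
        rw [h3, hper]
        push_cast; ring
  · intro δ hδ hδε
    have hm : min ε (δ * c) ≤ ε := min_le_left _ _
    refine mem_of_superset (hPn (min ε (δ * c)) (lt_min hε (by positivity)) hm) ?_
    rintro _ ⟨⟨r, θ⟩, ⟨hr, -⟩, rfl⟩
    obtain ⟨θ', rfl⟩ := hsurj θ
    have hp := hpos θ'
    refine ⟨(r / lam θ', θ'), ⟨⟨div_nonneg hr.1 hp.le, ?_⟩, trivial⟩, ?_⟩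
    · rw [div_lt_iff₀ hp]
      exact (lt_of_lt_of_le hr.2 (min_le_right _ _)).trans_le
        (mul_le_mul_of_nonneg_left (hcl _) hδ.le)
    · simp [hu, div_mul_cancel₀ _ hp.ne']
  · have h1 := (hPd.comp (u := u) (D' := Set.Ioo 0 (ε / C) ×ˢ Set.univ) huc.continuousOn (by
      rintro ⟨r, θ⟩ ⟨hr, -⟩
      exact ⟨⟨mul_pos hr.1 (hpos θ), (hlt r ⟨hr.1.le, hr.2⟩ θ).2⟩, trivial⟩)).act A
    refine h1.congr (a := 0) (fun _ _ => rfl) ?_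
    rintro ⟨r, θ⟩ -
    simp only [hu, Function.comp, add_zero]
    rw [← hform, hAA]

end ConeAct

end TranslationStructure

/-! ### Projections to a torus -/

namespace TranslationStructure

/-- A continuous map `proj` from a translation surface to a torus, presented by a local
homeomorphic homomorphism `cov : ℂ → T`, which is a translation in charts and whose fibre over `0`
is the singular set. -/
structure TorusProjection {X : Type*} [TopologicalSpace X] (S : TranslationStructure X)
    (T : Type*) [TopologicalSpace T] [AddCommGroup T] where
  cov : ℂ →+ T
  proj : X → T
  isLocalHomeomorph_cov : IsLocalHomeomorph cov
  continuous_proj : Continuous proj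
  proj_eq_zero_iff : ∀ p, proj p = 0 ↔ p ∈ S.sing
  proj_sub : ∀ φ ∈ S.atlas, ∀ p ∈ φ.source, ∀ᶠ p' in 𝓝 p, proj p' - proj p = cov (φ p' - φ p)

namespace TorusProjection

variable {X Y T : Type*} [TopologicalSpace X] [TopologicalSpace Y] [TopologicalSpace T]
  [AddCommGroup T] {S : TranslationStructure X}

/-- The torus projection of `A X`. -/
noncomputable def act (q : S.TorusProjection T) (A : Matrix.SpecialLinearGroup (Fin 2) ℝ) :
    (S.act A).TorusProjection T where
  cov := q.cov.comp ((slPlane A).symm.toLinearEquiv.toLinearMap.toAddMonoidHom)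
  proj := q.proj
  isLocalHomeomorph_cov :=
    q.isLocalHomeomorph_cov.comp (slPlane A).symm.toHomeomorph.isLocalHomeomorph
  continuous_proj := q.continuous_proj
  proj_eq_zero_iff := q.proj_eq_zero_iff
  proj_sub := by
    rintro _ ⟨φ, hφ, rfl⟩ p hp
    filter_upwards [q.proj_sub φ hφ p hp] with p' hp'
    rw [hp']
    change _ = q.cov ((slPlane A).symm (slPlane A (φ p') - slPlane A (φ p)))
    rw [← map_sub, ContinuousLinearEquiv.symm_apply_apply]

theorem act_cov_apply (q : S.TorusProjection T) (A : Matrix.SpecialLinearGroup (Fin 2) ℝ) (z : ℂ) :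
    (q.act A).cov z = q.cov ((slPlane A).symm z) := rfl

variable (q : S.TorusProjection T)

theorem exists_injectivity_radius : ∃ δ > 0, ∀ z : ℂ, ‖z‖ < δ → q.cov z = 0 → z = 0 := by
  obtain ⟨e, he, hq⟩ := q.isLocalHomeomorph_cov 0
  obtain ⟨δ, hδ, hb⟩ := Metric.isOpen_iff.1 e.open_source 0 he
  refine ⟨δ, hδ, fun z hz h0 => ?_⟩
  refine e.injOn (hb (by simpa using hz)) he ?_
  rw [← hq, h0, map_zero]

theorem eventually_eq_zero : ∀ᶠ z in 𝓝 (0 : ℂ), q.cov z = 0 → z = 0 := by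
  obtain ⟨δ, hδ, h⟩ := q.exists_injectivity_radius
  filter_upwards [Metric.ball_mem_nhds (0 : ℂ) hδ] with z hz
  exact h z (by simpa using hz)

theorem eventually_proj_sub {g : Y → X} {f : Y → ℂ} {D : Set Y} (h : S.DevelopsAs g f D) {y : Y}
    (hy : y ∈ D) : ∀ᶠ y' in 𝓝[D] y, q.proj (g y') - q.proj (g y) = q.cov (f y' - f y) := by
  obtain ⟨φ, hφ, hs⟩ := S.exists_chart (g y) (h.2 y hy).1
  filter_upwards [(h.2 y hy).2 φ hφ hs, (h.1 y hy).eventually (q.proj_sub φ hφ _ hs)] with y' h1 h2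
  rw [h2, h1]

/-- The difference `proj ∘ g - cov ∘ f` is locally constant. -/
theorem proj_developsAs {g : Y → X} {f : Y → ℂ} {D : Set Y} (h : S.DevelopsAs g f D)
    (hD : IsPreconnected D) {y₀ : Y} (hy₀ : y₀ ∈ D) {y : Y} (hy : y ∈ D) :
    q.proj (g y) - q.cov (f y) = q.proj (g y₀) - q.cov (f y₀) := by
  have : PreconnectedSpace D := Subtype.preconnectedSpace hD
  have hlc : IsLocallyConstant fun y : D => q.proj (g y) - q.cov (f y) := by
    rw [IsLocallyConstant.iff_eventually_eq]
    rintro ⟨y, hy⟩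
    refine (preimage_coe_mem_nhds_subtype (a := ⟨y, hy⟩)
      (t := {y' | q.proj (g y') - q.cov (f y') = q.proj (g y) - q.cov (f y)})).2 ?_
    filter_upwards [q.eventually_proj_sub h hy] with y' hy'
    rw [map_sub] at hy'
    rw [sub_eq_sub_iff_sub_eq_sub, hy']
  exact hlc.apply_eq_of_preconnectedSpace ⟨y, hy⟩ ⟨y₀, hy₀⟩

/-- Converse used for lifts: in a chart, the increments of `g` and `f` differ by a small element of
the kernel of `cov`, which is discrete, so they agree. -/
theorem developsAs {g : Y → X} {f : Y → ℂ} {D : Set Y} (hg : ContinuousOn g D)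
    (hf : ContinuousOn f D) (h : ∀ y ∈ D, q.proj (g y) = q.cov (f y))
    (h0 : ∀ y ∈ D, q.cov (f y) ≠ 0) : S.DevelopsAs g f D := by
  refine ⟨hg, fun y hy => ⟨fun hs => h0 y hy ?_, fun φ hφ hs => ?_⟩⟩
  · rw [← h y hy]; exact (q.proj_eq_zero_iff _).2 hs
  · have hlim : Tendsto (fun y' => φ (g y') - φ (g y) - (f y' - f y)) (𝓝[D] y) (𝓝 0) := by
      have h1 : Tendsto (fun y' => φ (g y')) (𝓝[D] y) (𝓝 (φ (g y))) :=
        (φ.continuousAt hs).tendsto.comp (hg y hy)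
      have := (h1.sub_const (φ (g y))).sub ((hf y hy).tendsto.sub_const (f y))
      simpa using this
    filter_upwards [(hg y hy).eventually (q.proj_sub φ hφ _ hs), hlim.eventually
      q.eventually_eq_zero, self_mem_nhdsWithin] with y' h1 h2 h3
    refine sub_eq_zero.1 (h2 ?_)
    rw [map_sub, ← h1, h y' h3, h y hy, ← map_sub, sub_self]

end TorusProjection

/-! ### A square-tiled surface projects to the square torus -/

section Square

/-- The projection of the plane to the square torus of side `s`. -/
noncomputable def squareCov (s : ℝ) : ℂ →+ AddCircle s × AddCircle s where
  toFun z := (z.re, z.im)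
  map_zero' := by simp
  map_add' z w := by simp

theorem squareCov_apply (s : ℝ) (z : ℂ) :
    squareCov s z = ((z.re : AddCircle s), (z.im : AddCircle s)) := rfl

theorem isLocalHomeomorph_squareCov (s : ℝ) : IsLocalHomeomorph (squareCov s) := by
  have h := AddCircle.isLocalHomeomorph_coe s
  have hp : IsLocalHomeomorph fun p : ℝ × ℝ => ((p.1 : AddCircle s), (p.2 : AddCircle s)) := by
    rintro ⟨x, y⟩
    obtain ⟨e, he, hx⟩ := h x
    obtain ⟨e', he', hy⟩ := h y
    refine ⟨e.prod e', ⟨he, he'⟩, ?_⟩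
    rw [OpenPartialHomeomorph.prod_apply, ← hx, ← hy]
  exact hp.comp Complex.equivRealProdCLM.toHomeomorph.isLocalHomeomorph

theorem squareCov_eq_zero_iff {s : ℝ} {z : ℂ} :
    squareCov s z = 0 ↔ ∃ a b : ℤ, z = ⟨a * s, b * s⟩ := by
  rw [squareCov_apply, Prod.mk_eq_zero, AddCircle.coe_eq_zero_iff, AddCircle.coe_eq_zero_iff]
  constructor
  · rintro ⟨⟨a, ha⟩, ⟨b, hb⟩⟩
    exact ⟨a, b, by apply Complex.ext <;> simp [← ha, ← hb]⟩
  · rintro ⟨a, b, rfl⟩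
    exact ⟨⟨a, by simp⟩, ⟨b, by simp⟩⟩

theorem squareCov_eq_zero_of_mem_corners {s : ℝ} {z : ℂ} (hz : z ∈ corners s) :
    squareCov s z = 0 := by
  obtain ⟨h1 | h1, h2 | h2⟩ := hz <;> simp [squareCov_apply, h1, h2]

theorem int_mul_mem_Icc {s : ℝ} (hs : 0 < s) {a : ℤ} (h : (a : ℝ) * s ∈ Set.Icc 0 s) :
    (a : ℝ) * s = 0 ∨ (a : ℝ) * s = s := by
  have h1 : (0 : ℝ) ≤ a := nonneg_of_mul_nonneg_left h.1 hs
  have h2 : (a : ℝ) ≤ 1 := by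
    by_contra hc
    nlinarith [h.2]
  have h1' : 0 ≤ a := by exact_mod_cast h1
  have h2' : a ≤ 1 := by exact_mod_cast h2
  interval_cases a
  · left; simp
  · right; simp

theorem mem_corners_of_squareCov_eq_zero {s : ℝ} (hs : 0 < s) {z : ℂ} (hz : z ∈ square s)
    (h : squareCov s z = 0) : z ∈ corners s := by
  obtain ⟨a, b, rfl⟩ := squareCov_eq_zero_iff.1 h
  exact ⟨int_mul_mem_Icc hs hz.1, int_mul_mem_Icc hs hz.2⟩

theorem interior_square (s : ℝ) :
    interior (square s) = {z | z.re ∈ Set.Ioo 0 s ∧ z.im ∈ Set.Ioo 0 s} := by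
  have h : square s = Set.Icc 0 s ×ℂ Set.Icc 0 s := rfl
  rw [h, Complex.interior_reProdIm, interior_Icc]
  rfl

theorem isCompact_square (s : ℝ) : IsCompact (square s) := by
  have h : square s = Set.Icc 0 s ×ℂ Set.Icc 0 s := rfl
  rw [h]
  exact isCompact_Icc.reProdIm isCompact_Icc

variable {X : Type*} [TopologicalSpace X] {S : TranslationStructure X} {N : ℕ} {s : ℝ}
  {τ : Fin N → ℂ → X}

/-- Moving both points slightly along `ζ` keeps their images equal and brings both into the open
square, where tiles are injective and disjoint. -/
theorem eq_of_tile_eq_of_direction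
    (hint : ∀ i j, ∀ z ∈ interior (square s), ∀ w ∈ square s, τ i z = τ j w → i = j ∧ z = w)
    (hdev : ∀ i, S.DevelopsAs (τ i) id (square s \ corners s)) {i j : Fin N} {z w ζ : ℂ}
    (hz : z ∈ square s \ corners s) (hw : w ∈ square s \ corners s) (h : τ i z = τ j w)
    (hzζ : ∀ᶠ t : ℝ in 𝓝[>] 0, z + t * ζ ∈ interior (square s))
    (hwζ : ∀ᶠ t : ℝ in 𝓝[>] 0, w + t * ζ ∈ interior (square s)) : i = j ∧ z = w := by
  obtain ⟨φ, hφ, hs⟩ := S.exists_chart (τ i z) ((hdev i).2 z hz).1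
  have hs' : τ j w ∈ φ.source := h ▸ hs
  have hsub : interior (square s) ⊆ square s \ corners s := by
    intro y hy
    refine ⟨interior_subset hy, ?_⟩
    rw [interior_square] at hy
    rintro ⟨h1 | h1, -⟩
    · exact hy.1.1.ne' h1
    · exact hy.1.2.ne h1
  have hlim : ∀ v : ℂ, (∀ᶠ t : ℝ in 𝓝[>] 0, v + t * ζ ∈ interior (square s)) →
      Tendsto (fun t : ℝ => v + t * ζ) (𝓝[>] 0) (𝓝[square s \ corners s] v) := by
    intro v hv
    refine tendsto_nhdsWithin_iff.2 ⟨?_, hv.mono fun t ht => hsub ht⟩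
    have : Continuous fun t : ℝ => v + t * ζ := by fun_prop
    simpa using (this.tendsto 0).mono_left nhdsWithin_le_nhds
  have key := ((((hlim z hzζ).eventually ((hdev i).2 z hz |>.2 φ hφ hs)).and
    ((hlim w hwζ).eventually ((hdev j).2 w hw |>.2 φ hφ hs'))).and
    (((hlim z hzζ).eventually ((hdev i).1 z hz (φ.open_source.mem_nhds hs))).and
    ((hlim w hwζ).eventually ((hdev j).1 w hw (φ.open_source.mem_nhds hs'))))).and
    (hzζ.and hwζ)
  obtain ⟨t, ⟨⟨e1, e2⟩, m1, m2⟩, n1, n2⟩ := key.exists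
  have : τ i (z + t * ζ) = τ j (w + t * ζ) := by
    refine φ.injOn m1 m2 ?_
    simp only [id] at e1 e2
    rw [add_sub_cancel_left] at e1 e2
    rw [h] at e1
    exact sub_left_injective (e1.trans e2.symm)
  obtain ⟨h1, h2⟩ := hint i j _ n1 _ (interior_subset n2) this
  exact ⟨h1, add_right_cancel h2⟩

variable [T2Space X]

/-- If the images agreed, sliding both points along `d` would keep them equal by unique
continuation; at time `a` the second reaches a vertex, which is singular, while the first is still
regular. -/
theorem not_tile_eq_of_slide (hcont : ∀ i, ContinuousOn (τ i) (square s))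
    (hdev : ∀ i, S.DevelopsAs (τ i) id (square s \ corners s))
    (hcor : ∀ i, ∀ z ∈ corners s, τ i z ∈ S.sing) {i j : Fin N} {z w d : ℂ} {a : ℝ} (ha : 0 < a)
    (hz : ∀ t : ℝ, t ∈ Set.Icc 0 a → z + t * d ∈ square s \ corners s)
    (hw : ∀ t : ℝ, t ∈ Set.Ico 0 a → w + t * d ∈ square s \ corners s)
    (hwa : w + a * d ∈ square s) (hwc : w + a * d ∈ corners s) : τ i z ≠ τ j w := by
  intro h
  have hline : ∀ v : ℂ, Continuous fun t : ℝ => v + t * d := fun v => by fun_prop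
  have h1 : S.DevelopsAs (fun t : ℝ => τ i (z + t * d)) (fun t : ℝ => t * d) (Set.Ico 0 a) :=
    ((hdev i).comp (hline z).continuousOn fun t ht => hz t ⟨ht.1, ht.2.le⟩).congr
      (a := -z) (fun _ _ => rfl) (by simp)
  have h2 : S.DevelopsAs (fun t : ℝ => τ j (w + t * d)) (fun t : ℝ => t * d) (Set.Ico 0 a) :=
    ((hdev j).comp (hline w).continuousOn fun t ht => hw t ht).congr
      (a := -w) (fun _ _ => rfl) (by simp)
  have heq := h1.eqOn h2 isPreconnected_Ico (y₀ := 0) ⟨le_rfl, ha⟩ (by simpa using h)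
  have heq' := heq.of_subset_closure
    ((hcont i).comp (s := Set.Icc 0 a) (hline z).continuousOn fun t ht => (hz t ht).1)
    ((hcont j).comp (s := Set.Icc 0 a) (hline w).continuousOn fun t ht => by
      rcases ht.2.lt_or_eq with h | rfl
      · exact (hw t ⟨ht.1, h⟩).1
      · exact hwa) Set.Ico_subset_Icc_self (by rw [closure_Ico ha.ne])
  have hfin := heq' (Set.right_mem_Icc.2 ha.le)
  have hsing := hcor j _ hwc
  simp only at hfin
  rw [← hfin] at hsing
  exact ((hdev i).2 _ (hz a (Set.right_mem_Icc.2 ha.le))).1 hsing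

theorem exists_direction {s x y : ℝ} (hs : 0 < s) (hx : x ∈ Set.Icc 0 s) (hy : y ∈ Set.Icc 0 s)
    (h : ¬(x = 0 ∧ y = s)) (h' : ¬(y = 0 ∧ x = s)) :
    ∃ ζ : ℝ, (∀ᶠ t : ℝ in 𝓝[>] 0, x + t * ζ ∈ Set.Ioo 0 s) ∧
      ∀ᶠ t : ℝ in 𝓝[>] 0, y + t * ζ ∈ Set.Ioo 0 s := by
  have hup : ∀ v ∈ Set.Ico 0 s, ∀ᶠ t : ℝ in 𝓝[>] 0, v + t * 1 ∈ Set.Ioo 0 s := by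
    intro v hv
    filter_upwards [Ioo_mem_nhdsGT (sub_pos.2 hv.2)] with t ht
    exact ⟨by linarith [ht.1, hv.1], by linarith [ht.2]⟩
  have hdown : ∀ v ∈ Set.Ioc 0 s, ∀ᶠ t : ℝ in 𝓝[>] 0, v + t * (-1) ∈ Set.Ioo 0 s := by
    intro v hv
    filter_upwards [Ioo_mem_nhdsGT hv.1] with t ht
    exact ⟨by linarith [ht.2], by linarith [ht.1, hv.2]⟩
  by_cases hxs : x = s
  · have hy0 : y ≠ 0 := fun hy0 => h' ⟨hy0, hxs⟩
    exact ⟨-1, hdown x ⟨hxs ▸ hs, hx.2⟩, hdown y ⟨lt_of_le_of_ne hy.1 hy0.symm, hy.2⟩⟩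
  · by_cases hys : y = s
    · have hx0 : x ≠ 0 := fun hx0 => h ⟨hx0, hys⟩
      exact ⟨-1, hdown x ⟨lt_of_le_of_ne hx.1 hx0.symm, hx.2⟩, hdown y ⟨hys ▸ hs, hy.2⟩⟩
    · exact ⟨1, hup x ⟨hx.1, lt_of_le_of_ne hx.2 hxs⟩, hup y ⟨hy.1, lt_of_le_of_ne hy.2 hys⟩⟩

/-- Slide upwards: `w` reaches the top vertex of its vertical side strictly before `z` reaches the
top. -/
theorem not_tile_eq_of_im_lt (hcont : ∀ i, ContinuousOn (τ i) (square s))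
    (hdev : ∀ i, S.DevelopsAs (τ i) id (square s \ corners s))
    (hcor : ∀ i, ∀ z ∈ corners s, τ i z ∈ S.sing) {i j : Fin N} {z w : ℂ}
    (hz : z ∈ square s) (hw : w ∈ square s)
    (hwre : w.re = 0 ∨ w.re = s) (hzim : 0 < z.im) (hwim : w.im < s) (hzw : z.im < w.im) :
    τ i z ≠ τ j w := by
  refine not_tile_eq_of_slide hcont hdev hcor (d := Complex.I) (a := s - w.im) (by linarith)
    ?_ ?_ ?_ ?_
  · intro t ht
    refine ⟨⟨by simpa using hz.1, ?_⟩, ?_⟩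
    · simp only [Complex.add_im, Complex.mul_im, Complex.ofReal_re, Complex.I_im, Complex.ofReal_im,
        Complex.I_re]
      exact ⟨by linarith [ht.1], by linarith [ht.2]⟩
    · rintro ⟨-, h | h⟩
      · simp at h; linarith [ht.1]
      · simp at h; linarith [ht.2]
  · intro t ht
    refine ⟨⟨by simpa using hw.1, ?_⟩, ?_⟩
    · simp only [Complex.add_im, Complex.mul_im, Complex.ofReal_re, Complex.I_im, Complex.ofReal_im,
        Complex.I_re]
      exact ⟨by linarith [ht.1], by linarith [ht.2]⟩
    · rintro ⟨-, h | h⟩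
      · simp at h; linarith [ht.1]
      · simp at h; linarith [ht.2]
  · refine ⟨by simpa using hw.1, ?_⟩
    simp; linarith
  · exact ⟨by simpa using hwre, Or.inr (by simp)⟩

theorem not_tile_eq_of_re_lt (hcont : ∀ i, ContinuousOn (τ i) (square s))
    (hdev : ∀ i, S.DevelopsAs (τ i) id (square s \ corners s))
    (hcor : ∀ i, ∀ z ∈ corners s, τ i z ∈ S.sing) {i j : Fin N} {z w : ℂ}
    (hz : z ∈ square s) (hw : w ∈ square s)
    (hwim : w.im = 0 ∨ w.im = s) (hzre : 0 < z.re) (hwre : w.re < s) (hzw : z.re < w.re) :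
    τ i z ≠ τ j w := by
  refine not_tile_eq_of_slide hcont hdev hcor (d := 1) (a := s - w.re) (by linarith)
    ?_ ?_ ?_ ?_
  · intro t ht
    refine ⟨⟨?_, by simpa using hz.2⟩, ?_⟩
    · simp only [Complex.add_re, mul_one, Complex.ofReal_re]
      exact ⟨by linarith [ht.1], by linarith [ht.2]⟩
    · rintro ⟨h | h, -⟩
      · simp at h; linarith [ht.1]
      · simp at h; linarith [ht.2]
  · intro t ht
    refine ⟨⟨?_, by simpa using hw.2⟩, ?_⟩
    · simp only [Complex.add_re, mul_one, Complex.ofReal_re]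
      exact ⟨by linarith [ht.1], by linarith [ht.2]⟩
    · rintro ⟨h | h, -⟩
      · simp at h; linarith [ht.1]
      · simp at h; linarith [ht.2]
  · refine ⟨?_, by simpa using hw.2⟩
    simp; linarith
  · exact ⟨Or.inr (by simp), by simpa using hwim⟩

/-- This makes the torus projection well defined. Points identified across opposite sides have equal
positions along them, by sliding, and differ by one period transversally. Otherwise, unless both are
vertices, a common inward direction exists and the points coincide. -/
theorem squareCov_eq_of_tile_eq (hs : 0 < s) (hcont : ∀ i, ContinuousOn (τ i) (square s))
    (hint : ∀ i j, ∀ z ∈ interior (square s), ∀ w ∈ square s, τ i z = τ j w → i = j ∧ z = w)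
    (hdev : ∀ i, S.DevelopsAs (τ i) id (square s \ corners s))
    (hcor : ∀ i, ∀ z ∈ corners s, τ i z ∈ S.sing) {i j : Fin N} {z w : ℂ}
    (hz : z ∈ square s) (hw : w ∈ square s) (h : τ i z = τ j w) :
    squareCov s z = squareCov s w := by
  by_cases hzc : z ∈ corners s
  · have hwc : w ∈ corners s := by
      by_contra hwc
      exact ((hdev j).2 w ⟨hw, hwc⟩).1 (h ▸ hcor i z hzc)
    rw [squareCov_eq_zero_of_mem_corners hzc, squareCov_eq_zero_of_mem_corners hwc]
  have hwc : w ∉ corners s := fun hwc => ((hdev i).2 z ⟨hz, hzc⟩).1 (h ▸ hcor j w hwc)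
  have hre : ∀ {i j : Fin N} {z w : ℂ}, z ∈ square s → w ∈ square s → z ∉ corners s →
      w ∉ corners s → τ i z = τ j w → z.re = 0 ∧ w.re = s → squareCov s z = squareCov s w := by
    intro i j z w hz hw hzc hwc h ⟨h1, h2⟩
    have n1 : z.im ≠ 0 := fun h => hzc ⟨Or.inl h1, Or.inl h⟩
    have n2 : z.im ≠ s := fun h => hzc ⟨Or.inl h1, Or.inr h⟩
    have n3 : w.im ≠ 0 := fun h => hwc ⟨Or.inr h2, Or.inl h⟩
    have n4 : w.im ≠ s := fun h => hwc ⟨Or.inr h2, Or.inr h⟩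
    have himeq : z.im = w.im := by
      rcases lt_trichotomy z.im w.im with hlt | heq | hlt
      · exact absurd h (not_tile_eq_of_im_lt hcont hdev hcor hz hw (Or.inr h2)
          (lt_of_le_of_ne hz.2.1 n1.symm) (lt_of_le_of_ne hw.2.2 n4) hlt)
      · exact heq
      · exact absurd h.symm (not_tile_eq_of_im_lt hcont hdev hcor hw hz (Or.inl h1)
          (lt_of_le_of_ne hw.2.1 n3.symm) (lt_of_le_of_ne hz.2.2 n2) hlt)
    simp [squareCov_apply, h1, h2, himeq, AddCircle.coe_period]
  have him : ∀ {i j : Fin N} {z w : ℂ}, z ∈ square s → w ∈ square s → z ∉ corners s →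
      w ∉ corners s → τ i z = τ j w → z.im = 0 ∧ w.im = s → squareCov s z = squareCov s w := by
    intro i j z w hz hw hzc hwc h ⟨h1, h2⟩
    have n1 : z.re ≠ 0 := fun h => hzc ⟨Or.inl h, Or.inl h1⟩
    have n2 : z.re ≠ s := fun h => hzc ⟨Or.inr h, Or.inl h1⟩
    have n3 : w.re ≠ 0 := fun h => hwc ⟨Or.inl h, Or.inr h2⟩
    have n4 : w.re ≠ s := fun h => hwc ⟨Or.inr h, Or.inr h2⟩
    have hreeq : z.re = w.re := by
      rcases lt_trichotomy z.re w.re with hlt | heq | hlt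
      · exact absurd h (not_tile_eq_of_re_lt hcont hdev hcor hz hw (Or.inr h2)
          (lt_of_le_of_ne hz.1.1 n1.symm) (lt_of_le_of_ne hw.1.2 n4) hlt)
      · exact heq
      · exact absurd h.symm (not_tile_eq_of_re_lt hcont hdev hcor hw hz (Or.inl h1)
          (lt_of_le_of_ne hw.1.1 n3.symm) (lt_of_le_of_ne hz.1.2 n2) hlt)
    simp [squareCov_apply, h1, h2, hreeq, AddCircle.coe_period]
  by_cases c1 : z.re = 0 ∧ w.re = s
  · exact hre hz hw hzc hwc h c1
  by_cases c2 : w.re = 0 ∧ z.re = s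
  · exact (hre hw hz hwc hzc h.symm c2).symm
  by_cases c3 : z.im = 0 ∧ w.im = s
  · exact him hz hw hzc hwc h c3
  by_cases c4 : w.im = 0 ∧ z.im = s
  · exact (him hw hz hwc hzc h.symm c4).symm
  obtain ⟨ζ, a1, a2⟩ := exists_direction hs hz.1 hw.1 c1 c2
  obtain ⟨ξ, b1, b2⟩ := exists_direction hs hz.2 hw.2 c3 c4
  rw [(eq_of_tile_eq_of_direction (ζ := ⟨ζ, ξ⟩) hint hdev ⟨hz, hzc⟩ ⟨hw, hwc⟩ h ?_ ?_).2]
  · filter_upwards [a1, b1] with t h1 h2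
    rw [interior_square]
    exact ⟨by simpa using h1, by simpa using h2⟩
  · filter_upwards [a2, b2] with t h1 h2
    rw [interior_square]
    exact ⟨by simpa using h1, by simpa using h2⟩

/-- A surface tiled by squares with the vertices as singularities projects to the square torus,
and the fibre over the class of an interior point of the square has one point in each tile. -/
theorem IsSquareTiled.exists_torusProjection (h : S.IsSquareTiled N s) :
    ∃ q : S.TorusProjection (AddCircle s × AddCircle s), q.cov = squareCov s ∧
      ∀ z ∈ interior (square s), Nat.card {p // q.proj p = squareCov s z} = N := by
  obtain ⟨hs, τ, hcont, hcover, hint, hdev, hcor⟩ := h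
  -- An arbitrary, possibly discontinuous, choice of tile and preimage; `hwd` shows that the torus
  -- class does not depend on it.
  choose i z hz hiz using hcover
  have hwd : ∀ j, ∀ w ∈ square s, squareCov s (z (τ j w)) = squareCov s w := fun j w hw =>
    squareCov_eq_of_tile_eq hs hcont hint hdev hcor (hz _) hw (hiz _)
  have hcovc : Continuous (squareCov s) := (isLocalHomeomorph_squareCov s).continuous
  have hcc : ∀ (C : Set ℂ), IsClosed C → ∀ j, IsClosed (τ j '' (square s ∩ C)) := fun C hC j =>
    (((isCompact_square s).inter_right hC).image_of_continuousOn
      ((hcont j).mono Set.inter_subset_left)).isClosed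
  refine ⟨{ cov := squareCov s, proj := fun p => squareCov s (z p),
            isLocalHomeomorph_cov := isLocalHomeomorph_squareCov s,
            continuous_proj := ?_, proj_eq_zero_iff := ?_, proj_sub := ?_ }, rfl, ?_⟩
  · rw [continuous_iff_isClosed]
    intro C hC
    have : (fun p => squareCov s (z p)) ⁻¹' C = ⋃ j, τ j '' (square s ∩ squareCov s ⁻¹' C) := by
      ext p
      simp only [Set.mem_preimage, Set.mem_iUnion]
      constructor
      · intro hp
        exact ⟨i p, z p, ⟨hz p, hp⟩, hiz p⟩
      · rintro ⟨j, w, ⟨hw, hwC⟩, rfl⟩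
        rw [hwd j w hw]; exact hwC
    rw [this]
    exact isClosed_iUnion_of_finite fun j => hcc _ (hC.preimage hcovc) j
  · intro p
    constructor
    · intro hp
      rw [← hiz p]
      exact hcor _ _ (mem_corners_of_squareCov_eq_zero hs (hz p) hp)
    · intro hp
      by_contra h0
      have hzc : z p ∉ corners s := fun hc => h0 (squareCov_eq_zero_of_mem_corners hc)
      refine ((hdev (i p)).2 (z p) ⟨hz p, hzc⟩).1 ?_
      rw [hiz p]; exact hp
  · intro φ hφ p hp
    have hps := S.source_subset φ hφ hp
    -- The chosen tile may change near `p`, so the increment is checked for every tile and every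
    -- preimage. Within tile `j`, good neighbourhoods of the preimages of `p` form an open set `O`,
    -- and the image of the compact remainder is closed and misses `p`.
    suffices ∀ j, ∀ᶠ p' in 𝓝 p, ∀ w' ∈ square s, τ j w' = p' →
        squareCov s (φ p' - φ p) = squareCov s w' - squareCov s (z p) by
      filter_upwards [eventually_all.2 this] with p' hp'
      exact (hp' (i p') (z p') (hz p') (hiz p')).symm
    intro j
    have hloc : ∀ w ∈ square s, τ j w = p → ∃ U : Set ℂ, IsOpen U ∧ w ∈ U ∧
        ∀ w' ∈ U ∩ square s, squareCov s (φ (τ j w') - φ p) =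
          squareCov s w' - squareCov s (z p) := by
      intro w hw hwp
      have hwc : w ∉ corners s := fun hc => hps (hwp ▸ hcor j w hc)
      have hcl : IsClosed (corners s) := by
        have e : corners s = Complex.re ⁻¹' {0, s} ∩ Complex.im ⁻¹' {0, s} := by
          ext; simp [corners]
        rw [e]
        exact ((Set.toFinite _).isClosed.preimage Complex.continuous_re).inter
          ((Set.toFinite _).isClosed.preimage Complex.continuous_im)
      have hev := ((hdev j).2 w ⟨hw, hwc⟩).2 φ hφ (by rw [hwp]; exact hp)
      obtain ⟨U, hU, hwU, hUs⟩ := mem_nhdsWithin.1 hev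
      refine ⟨U ∩ (corners s)ᶜ, hU.inter hcl.isOpen_compl, ⟨hwU, hwc⟩, ?_⟩
      rintro w' ⟨⟨hw'U, hw'c⟩, hw's⟩
      have h1 : φ (τ j w') - φ (τ j w) = w' - w := hUs ⟨hw'U, hw's, hw'c⟩
      rw [← hwp, h1, map_sub, hwd j w hw]
    choose! U hU hwU hUs using hloc
    set O : Set ℂ := ⋃ w ∈ {w | w ∈ square s ∧ τ j w = p}, U w with hO
    have hOo : IsOpen O := isOpen_biUnion fun w hw => hU w hw.1 hw.2
    have hK := hcc Oᶜ hOo.isClosed_compl j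
    have hpK : p ∈ (τ j '' (square s ∩ Oᶜ))ᶜ := by
      rintro ⟨w, ⟨hw, hwO⟩, hwp⟩
      exact hwO (Set.mem_biUnion (x := w) ⟨hw, hwp⟩ (hwU w hw hwp))
    filter_upwards [hK.isOpen_compl.mem_nhds hpK] with p' hp' w' hw' hw'p
    have hw'O : w' ∈ O := by
      by_contra hc
      exact hp' ⟨w', ⟨hw', hc⟩, hw'p⟩
    obtain ⟨w, ⟨hw, hwp⟩, hw'U⟩ := Set.mem_iUnion₂.1 hw'O
    rw [← hw'p]
    exact hUs w hw hwp w' ⟨hw'U, hw'⟩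
  · intro y hy
    have hys := interior_subset hy
    refine Eq.trans (Nat.card_congr (Equiv.ofBijective (fun j => ⟨τ j y, hwd j y hys⟩) ⟨?_, ?_⟩).symm)
      (Nat.card_fin N)
    · intro j j' hj
      exact (hint j j' y hy y hys (congrArg Subtype.val hj)).1
    · rintro ⟨p, hp⟩
      refine ⟨i p, Subtype.ext ?_⟩
      have hyz : z p = y := by
        have hp' : squareCov s (z p) = squareCov s y := hp
        have h0 : squareCov s (z p - y) = 0 := by rw [map_sub, hp', sub_self]
        obtain ⟨a, b, hab⟩ := squareCov_eq_zero_iff.1 h0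
        rw [interior_square] at hy
        -- Congruent mod `s`, with one of the two strictly inside the interval, forces equality;
        -- this is why the fibre is counted over an interior point.
        have hcomp : ∀ (u v : ℝ) (m : ℤ), u ∈ Set.Icc 0 s → v ∈ Set.Ioo 0 s → u - v = m * s →
            u = v := by
          intro u v m hu hv huv
          have h1 : (m : ℝ) < 1 := by
            by_contra hc
            nlinarith [hu.2, hv.1]
          have h2 : (-1 : ℝ) < m := by
            by_contra hc
            nlinarith [hu.1, hv.2]
          have h1' : m < 1 := by exact_mod_cast h1
          have h2' : -1 < m := by exact_mod_cast h2
          have : m = 0 := by omega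
          rw [this] at huv
          simp at huv
          linarith
        apply Complex.ext
        · exact hcomp _ _ a (hz p).1 hy.1 (by simpa using congrArg Complex.re hab)
        · exact hcomp _ _ b (hz p).2 hy.2 (by simpa using congrArg Complex.im hab)
      change τ (i p) y = p
      rw [← hyz, hiz]

end Square

end TranslationStructure

/-! ### Uniform cone coordinates and the number of sheets -/

namespace TranslationStructure

/-- Cone coordinates of a common radius around all singularities of a surface, all of whose
cone angles are `2π(k+1)`. -/
structure ConeAtlas {X : Type*} [TopologicalSpace X] (S : TranslationStructure X) (k : ℕ) where
  radius : ℝ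
  radius_pos : 0 < radius
  chart : S.sing → ℝ × ℝ → X
  chart_zero : ∀ (x : S.sing) (θ : ℝ), chart x (0, θ) = x
  continuousOn_chart : ∀ x, ContinuousOn (chart x) (Set.Ico 0 radius ×ˢ Set.univ)
  chart_eq_iff : ∀ x, ∀ r ∈ Set.Ico 0 radius, ∀ r' ∈ Set.Ico 0 radius, ∀ θ θ' : ℝ,
    chart x (r, θ) = chart x (r', θ') ↔
      r = r' ∧ (r = 0 ∨ ∃ m : ℤ, θ' - θ = m * (2 * Real.pi * (k + 1)))
  image_mem_nhds : ∀ x : S.sing, chart x '' (Set.Ico 0 radius ×ˢ Set.univ) ∈ 𝓝 (x : X)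
  developsAs : ∀ x, S.DevelopsAs (chart x) polar (Set.Ioo 0 radius ×ˢ Set.univ)

theorem exists_coneAtlas {X : Type*} [TopologicalSpace X] (S : TranslationStructure X) {k : ℕ}
    (h : ∀ x ∈ S.sing, S.IsConePoint x k) {η : ℝ} (hη : 0 < η) :
    ∃ C : S.ConeAtlas k, C.radius ≤ η := by
  have : Finite S.sing := S.finite_sing
  choose ε hε P h0 hc hi hn hd using fun x : S.sing => h x x.2
  have hev : ∀ᶠ m : ℝ in 𝓝[>] 0, ∀ x, m ≤ ε x :=
    eventually_all.2 fun x => by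
      filter_upwards [Ioo_mem_nhdsGT (hε x)] with m hm using hm.2.le
  obtain ⟨m, hm, hmη⟩ := (hev.and (Ioo_mem_nhdsGT hη)).exists
  have hsub : ∀ x, Set.Ico 0 m ⊆ Set.Ico 0 (ε x) := fun x => Set.Ico_subset_Ico_right (hm x)
  exact ⟨{ radius := m
           radius_pos := hmη.1
           chart := P
           chart_zero := h0
           continuousOn_chart := fun x => (hc x).mono (Set.prod_mono (hsub x) subset_rfl)
           chart_eq_iff := fun x r hr r' hr' => hi x r (hsub x hr) r' (hsub x hr')
           image_mem_nhds := fun x => hn x m hmη.1 (hm x)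
           developsAs := fun x => (hd x).mono
            (Set.prod_mono (Set.Ioo_subset_Ioo_right (hm x)) subset_rfl) }, hmη.2.le⟩

namespace ConeAtlas

variable {X T : Type*} [TopologicalSpace X] [TopologicalSpace T] [AddCommGroup T]
  {S : TranslationStructure X} {k : ℕ} (C : S.ConeAtlas k) (q : S.TorusProjection T)

theorem chart_add_period (x : S.sing) {r : ℝ} (hr : r ∈ Set.Ico 0 C.radius) (θ : ℝ) (m : ℤ) :
    C.chart x (r, θ + m * (2 * Real.pi * (k + 1))) = C.chart x (r, θ) :=
  ((C.chart_eq_iff x r hr r hr _ _).2 ⟨rfl, Or.inr ⟨m, by ring⟩⟩).symm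

/-- The difference is constant on the punctured cone, and along each ray it tends to its value `0`
at the apex. -/
theorem proj_chart [IsTopologicalAddGroup T] [T2Space T] (x : S.sing) {r : ℝ}
    (hr : r ∈ Set.Ico 0 C.radius) (θ : ℝ) : q.proj (C.chart x (r, θ)) = q.cov (polar (r, θ)) := by
  have h0 : q.proj (C.chart x (0, θ)) - q.cov (polar (0, θ)) = 0 := by
    rw [C.chart_zero, (q.proj_eq_zero_iff _).2 x.2]
    simp [polar]
  rcases hr.1.eq_or_lt with rfl | hr0
  · exact sub_eq_zero.1 h0
  have hcont : ContinuousOn (fun r : ℝ => q.proj (C.chart x (r, θ)) - q.cov (polar (r, θ)))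
      (Set.Ico 0 C.radius) := by
    refine ContinuousOn.sub ?_ ?_
    · exact q.continuous_proj.comp_continuousOn ((C.continuousOn_chart x).comp
        (by fun_prop) fun r hr => ⟨hr, trivial⟩)
    · exact (q.isLocalHomeomorph_cov.continuous.comp (continuous_polar.comp
        (by fun_prop))).continuousOn
  have hlim := (hcont 0 ⟨le_rfl, C.radius_pos⟩).mono_left
    (nhdsWithin_mono 0 (Set.Ioo_subset_Ico_self))
  simp only [nhdsWithin_Ioo_eq_nhdsGT C.radius_pos, h0] at hlim
  have hconst : ∀ᶠ r' : ℝ in 𝓝[>] 0, q.proj (C.chart x (r', θ)) - q.cov (polar (r', θ)) =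
      q.proj (C.chart x (r, θ)) - q.cov (polar (r, θ)) := by
    filter_upwards [Ioo_mem_nhdsGT C.radius_pos] with r' hr'
    exact q.proj_developsAs (C.developsAs x) (isPreconnected_Ioo.prod isPreconnected_univ)
      (y₀ := (r, θ)) ⟨⟨hr0, hr.2⟩, trivial⟩ ⟨hr', trivial⟩
  exact sub_eq_zero.1 (tendsto_nhds_unique (tendsto_const_nhds.congr' (hconst.mono
    fun _ h => h.symm)) hlim)

/-- The radius of the cone coordinates is small compared to the torus. -/
def IsSmall : Prop := ∀ z : ℂ, ‖z‖ < 2 * C.radius → q.cov z = 0 → z = 0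

variable {C q}

theorem IsSmall.eq (hC : C.IsSmall q) {z w : ℂ} (hz : ‖z‖ < C.radius) (hw : ‖w‖ < C.radius)
    (h : q.cov z = q.cov w) : z = w := by
  refine sub_eq_zero.1 (hC _ ?_ (by rw [map_sub, h, sub_self]))
  exact (norm_sub_le _ _).trans_lt (by linarith)

theorem IsSmall.polar_eq [IsTopologicalAddGroup T] [T2Space T] (hC : C.IsSmall q) {x y : S.sing}
    {r r' θ θ' : ℝ} (hr : r ∈ Set.Ico 0 C.radius) (hr' : r' ∈ Set.Ico 0 C.radius)
    (h : C.chart x (r, θ) = C.chart y (r', θ')) : polar (r, θ) = polar (r', θ') := by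
  have := congrArg q.proj h
  rw [C.proj_chart q x hr, C.proj_chart q y hr'] at this
  exact hC.eq (by rw [norm_polar hr.1]; exact hr.2) (by rw [norm_polar hr'.1]; exact hr'.2) this

theorem developsAs_ray (C : S.ConeAtlas k) (x : S.sing) {v : ℂ} {θ : ℝ} (hv : v ≠ 0)
    (hθ : polar (‖v‖, θ) = v) : S.DevelopsAs (fun t : ℝ => C.chart x (t * ‖v‖, θ))
      (fun t : ℝ => t * v) (Set.Ioo 0 (C.radius / ‖v‖)) := by
  have hv' : 0 < ‖v‖ := norm_pos_iff.2 hv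
  refine ((C.developsAs x).comp (u := fun t : ℝ => (t * ‖v‖, θ)) (by fun_prop) ?_).congr (a := 0)
    (fun _ _ => rfl) ?_
  · intro t ht
    exact ⟨⟨mul_pos ht.1 hv', (lt_div_iff₀ hv').1 ht.2⟩, trivial⟩
  · intro t _
    simp only [Function.comp]
    rw [polar_smul, hθ, add_zero]

theorem tendsto_ray (C : S.ConeAtlas k) (x : S.sing) (a θ : ℝ) (ha : 0 < a) :
    Tendsto (fun t : ℝ => C.chart x (t * a, θ)) (𝓝[>] 0) (𝓝 (x : X)) := by
  have h := (C.continuousOn_chart x) (0, θ) ⟨⟨le_rfl, C.radius_pos⟩, trivial⟩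
  rw [ContinuousWithinAt, C.chart_zero] at h
  refine h.comp (tendsto_nhdsWithin_iff.2 ⟨?_, ?_⟩)
  · have : Continuous fun t : ℝ => (t * a, θ) := by fun_prop
    simpa using (this.tendsto 0).mono_left nhdsWithin_le_nhds
  · filter_upwards [Ioo_mem_nhdsGT (div_pos C.radius_pos ha)] with t ht
    exact ⟨⟨(mul_pos ht.1 ha).le, (lt_div_iff₀ ha).1 ht.2⟩, trivial⟩

variable [IsTopologicalAddGroup T] [T2Space T]

/-- By compactness the complement of the cone neighbourhoods has closed image missing `0`, so any
point projecting close to `0` lies in some cone. -/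
theorem IsSmall.exists_chart_eq [CompactSpace X] (hC : C.IsSmall q) : ∃ η > 0, η ≤ C.radius ∧
    ∀ (p : X) (z : ℂ), z ≠ 0 → ‖z‖ < η → q.proj p = q.cov z →
      ∃ (x : S.sing) (θ : ℝ), p = C.chart x (‖z‖, θ) ∧ polar (‖z‖, θ) = z := by
  set O : Set X := ⋃ x, interior (C.chart x '' (Set.Ico 0 C.radius ×ˢ Set.univ)) with hO
  have hOo : IsOpen O := isOpen_iUnion fun x => isOpen_interior
  have hcl : IsClosed (q.proj '' Oᶜ) := q.continuous_proj.isClosedMap _ hOo.isClosed_compl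
  have h0 : (0 : T) ∈ (q.proj '' Oᶜ)ᶜ := by
    rintro ⟨p, hp, hp0⟩
    have hs := (q.proj_eq_zero_iff p).1 hp0
    exact hp (Set.mem_iUnion.2 ⟨⟨p, hs⟩, mem_interior_iff_mem_nhds.2 (C.image_mem_nhds ⟨p, hs⟩)⟩)
  have hev : ∀ᶠ z in 𝓝 (0 : ℂ), q.cov z ∈ (q.proj '' Oᶜ)ᶜ :=
    (q.isLocalHomeomorph_cov.continuous.tendsto 0).eventually
      (by rw [map_zero]; exact hcl.isOpen_compl.mem_nhds h0)
  obtain ⟨η, hη, hb⟩ := Metric.eventually_nhds_iff.1 hev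
  refine ⟨min η C.radius, lt_min hη C.radius_pos, min_le_right _ _, fun p z hz hzη hp => ?_⟩
  have hpO : p ∈ O := by
    by_contra hc
    exact hb (y := z) (by simpa using hzη.trans_le (min_le_left _ _)) ⟨p, hc, hp⟩
  obtain ⟨x, hx⟩ := Set.mem_iUnion.1 hpO
  obtain ⟨⟨r, θ⟩, ⟨hr, -⟩, rfl⟩ := interior_subset hx
  rw [C.proj_chart q x hr] at hp
  have hpz := hC.eq (by rw [norm_polar hr.1]; exact hr.2) (hzη.trans_le (min_le_right _ _)) hp
  have hrz : r = ‖z‖ := by rw [← hpz, norm_polar hr.1]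
  subst hrz
  exact ⟨x, θ, rfl, hpz⟩

variable [T2Space X]

/-- The projection fixes radius and direction. The two rays through the common point then coincide
back to their apexes, which identifies the singularities; the angles agree modulo the period. -/
theorem IsSmall.chart_eq (hC : C.IsSmall q) {x y : S.sing} {r r' θ θ' : ℝ}
    (hr : r ∈ Set.Ioo 0 C.radius) (hr' : r' ∈ Set.Ioo 0 C.radius)
    (h : C.chart x (r, θ) = C.chart y (r', θ')) :
    x = y ∧ r = r' ∧ ∃ m : ℤ, θ' - θ = m * (2 * Real.pi * (k + 1)) := by
  have hri := Set.Ioo_subset_Ico_self hr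
  have hri' := Set.Ioo_subset_Ico_self hr'
  have hpol := hC.polar_eq hri hri' h
  have hrr : r = r' := by
    have := congrArg norm hpol
    rwa [norm_polar hr.1.le, norm_polar hr'.1.le] at this
  subst hrr
  have hxy : x = y := by
    have hn : ‖polar (r, θ)‖ = r := norm_polar hr.1.le _
    have hv : polar (r, θ) ≠ 0 := norm_pos_iff.1 (by rw [hn]; exact hr.1)
    have h1 := C.developsAs_ray x (v := polar (r, θ)) (θ := θ) hv (by rw [hn])
    have h2 := C.developsAs_ray y (v := polar (r, θ)) (θ := θ') hv (by rw [hn, hpol])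
    rw [hn] at h1 h2
    have hlt : 1 < C.radius / r := (one_lt_div hr.1).2 hr.2
    have heq := h1.eqOn h2 isPreconnected_Ioo (y₀ := 1) ⟨one_pos, hlt⟩ (by simpa using h)
    have t1 := C.tendsto_ray x r θ hr.1
    have t2 := C.tendsto_ray y r θ' hr.1
    refine Subtype.ext (tendsto_nhds_unique t1 (t2.congr' ?_))
    filter_upwards [Ioo_mem_nhdsGT (one_pos.trans hlt)] with t ht using (heq ht).symm
  subst hxy
  obtain ⟨-, h0 | hm⟩ := (C.chart_eq_iff x r hri r hri _ _).1 h
  · exact absurd h0 hr.1.ne'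
  · exact ⟨rfl, rfl, hm⟩

variable [CompactSpace X]

theorem exists_fin_angle (k : ℕ) (m : ℤ) :
    ∃ (j : Fin (k + 1)) (l : ℤ), m = (j : ℕ) + l * (k + 1) := by
  have hk : (0 : ℤ) < k + 1 := by positivity
  have h1 := Int.emod_nonneg m hk.ne'
  have h2 := Int.emod_lt_of_pos m hk
  refine ⟨⟨(m % (k + 1)).toNat, by omega⟩, m / (k + 1), ?_⟩
  simp only
  rw [Int.toNat_of_nonneg h1]
  linarith [Int.emod_add_mul_ediv m (k + 1)]

theorem fin_angle_injective {k : ℕ} {j j' : Fin (k + 1)} {l : ℤ}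
    (h : ((j' : ℕ) : ℤ) - (j : ℕ) = l * (k + 1)) : j = j' := by
  have hj := j.2
  have hj' := j'.2
  have : l = 0 := by
    by_contra hl
    rcases lt_or_gt_of_ne hl with hl | hl <;> nlinarith
  subst this
  ext
  omega

/-- The number of sheets of the torus projection. -/
theorem IsSmall.exists_card_fiber (hC : C.IsSmall q) : ∃ η > 0, ∀ z : ℂ, z ≠ 0 → ‖z‖ < η →
    Nat.card {p // q.proj p = q.cov z} = S.sing.ncard * (k + 1) := by
  obtain ⟨η, hη, hηC, hsurj⟩ := hC.exists_chart_eq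
  refine ⟨η, hη, fun z hz hzη => ?_⟩
  have hr : ‖z‖ ∈ Set.Ioo 0 C.radius := ⟨norm_pos_iff.2 hz, hzη.trans_le hηC⟩
  have hri := Set.Ioo_subset_Ico_self hr
  let F : S.sing × Fin (k + 1) → {p // q.proj p = q.cov z} := fun a =>
    ⟨C.chart a.1 (‖z‖, z.arg + ((a.2 : ℕ) : ℤ) * (2 * Real.pi)), by
      rw [C.proj_chart q _ hri, polar_add_int, polar_norm_arg]⟩
  have hF : Function.Bijective F := by
    constructor
    · rintro ⟨x, j⟩ ⟨x', j'⟩ h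
      obtain ⟨h1, -, m, hm⟩ := hC.chart_eq hr hr (congrArg Subtype.val h)
      refine Prod.ext h1 (fin_angle_injective (l := m) ?_)
      have hp : (2 * Real.pi) ≠ 0 := by positivity
      have : (((j' : ℕ) : ℝ) - (j : ℕ)) = m * (k + 1) := by
        apply mul_right_cancel₀ hp
        push_cast at hm
        linear_combination hm
      exact_mod_cast this
    · rintro ⟨p, hp⟩
      obtain ⟨x, θ, rfl, hθ⟩ := hsurj p z hz hzη hp
      obtain ⟨m, hm⟩ := (polar_eq_iff (θ := z.arg) hr.1).1 (hθ.trans (polar_norm_arg z).symm)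
      obtain ⟨j, l, rfl⟩ := exists_fin_angle k m
      refine ⟨⟨x, j⟩, Subtype.ext ?_⟩
      simp only [F]
      rw [← C.chart_add_period x hri _ l, hm]
      congr 2
      push_cast
      ring
  rw [← Nat.card_congr (Equiv.ofBijective F hF), Nat.card_prod, Nat.card_fin,
    Nat.card_coe_set_eq]

end ConeAtlas

theorem exists_small_coneAtlas {X T : Type*} [TopologicalSpace X] [TopologicalSpace T]
    [AddCommGroup T] {S : TranslationStructure X} {k : ℕ} (q : S.TorusProjection T)
    (h : ∀ x ∈ S.sing, S.IsConePoint x k) : ∃ C : S.ConeAtlas k, C.IsSmall q := by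
  obtain ⟨δ, hδ, hinj⟩ := q.exists_injectivity_radius
  obtain ⟨C, hC⟩ := S.exists_coneAtlas h (half_pos hδ)
  exact ⟨C, fun z hz => hinj z (by linarith)⟩

/-- Comparing the two ways to count sheets of the projection to the square torus. -/
theorem IsSquareTiled.eq_ncard_mul {X : Type*} [TopologicalSpace X] [T2Space X] [CompactSpace X]
    {S : TranslationStructure X} {N k : ℕ} {s : ℝ} (h : S.IsSquareTiled N s)
    (hcone : ∀ x ∈ S.sing, S.IsConePoint x k) : N = S.sing.ncard * (k + 1) := by
  have hs := h.1
  obtain ⟨q, hq, hcard⟩ := h.exists_torusProjection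
  obtain ⟨C, hC⟩ := exists_small_coneAtlas q hcone
  obtain ⟨η, hη, hfib⟩ := hC.exists_card_fiber
  -- A small diagonal point lies both inside the square, where the fibre has `N` points, and near
  -- `0`, where it has `n(k+1)`.
  have hev : ∀ᶠ t : ℝ in 𝓝[>] 0, ‖(⟨t, t⟩ : ℂ)‖ < η := by
    have hc : Continuous fun t : ℝ => (⟨t, t⟩ : ℂ) := by
      have : (fun t : ℝ => (⟨t, t⟩ : ℂ)) = fun t : ℝ => (t : ℂ) * ⟨1, 1⟩ := by
        ext t; apply Complex.ext <;> simp
      rw [this]; fun_prop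
    have h0 := (hc.norm.tendsto 0).mono_left (nhdsWithin_le_nhds (s := Set.Ioi 0))
    refine h0.eventually (gt_mem_nhds ?_)
    have : (⟨0, 0⟩ : ℂ) = 0 := rfl
    rw [this, norm_zero]
    exact hη
  obtain ⟨t, ht, hts⟩ := (hev.and (Ioo_mem_nhdsGT hs)).exists
  rw [← hcard ⟨t, t⟩ (by rw [interior_square]; exact ⟨hts, hts⟩), ← hq]
  exact hfib _ (fun h0 => hts.1.ne' (congrArg Complex.re h0)) ht

end TranslationStructure

/-! ### Saddle connections as lifts of primitive lattice vectors -/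

namespace TranslationStructure

theorem DevelopsAs.eventually_sub_eq {X Y : Type*} [TopologicalSpace X] [TopologicalSpace Y]
    {S : TranslationStructure X} {g : Y → X} {f f' : Y → ℂ} {D : Set Y} (h : S.DevelopsAs g f D)
    (h' : S.DevelopsAs g f' D) {y : Y} (hy : y ∈ D) :
    ∀ᶠ y' in 𝓝[D] y, f y' - f y = f' y' - f' y := by
  obtain ⟨φ, hφ, hs⟩ := S.exists_chart (g y) (h.2 y hy).1
  filter_upwards [(h.2 y hy).2 φ hφ hs, (h'.2 y hy).2 φ hφ hs] with y' h1 h2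
  rw [← h1, h2]

namespace TorusProjection

variable {X T : Type*} [TopologicalSpace X] [TopologicalSpace T] [AddCommGroup T]
  {S : TranslationStructure X} (q : S.TorusProjection T)

/-- Near a regular point the projection is a recentred chart followed by `cov` and a translation. -/
theorem isLocalHomeomorphOn_proj [IsTopologicalAddGroup T] :
    IsLocalHomeomorphOn q.proj (q.proj ⁻¹' {0}ᶜ) := by
  refine IsLocalHomeomorphOn.mk _ _ fun p hp => ?_
  have hps : p ∈ S.singᶜ := fun h => hp ((q.proj_eq_zero_iff p).2 h)
  obtain ⟨φ, hφ, hs⟩ := S.exists_chart p hps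
  obtain ⟨e, he, hcov⟩ := q.isLocalHomeomorph_cov 0
  obtain ⟨U, hU, hUo, hpU⟩ := eventually_nhds_iff.1 (q.proj_sub φ hφ p hs)
  refine ⟨(((φ.restrOpen U hUo).trans (Homeomorph.subRight (φ p)).toOpenPartialHomeomorph).trans
    e).trans (Homeomorph.addRight (q.proj p)).toOpenPartialHomeomorph, ?_, ?_⟩
  · simp [hs, hpU, he]
  · intro p' hp'
    have hp'U : p' ∈ U := by
      simp at hp'
      exact hp'.1.2
    have := hU p' hp'U
    rw [hcov] at this
    simp [← this]

theorem isCoveringMapOn_proj [IsTopologicalAddGroup T] [T2Space T] [T2Space X] [CompactSpace X] :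
    IsCoveringMapOn q.proj {0}ᶜ :=
  IsCoveringMapOn.of_isLocalHomeomorphOn q.continuous_proj q.isLocalHomeomorphOn_proj

/-- A path whose projection tends to `0` converges to a singularity. -/
theorem exists_tendsto_sing [T2Space T] [T2Space X] [CompactSpace X] {G : ℝ → X} {a b : ℝ}
    (hab : a < b) (hG : ContinuousOn G (Set.Ioo a b))
    (h0 : Tendsto (fun t => q.proj (G t)) (𝓝[<] b) (𝓝 0)) :
    ∃ y ∈ S.sing, Tendsto G (𝓝[<] b) (𝓝 y) := by
  -- By compactness the path finally stays in the union of the disjoint neighbourhoods, and by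
  -- connectedness in a single one.
  have key : ∀ W : X → Set X, (∀ x ∈ S.sing, x ∈ W x) → (∀ x, IsOpen (W x)) →
      S.sing.PairwiseDisjoint W → ∃ x ∈ S.sing, ∀ᶠ t in 𝓝[<] b, G t ∈ W x := by
    intro W hxW hW hdisj
    have hO : IsOpen (⋃ x ∈ S.sing, W x) := isOpen_biUnion fun x _ => hW x
    have hcl : IsClosed (q.proj '' (⋃ x ∈ S.sing, W x)ᶜ) :=
      q.continuous_proj.isClosedMap _ hO.isClosed_compl
    have hev : ∀ᶠ t in 𝓝[<] b, G t ∈ ⋃ x ∈ S.sing, W x := by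
      refine (h0.eventually (hcl.isOpen_compl.mem_nhds ?_)).mono fun t ht => ?_
      · rintro ⟨p, hp, hp0⟩
        have hps := (q.proj_eq_zero_iff p).1 hp0
        exact hp (Set.mem_biUnion hps (hxW p hps))
      · by_contra hc
        exact ht ⟨G t, hc, rfl⟩
    obtain ⟨c, hc, hcs⟩ := (mem_nhdsLT_iff_exists_Ioo_subset' hab).1 hev
    set d := max a c with hd
    have hdb : d < b := max_lt hab hc
    have hsub : ∀ t ∈ Set.Ioo d b, G t ∈ ⋃ x ∈ S.sing, W x := fun t ht =>
      hcs ⟨(le_max_right _ _).trans_lt ht.1, ht.2⟩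
    obtain ⟨t₀, ht₀⟩ : (Set.Ioo d b).Nonempty := Set.nonempty_Ioo.2 hdb
    obtain ⟨x, hx, hxt⟩ := Set.mem_iUnion₂.1 (hsub t₀ ht₀)
    refine ⟨x, hx, ?_⟩
    have hpre : IsPreconnected (G '' Set.Ioo d b) :=
      isPreconnected_Ioo.image _ (hG.mono (Set.Ioo_subset_Ioo_left (le_max_left _ _)))
    have hdis : Disjoint (W x) (⋃ y ∈ S.sing \ {x}, W y) := by
      rw [Set.disjoint_iUnion₂_right]
      intro y hy
      exact hdisj hx hy.1 (Ne.symm hy.2)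
    have hle := hpre.subset_left_of_subset_union (hW x)
      (isOpen_biUnion fun y (_ : y ∈ S.sing \ {x}) => hW y) hdis ?_
      ⟨G t₀, Set.mem_image_of_mem _ ht₀, hxt⟩
    · filter_upwards [Ioo_mem_nhdsLT hdb] with t ht using hle ⟨t, ht, rfl⟩
    · rintro _ ⟨t, ht, rfl⟩
      obtain ⟨y, hy, hyt⟩ := Set.mem_iUnion₂.1 (hsub t ht)
      by_cases hyx : y = x
      · exact Or.inl (hyx ▸ hyt)
      · exact Or.inr (Set.mem_biUnion (x := y) ⟨hy, hyx⟩ hyt)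
  have hbot : (𝓝[<] b).NeBot := nhdsLT_neBot_of_exists_lt ⟨a, hab⟩
  obtain ⟨U, hU, hdisj⟩ := S.finite_sing.t2_separation
  obtain ⟨x, hx, hxU⟩ := key U (fun x _ => (hU x).1) (fun x => (hU x).2) hdisj
  refine ⟨x, hx, tendsto_nhds.2 fun V hV hxV => ?_⟩
  classical
  -- Shrinking only the neighbourhood of `x` by `V` must select `x` again, since the path is already
  -- in `U x`.
  obtain ⟨y, hy, hyW⟩ := key (fun y => if y = x then U y ∩ V else U y)
    (fun y _ => by
      by_cases h : y = x
      · simp only [h, if_true]; exact ⟨(hU x).1, hxV⟩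
      · simp only [h, if_false]; exact (hU y).1)
    (fun y => by
      by_cases h : y = x
      · simp only [h, if_true]; exact (hU x).2.inter hV
      · simp only [h, if_false]; exact (hU y).2)
    (hdisj.mono fun y => by
      by_cases h : y = x
      · simp [h]
      · simp [h])
  by_cases h : y = x
  · simp only [h, if_true] at hyW
    exact hyW.mono fun t ht => ht.2
  · simp only [h, if_false] at hyW
    obtain ⟨t, h1, h2⟩ := (hyW.and hxU).exists
    exact absurd h2 (Set.disjoint_left.1 (hdisj hy hx h) h1)

/-- Primitive vectors of the lattice `q.cov.ker`. -/
def IsPrimitive (v : ℂ) : Prop :=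
  v ≠ 0 ∧ q.cov v = 0 ∧ ∀ t ∈ Set.Ioo (0 : ℝ) 1, q.cov (t * v) ≠ 0

variable {q}

/-- Were the lengths different, the shorter vector would be a lattice point strictly inside the
longer one. -/
theorem IsPrimitive.eq_of_smul {v w : ℂ} (hv : q.IsPrimitive v) (hw : q.IsPrimitive w) {t : ℝ}
    (ht : 0 < t) (h : v = t * w) : t = 1 := by
  rcases lt_trichotomy t 1 with hlt | h1 | hgt
  · exact absurd (h ▸ hv.2.1) (hw.2.2 t ⟨ht, hlt⟩)
  · exact h1
  · have h2 : w = ((t⁻¹ : ℝ) : ℂ) * v := by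
      rw [h, ← mul_assoc, ← Complex.ofReal_mul, inv_mul_cancel₀ ht.ne', Complex.ofReal_one, one_mul]
    exact absurd (h2 ▸ hw.2.1) (hv.2.2 _ ⟨inv_pos.2 ht, inv_lt_one_of_one_lt₀ hgt⟩)

theorem IsPrimitive.eq_of_polar {v w : ℂ} (hv : q.IsPrimitive v) (hw : q.IsPrimitive w) {θ : ℝ}
    (h1 : polar (‖v‖, θ) = v) (h2 : polar (‖w‖, θ) = w) : v = w := by
  have hv0 := norm_pos_iff.2 hv.1
  have hw0 := norm_pos_iff.2 hw.1
  have h : v = ((‖v‖ / ‖w‖ : ℝ) : ℂ) * w := by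
    rw [← h2, ← polar_smul, norm_polar hw0.le, div_mul_cancel₀ _ hw0.ne', h1]
  rw [hv.eq_of_smul hw (div_pos hv0 hw0) h] at h
  simpa using h

end TorusProjection

namespace SaddleConnection

variable {X T : Type*} [TopologicalSpace X] [TopologicalSpace T] [AddCommGroup T]
  {S : TranslationStructure X} {k : ℕ}

/-- The initial singularity. -/
def source (e : S.SaddleConnection) : S.sing := ⟨e.path 0, e.initial_mem⟩

/-- The terminal singularity. -/
def target (e : S.SaddleConnection) : S.sing := ⟨e.path 1, e.terminal_mem⟩

theorem eq_of_path_eq {e e' : S.SaddleConnection} (h : e.path = e'.path) (h' : e.hol = e'.hol) :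
    e = e' := by
  cases e; cases e'; cases h; cases h'; rfl

/-- The saddle connection traversed backwards. -/
noncomputable def reverse (e : S.SaddleConnection) : S.SaddleConnection where
  path := e.path.comp ⟨unitInterval.symm, unitInterval.continuous_symm⟩
  hol := -e.hol
  initial_mem := by simpa using e.terminal_mem
  terminal_mem := by simpa using e.initial_mem
  straight := by
    refine (e.straight.comp (u := unitInterval.symm) (D' := Set.Ioo 0 1)
      unitInterval.continuous_symm.continuousOn ?_).congr (a := -e.hol) (fun _ _ => rfl) ?_
    · rintro t ⟨h0, h1⟩
      constructor
      · rw [← unitInterval.symm_one]; exact unitInterval.strictAnti_symm h1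
      · rw [← unitInterval.symm_zero]; exact unitInterval.strictAnti_symm h0
    · intro t _
      simp only [Function.comp, unitInterval.coe_symm_eq]
      push_cast
      ring

theorem reverse_source (e : S.SaddleConnection) : e.reverse.source = e.target :=
  Subtype.ext (by simp [source, target, reverse])

theorem outRay_reverse (e : S.SaddleConnection) : e.reverse.outRay = e.inRay := by
  funext r
  simp only [outRay, inRay, length, reverse, norm_neg, ContinuousMap.comp_apply,
    ContinuousMap.coe_mk, unitInterval.symm_projIcc]

theorem dense_Ioo_unitInterval : closure (Set.Ioo (0 : unitInterval) 1) = Set.univ := by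
  rw [closure_Ioo (zero_ne_one), Set.eq_univ_iff_forall]
  exact fun t => ⟨unitInterval.nonneg', unitInterval.le_one'⟩

theorem proj_path (q : S.TorusProjection T) [IsTopologicalAddGroup T] [T2Space T]
    (e : S.SaddleConnection) (t : unitInterval) : q.proj (e.path t) = q.cov (t * e.hol) := by
  have hcont : Continuous fun t : unitInterval => q.proj (e.path t) - q.cov (t * e.hol) := by
    refine (q.continuous_proj.comp e.path.continuous).sub
      (q.isLocalHomeomorph_cov.continuous.comp ?_)
    fun_prop
  obtain ⟨t₀, ht₀⟩ := Set.nonempty_Ioo.2 (zero_lt_one (α := unitInterval))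
  have hEq : Set.EqOn (fun t : unitInterval => q.proj (e.path t) - q.cov (t * e.hol))
      (fun _ => q.proj (e.path t₀) - q.cov (t₀ * e.hol)) (Set.Ioo 0 1) := fun t ht =>
    q.proj_developsAs e.straight isPreconnected_Ioo ht₀ ht
  have hEq' := hEq.closure hcont continuous_const
  rw [dense_Ioo_unitInterval] at hEq'
  have h1 := hEq' (Set.mem_univ t)
  have h2 := hEq' (Set.mem_univ 0)
  simp only at h1 h2
  rw [← h2, (q.proj_eq_zero_iff _).2 e.initial_mem] at h1
  simpa [sub_eq_zero] using h1

/-- The path lies over `t ↦ cov(t · hol)` and meets the fibre over `0`, the singular set, only at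
its endpoints. -/
theorem isPrimitive_hol (q : S.TorusProjection T) [IsTopologicalAddGroup T] [T2Space T]
    (e : S.SaddleConnection) : q.IsPrimitive e.hol := by
  have hnz : ∀ t ∈ Set.Ioo (0 : ℝ) 1, q.cov (t * e.hol) ≠ 0 := by
    intro t ht h
    have hmem : (⟨t, ht.1.le, ht.2.le⟩ : unitInterval) ∈ Set.Ioo (0 : unitInterval) 1 :=
      ⟨ht.1, ht.2⟩
    refine (e.straight.2 _ hmem).1 ((q.proj_eq_zero_iff _).1 ?_)
    rw [e.proj_path q]
    exact h
  refine ⟨fun h => hnz (1 / 2) (by norm_num) (by simp [h]), ?_, hnz⟩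
  have := e.proj_path q 1
  rw [(q.proj_eq_zero_iff _).2 e.terminal_mem] at this
  simpa using this.symm

theorem eq_of_path_apply_eq [T2Space X] {e e' : S.SaddleConnection} (h : e.hol = e'.hol)
    {t : unitInterval} (ht : t ∈ Set.Ioo 0 1) (htt : e.path t = e'.path t) : e = e' := by
  have h2 := e'.straight
  rw [← h] at h2
  have hEq := (e.straight.eqOn h2 isPreconnected_Ioo ht htt).closure e.path.continuous
    e'.path.continuous
  rw [dense_Ioo_unitInterval] at hEq
  exact eq_of_path_eq (ContinuousMap.ext fun t => hEq (Set.mem_univ t)) h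

/-- The saddle connection `e` leaves its initial singularity at the angle `θ` of the cone
coordinates. -/
def IsOutAngle (C : S.ConeAtlas k) (e : S.SaddleConnection) (θ : ℝ) : Prop :=
  polar (‖e.hol‖, θ) = e.hol ∧ ∀ t : unitInterval, t ∈ Set.Ioo 0 1 → t * ‖e.hol‖ < C.radius →
    e.path t = C.chart e.source (t * ‖e.hol‖, θ)

variable {C : S.ConeAtlas k} {q : S.TorusProjection T}

theorem IsOutAngle.eventually {e : S.SaddleConnection} {θ : ℝ} (h : e.IsOutAngle C θ)
    (h0 : e.hol ≠ 0) : ∀ᶠ r in 𝓝[>] 0, e.outRay r = C.chart e.source (r, θ) := by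
  have hl : 0 < ‖e.hol‖ := norm_pos_iff.2 h0
  filter_upwards [Ioo_mem_nhdsGT hl, Ioo_mem_nhdsGT C.radius_pos] with r hr hrC
  have h1 : r / ‖e.hol‖ ∈ Set.Ioo (0 : ℝ) 1 := ⟨div_pos hr.1 hl, (div_lt_one hl).2 hr.2⟩
  rw [outRay, length, Set.projIcc_of_mem zero_le_one (Set.Ioo_subset_Icc_self h1)]
  have := h.2 ⟨r / ‖e.hol‖, Set.Ioo_subset_Icc_self h1⟩ ⟨h1.1, h1.2⟩
  simp only [div_mul_cancel₀ _ hl.ne'] at this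
  exact this hrC.2

theorem exists_small_time (C : S.ConeAtlas k) {v : ℂ} (hv : v ≠ 0) :
    ∃ t : unitInterval, t ∈ Set.Ioo 0 1 ∧ t * ‖v‖ ∈ Set.Ioo 0 C.radius := by
  have hl : 0 < ‖v‖ := norm_pos_iff.2 hv
  obtain ⟨t, ht, htC⟩ := ((Ioo_mem_nhdsGT (zero_lt_one (α := ℝ))) |> fun h => (Filter.Eventually.and
    (eventually_mem_set.2 h) (eventually_mem_set.2 (Ioo_mem_nhdsGT
      (div_pos C.radius_pos hl))))).exists
  exact ⟨⟨t, Set.Ioo_subset_Icc_self ht⟩, ⟨ht.1, ht.2⟩, mul_pos ht.1 hl, (lt_div_iff₀ hl).1 htC.2⟩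

section T2

variable [IsTopologicalAddGroup T] [T2Space T] [T2Space X]

/-- The angle is read off at one small time, where the projection determines radius and direction;
unique continuation carries the agreement along the ray. -/
theorem exists_isOutAngle (hC : C.IsSmall q) (e : S.SaddleConnection) :
    ∃ θ, e.IsOutAngle C θ := by
  have hv := (e.isPrimitive_hol q).1
  have hl : 0 < ‖e.hol‖ := norm_pos_iff.2 hv
  have h1 : ∀ᶠ t in 𝓝[>] (0 : unitInterval),
      e.path t ∈ C.chart e.source '' (Set.Ico 0 C.radius ×ˢ Set.univ) :=
    (e.path.continuous.tendsto 0).mono_left nhdsWithin_le_nhds (C.image_mem_nhds e.source)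
  have h2 : ∀ᶠ t : unitInterval in 𝓝[>] 0, (t : ℝ) * ‖e.hol‖ < C.radius := by
    have hc : Continuous fun t : unitInterval => (t : ℝ) * ‖e.hol‖ := by fun_prop
    refine ((hc.tendsto 0).mono_left nhdsWithin_le_nhds).eventually (gt_mem_nhds ?_)
    simpa using C.radius_pos
  have hne : (𝓝[>] (0 : unitInterval)).NeBot := nhdsGT_neBot_of_exists_gt ⟨1, zero_lt_one⟩
  obtain ⟨t₀, ⟨hp, ht₀C⟩, ht₀⟩ :=
    ((h1.and h2).and (Ioo_mem_nhdsGT (zero_lt_one (α := unitInterval)))).exists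
  obtain ⟨⟨r, θ⟩, ⟨hr, -⟩, hrp⟩ := hp
  have ht₀r : (0 : ℝ) < t₀ := ht₀.1
  have hnorm : ‖(t₀ : ℂ) * e.hol‖ = t₀ * ‖e.hol‖ := by
    rw [norm_mul, Complex.norm_real, Real.norm_of_nonneg ht₀r.le]
  have hpol : polar (r, θ) = t₀ * e.hol := by
    refine hC.eq (by rw [norm_polar hr.1]; exact hr.2) (by rw [hnorm]; exact ht₀C) ?_
    rw [← C.proj_chart q e.source hr, hrp, e.proj_path q]
  have hrt : r = t₀ * ‖e.hol‖ := by rw [← hnorm, ← hpol, norm_polar hr.1]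
  have hθ : polar (‖e.hol‖, θ) = e.hol := by
    rw [hrt, polar_smul] at hpol
    exact mul_left_cancel₀ (Complex.ofReal_ne_zero.2 ht₀r.ne') hpol
  refine ⟨θ, hθ, fun t ht htC => ?_⟩
  have hD : S.DevelopsAs (fun t : unitInterval => C.chart e.source (t * ‖e.hol‖, θ))
      (fun t : unitInterval => ((t : ℝ) : ℂ) * e.hol) (Set.Ioc 0 (max t t₀)) := by
    refine (C.developsAs_ray e.source hv hθ).comp (u := fun t : unitInterval => (t : ℝ))
      (by fun_prop) fun u hu => ⟨hu.1, (lt_div_iff₀ hl).2 ?_⟩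
    rcases le_max_iff.1 hu.2 with h | h
    · exact (mul_le_mul_of_nonneg_right (Subtype.coe_le_coe.2 h) hl.le).trans_lt htC
    · exact (mul_le_mul_of_nonneg_right (Subtype.coe_le_coe.2 h) hl.le).trans_lt ht₀C
  have hmax : max t t₀ < 1 := max_lt ht.2 ht₀.2
  refine (e.straight.mono fun u hu => ⟨hu.1, hu.2.trans_lt hmax⟩).eqOn hD isPreconnected_Ioc
    ⟨ht₀.1, le_max_right _ _⟩ ?_ ⟨ht.1, le_max_left _ _⟩
  rw [← hrp, hrt]

theorem IsOutAngle.eq (q : S.TorusProjection T) {e e' : S.SaddleConnection} {θ θ' : ℝ}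
    (h : e.IsOutAngle C θ) (h' : e'.IsOutAngle C θ') (hs : e.source = e'.source)
    (hh : e.hol = e'.hol) {m : ℤ} (hm : θ' = θ + m * (2 * Real.pi * (k + 1))) : e = e' := by
  have hv := (e.isPrimitive_hol q).1
  obtain ⟨t, ht, htC⟩ := exists_small_time C hv
  refine eq_of_path_apply_eq hh ht ?_
  rw [h.2 t ht htC.2, h'.2 t ht (hh ▸ htC.2), ← hs, ← hh, hm,
    C.chart_add_period _ (Set.Ioo_subset_Ico_self htC)]

theorem IsOutAngle.exists_eq_add (hC : C.IsSmall q) {e : S.SaddleConnection} {θ θ' : ℝ}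
    (h : e.IsOutAngle C θ) (h' : e.IsOutAngle C θ') :
    ∃ m : ℤ, θ' - θ = m * (2 * Real.pi * (k + 1)) := by
  have hv := (e.isPrimitive_hol q).1
  obtain ⟨t, ht, htC⟩ := exists_small_time C hv
  have := (h.2 t ht htC.2).symm.trans (h'.2 t ht htC.2)
  exact (hC.chart_eq htC htC this).2.2

/-- Primitivity keeps `t ↦ cov(tv)` away from `0` on `(0,1)`, so it lifts through the covering from
a point on the prescribed ray. The lift tends to `x` at `0`, as it follows that ray, and to some
singularity at `1`. -/
theorem exists_of_angle [CompactSpace X] {v : ℂ} (hv : q.IsPrimitive v)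
    (x : S.sing) {θ : ℝ} (hθ : polar (‖v‖, θ) = v) :
    ∃ e : S.SaddleConnection, e.hol = v ∧ e.source = x ∧ e.IsOutAngle C θ := by
  have hl : 0 < ‖v‖ := norm_pos_iff.2 hv.1
  obtain ⟨t₀, ht₀, ht₀C⟩ := exists_small_time C hv.1
  have : ContractibleSpace (Set.Ioo (0 : ℝ) 1) :=
    (convex_Ioo 0 1).contractibleSpace (Set.nonempty_Ioo.2 zero_lt_one)
  have : LocallyPathConnectedSpace (Set.Ioo (0 : ℝ) 1) := isOpen_Ioo.locallyPathConnectedSpace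
  have hcovc := q.isLocalHomeomorph_cov.continuous
  let f : C(Set.Ioo (0 : ℝ) 1, T) := ⟨fun t => q.cov ((t : ℝ) * v), hcovc.comp (by fun_prop)⟩
  obtain ⟨F, ⟨hF0, hFp⟩, -⟩ := q.isCoveringMapOn_proj.existsUnique_continuousMap_lifts f
    (a₀ := ⟨t₀, ht₀⟩) (e₀ := C.chart x (t₀ * ‖v‖, θ)) (by
      rw [C.proj_chart q x (Set.Ioo_subset_Ico_self ht₀C), polar_smul, hθ]; rfl)
    fun t => hv.2.2 t t.2
  classical
  -- The default value `x` is immaterial: `extendFrom` sees only the values on `(0,1)`.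
  let G : ℝ → X := fun t => if h : t ∈ Set.Ioo (0 : ℝ) 1 then F ⟨t, h⟩ else x
  have hGF : ∀ t (h : t ∈ Set.Ioo (0 : ℝ) 1), G t = F ⟨t, h⟩ := fun t h => dif_pos h
  have hGc : ContinuousOn G (Set.Ioo 0 1) := by
    rw [continuousOn_iff_continuous_domRestrict]
    convert! F.continuous using 1
    funext t
    exact hGF t t.2
  have hGp : ∀ t ∈ Set.Ioo (0 : ℝ) 1, q.proj (G t) = q.cov (t * v) := fun t ht => by
    rw [hGF t ht]; exact congrFun hFp ⟨t, ht⟩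
  have hGd : S.DevelopsAs G (fun t : ℝ => t * v) (Set.Ioo 0 1) :=
    q.developsAs hGc (by fun_prop) hGp hv.2.2
  have hray : ∀ t ∈ Set.Ioo (0 : ℝ) (min 1 (C.radius / ‖v‖)), G t = C.chart x (t * ‖v‖, θ) := by
    refine (hGd.mono (Set.Ioo_subset_Ioo_right (min_le_left _ _))).eqOn
      ((C.developsAs_ray x hv.1 hθ).mono (Set.Ioo_subset_Ioo_right (min_le_right _ _)))
      isPreconnected_Ioo (y₀ := t₀) ⟨ht₀.1, lt_min ht₀.2 ((lt_div_iff₀ hl).2 ht₀C.2)⟩ ?_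
    rw [hGF _ ht₀, hF0]
  have hlim0 : Tendsto G (𝓝[>] 0) (𝓝 (x : X)) := by
    refine (C.tendsto_ray x ‖v‖ θ hl).congr' ?_
    filter_upwards [Ioo_mem_nhdsGT (lt_min one_pos (div_pos C.radius_pos hl))] with t ht
      using (hray t ht).symm
  obtain ⟨y, hy, hlim1⟩ := q.exists_tendsto_sing one_pos hGc (by
    have hc : Continuous fun t : ℝ => q.cov (t * v) := hcovc.comp (by fun_prop)
    have h1 := (hc.tendsto 1).mono_left (nhdsWithin_le_nhds (s := Set.Iio 1))
    simp only [Complex.ofReal_one, one_mul, hv.2.1] at h1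
    refine h1.congr' ?_
    filter_upwards [Ioo_mem_nhdsLT (zero_lt_one (α := ℝ))] with t ht using (hGp t ht).symm)
  have hext := continuousOn_Icc_extendFrom_Ioo hGc hlim0 hlim1
  have hexteq : ∀ t ∈ Set.Ioo (0 : ℝ) 1, extendFrom (Set.Ioo 0 1) G t = G t :=
    extendFrom_extends hGc
  let path : C(unitInterval, X) := ⟨fun t => extendFrom (Set.Ioo 0 1) G t,
    continuousOn_iff_continuous_domRestrict.1 hext⟩
  have hp0 : path 0 = x := eq_lim_at_left_extendFrom_Ioo one_pos hlim0
  have hp1 : path 1 = y := eq_lim_at_right_extendFrom_Ioo one_pos hlim1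
  refine ⟨⟨path, v, by rw [hp0]; exact x.2, by rw [hp1]; exact hy, ?_⟩, rfl, Subtype.ext hp0, hθ, ?_⟩
  · exact (hGd.comp (u := fun t : unitInterval => (t : ℝ)) (D' := Set.Ioo 0 1)
      continuous_subtype_val.continuousOn fun t ht => ⟨ht.1, ht.2⟩).congr (a := 0)
      (fun t ht => hexteq t ⟨ht.1, ht.2⟩) (by simp)
  · intro t ht htC
    have hsrc : (⟨path 0, by rw [hp0]; exact x.2⟩ : S.sing) = x := Subtype.ext hp0
    change extendFrom (Set.Ioo 0 1) G t = C.chart ⟨path 0, _⟩ (t * ‖v‖, θ)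
    rw [hsrc, hexteq t ⟨ht.1, ht.2⟩]
    exact hray t ⟨ht.1, lt_min ht.2 ((lt_div_iff₀ hl).2 htC)⟩

end T2

end SaddleConnection

/-- The angles between two rays given in cone coordinates. -/
theorem ConeAtlas.hasAngle_iff {X : Type*} [TopologicalSpace X] [T2Space X]
    {S : TranslationStructure X} {k : ℕ} (C : S.ConeAtlas k) {x : S.sing} {ρ₁ ρ₂ : ℝ → X}
    {θ₁ θ₂ : ℝ} (h₁ : ∀ᶠ r in 𝓝[>] 0, ρ₁ r = C.chart x (r, θ₁))
    (h₂ : ∀ᶠ r in 𝓝[>] 0, ρ₂ r = C.chart x (r, θ₂)) (α : ℝ) :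
    S.HasAngle ρ₁ ρ₂ α ↔ 0 ≤ α ∧ ∃ m : ℤ, θ₂ - θ₁ = α + m * (2 * Real.pi * (k + 1)) := by
  obtain ⟨η, hη, hsub⟩ := mem_nhdsGT_iff_exists_Ioo_subset.1 (h₁.and h₂)
  constructor
  · rintro ⟨hα, ε, θ, P, hε, hP, hPr⟩
    refine ⟨hα, ?_⟩
    set δ := min (min η ε) C.radius with hδ
    have hδ0 : 0 < δ := lt_min (lt_min hη hε) C.radius_pos
    have hδη : δ ≤ η := (min_le_left _ _).trans (min_le_left _ _)
    have hδε : δ ≤ ε := (min_le_left _ _).trans (min_le_right _ _)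
    have hδC : δ ≤ C.radius := min_le_right _ _
    have e1 : ∀ r ∈ Set.Ioo 0 δ, P (r, θ) = C.chart x (r, θ₁) := fun r hr =>
      (hPr r ⟨hr.1, hr.2.trans_le hδε⟩).1.trans (hsub ⟨hr.1, hr.2.trans_le hδη⟩).1
    have e2 : ∀ r ∈ Set.Ioo 0 δ, P (r, θ + α) = C.chart x (r, θ₂) := fun r hr =>
      (hPr r ⟨hr.1, hr.2.trans_le hδε⟩).2.trans (hsub ⟨hr.1, hr.2.trans_le hδη⟩).2
    have d1 : S.DevelopsAs (fun r => P (r, θ)) (fun r => polar (r, θ)) (Set.Ioo 0 δ) :=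
      hP.comp (u := fun r => (r, θ)) (by fun_prop) fun r hr =>
        ⟨⟨hr.1, hr.2.trans_le hδε⟩, ⟨le_rfl, by linarith⟩⟩
    have d2 : S.DevelopsAs (fun r => P (r, θ)) (fun r => polar (r, θ₁)) (Set.Ioo 0 δ) :=
      ((C.developsAs x).comp (u := fun r => (r, θ₁)) (by fun_prop) fun r hr =>
        ⟨⟨hr.1, hr.2.trans_le hδC⟩, trivial⟩).congr (a := 0) e1 (by simp)
    have hmid : δ / 2 ∈ Set.Ioo 0 δ := ⟨by linarith, by linarith⟩
    -- Two developments of one ray: comparing two different radii shows that `θ` and `θ₁` are the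
    -- same direction mod `2π`.
    have hev := d1.eventually_sub_eq d2 hmid
    rw [isOpen_Ioo.nhdsWithin_eq hmid] at hev
    obtain ⟨r, hr, hne⟩ := ((hev.filter_mono nhdsWithin_le_nhds).and
      (self_mem_nhdsWithin (s := {δ / 2}ᶜ))).exists
    have hpol : polar (1, θ) = polar (1, θ₁) := by
      have hp : ∀ r φ, polar (r, φ) = r * polar (1, φ) := fun r φ => by
        rw [← polar_smul, mul_one]
      rw [hp r, hp (δ / 2), hp r θ₁, hp (δ / 2) θ₁, ← sub_mul, ← sub_mul] at hr
      refine mul_left_cancel₀ ?_ hr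
      rw [← Complex.ofReal_sub, Complex.ofReal_ne_zero, sub_ne_zero]
      exact hne
    obtain ⟨j, hj⟩ := (polar_eq_iff one_pos).1 hpol
    -- The cone chart rotated by `θ₁ - θ`, a multiple of `2π`, still develops as `polar`, so it
    -- equals `P` on the whole sector once they agree on its first side.
    have d3 : S.DevelopsAs (fun p : ℝ × ℝ => C.chart x (p.1, p.2 - θ + θ₁)) polar
        (Set.Ioo 0 δ ×ˢ Set.Icc θ (θ + α)) := by
      refine ((C.developsAs x).comp (u := fun p : ℝ × ℝ => (p.1, p.2 - θ + θ₁)) (by fun_prop)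
        fun p hp => ⟨⟨hp.1.1, hp.1.2.trans_le hδC⟩, trivial⟩).congr (a := 0) (fun _ _ => rfl) ?_
      rintro ⟨r, φ⟩ -
      simp only [Function.comp, add_zero]
      rw [show φ - θ + θ₁ = φ + ((-j : ℤ) : ℝ) * (2 * Real.pi) by rw [hj]; push_cast; ring,
        polar_add_int]
    have heq := (hP.mono (Set.prod_mono (Set.Ioo_subset_Ioo_right hδε) subset_rfl)).eqOn d3
      (isPreconnected_Ioo.prod isPreconnected_Icc) (y₀ := (δ / 2, θ))
      ⟨hmid, ⟨le_rfl, by linarith⟩⟩ (by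
        simp only
        rw [e1 _ hmid, sub_self, zero_add])
    have hend := heq (x := (δ / 2, θ + α)) ⟨hmid, ⟨by linarith, le_rfl⟩⟩
    simp only at hend
    rw [e2 _ hmid] at hend
    have hmC : δ / 2 ∈ Set.Ico 0 C.radius := ⟨hmid.1.le, hmid.2.trans_le hδC⟩
    obtain ⟨-, h0 | ⟨m, hm⟩⟩ := (C.chart_eq_iff x _ hmC _ hmC _ _).1 hend
    · exact absurd h0 hmid.1.ne'
    · exact ⟨-m, by push_cast; linarith⟩
  · rintro ⟨hα, m, hm⟩
    refine ⟨hα, min η C.radius, θ₁, C.chart x, lt_min hη C.radius_pos,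
      (C.developsAs x).mono (Set.prod_mono (Set.Ioo_subset_Ioo_right (min_le_right _ _))
        (Set.subset_univ _)), fun r hr => ?_⟩
    have hr' := hsub ⟨hr.1, hr.2.trans_le (min_le_left _ _)⟩
    refine ⟨hr'.1.symm, ?_⟩
    rw [hr'.2, show θ₂ = θ₁ + α + m * (2 * Real.pi * (k + 1)) by linarith,
      C.chart_add_period x ⟨hr.1.le, hr.2.trans_le (min_le_right _ _)⟩]

end TranslationStructure

/-! ### Counting saddle connections and their continuations -/

namespace TranslationStructure

open scoped ENNReal

/-- Among the `k + 1` angles `φ + 2πj` on the circle of length `2π(k+1)`, all but one lie at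
distance at least `π` from the base point, unless `φ` is an odd multiple of `π`. -/
theorem ncard_angles (k : ℕ) (φ : ℝ) :
    ((∃ l : ℤ, φ = Real.pi + l * (2 * Real.pi)) →
      {j : Fin (k + 1) | ∀ m : ℤ, Real.pi ≤ |φ + ((j : ℕ) : ℤ) * (2 * Real.pi) +
        m * (2 * Real.pi * (k + 1))|}.ncard = k + 1) ∧
    ((¬∃ l : ℤ, φ = Real.pi + l * (2 * Real.pi)) →
      {j : Fin (k + 1) | ∀ m : ℤ, Real.pi ≤ |φ + ((j : ℕ) : ℤ) * (2 * Real.pi) +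
        m * (2 * Real.pi * (k + 1))|}.ncard = k) := by
  have hp := Real.pi_pos
  constructor
  · rintro ⟨l, rfl⟩
    have : {j : Fin (k + 1) | ∀ m : ℤ, Real.pi ≤ |Real.pi + l * (2 * Real.pi) +
        ((j : ℕ) : ℤ) * (2 * Real.pi) + m * (2 * Real.pi * (k + 1))|} = Set.univ := by
      rw [Set.eq_univ_iff_forall]
      intro j m
      have e : Real.pi + l * (2 * Real.pi) + ((j : ℕ) : ℤ) * (2 * Real.pi) +
          m * (2 * Real.pi * (k + 1)) =
          Real.pi * ((1 + 2 * (l + (j : ℕ) + m * (k + 1)) : ℤ) : ℝ) := by push_cast; ring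
      have h1 : (1 : ℝ) ≤ |((1 + 2 * (l + (j : ℕ) + m * (k + 1)) : ℤ) : ℝ)| := by
        rw [← Int.cast_abs]
        have : (1 : ℤ) ≤ |1 + 2 * (l + (j : ℕ) + m * (k + 1))| := Int.one_le_abs (by omega)
        exact_mod_cast this
      rw [e, abs_mul, abs_of_pos hp]
      nlinarith
    rw [this, Set.ncard_univ, Nat.card_fin]
  · intro hφ
    -- Rounding `φ/(2π)` gives distance at most `π`, with equality only at odd multiples of `π`. The
    -- class of `l₀` mod `k+1` is the excluded ray.
    obtain ⟨l₀, hl₀⟩ : ∃ l : ℤ, |φ + l * (2 * Real.pi)| < Real.pi := by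
      refine ⟨-round (φ / (2 * Real.pi)), ?_⟩
      have h1 := abs_sub_round (φ / (2 * Real.pi))
      have e : φ + ((-round (φ / (2 * Real.pi)) : ℤ) : ℝ) * (2 * Real.pi) =
          (φ / (2 * Real.pi) - round (φ / (2 * Real.pi))) * (2 * Real.pi) := by
        push_cast; field_simp; ring
      rw [e, abs_mul, abs_of_pos (by positivity : (0 : ℝ) < 2 * Real.pi)]
      have h2 : |φ / (2 * Real.pi) - round (φ / (2 * Real.pi))| ≠ 1 / 2 := by
        intro h2
        rcases eq_or_eq_neg_of_abs_eq h2 with h3 | h3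
        · refine hφ ⟨round (φ / (2 * Real.pi)), ?_⟩
          rw [h3] at e; push_cast at e; linarith
        · refine hφ ⟨round (φ / (2 * Real.pi)) - 1, ?_⟩
          rw [h3] at e; push_cast at e ⊢; linarith
      have h3 := lt_of_le_of_ne h1 h2
      nlinarith
    obtain ⟨j₀, m₀, rfl⟩ := ConeAtlas.exists_fin_angle k l₀
    have : {j : Fin (k + 1) | ∀ m : ℤ, Real.pi ≤ |φ + ((j : ℕ) : ℤ) * (2 * Real.pi) +
        m * (2 * Real.pi * (k + 1))|} = {j₀}ᶜ := by
      ext j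
      simp only [Set.mem_compl_iff, Set.mem_singleton_iff]
      constructor
      · rintro h rfl
        refine absurd (h m₀) (not_le.2 ?_)
        convert! hl₀ using 2
        push_cast; ring
      · intro hj m
        by_contra hc
        rw [not_le] at hc
        have h1 := abs_lt.1 hc
        have h2 := abs_lt.1 hl₀
        push_cast at h1 h2
        have h3 : ((j : ℕ) : ℝ) + m * (k + 1) - ((j₀ : ℕ) + m₀ * (k + 1)) < 1 := by nlinarith
        have h4 : -1 < ((j : ℕ) : ℝ) + m * (k + 1) - ((j₀ : ℕ) + m₀ * (k + 1)) := by nlinarith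
        have h3' : ((j : ℕ) : ℤ) + m * (k + 1) - ((j₀ : ℕ) + m₀ * (k + 1)) < 1 := by
          exact_mod_cast h3
        have h4' : -1 < ((j : ℕ) : ℤ) + m * (k + 1) - ((j₀ : ℕ) + m₀ * (k + 1)) := by
          exact_mod_cast h4
        refine hj (ConeAtlas.fin_angle_injective (l := m - m₀) ?_)
        have h5 : ((j : ℕ) : ℤ) + m * (k + 1) - ((j₀ : ℕ) + m₀ * (k + 1)) = 0 := by omega
        linear_combination -h5
    rw [this, Set.ncard_compl, Set.ncard_singleton, Nat.card_fin]
    rfl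

variable {X T : Type*} [TopologicalSpace X] [TopologicalSpace T] [AddCommGroup T]
  {S : TranslationStructure X} {k : ℕ} {C : S.ConeAtlas k} {q : S.TorusProjection T}
  [IsTopologicalAddGroup T] [T2Space T] [T2Space X]

/-- The angles on one side are the nonnegative representatives of `θ' - θ` modulo the period, those
on the other side the negatives of the nonpositive ones; together they bound the absolute value. -/
theorem isGeodesicJoin_iff (q : S.TorusProjection T) {e e' : S.SaddleConnection} {θ θ' : ℝ}
    (h : e.reverse.IsOutAngle C θ) (h' : e'.IsOutAngle C θ') :
    IsGeodesicJoin e e' ↔ e.target = e'.source ∧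
      ∀ m : ℤ, Real.pi ≤ |θ' - θ + m * (2 * Real.pi * (k + 1))| := by
  have hst : e.target = e'.source ↔ e.path 1 = e'.path 0 := Subtype.ext_iff
  rw [hst]
  refine and_congr_right fun hpath => ?_
  have h1 := h.eventually (e.reverse.isPrimitive_hol q).1
  have h2 := h'.eventually (e'.isPrimitive_hol q).1
  rw [SaddleConnection.outRay_reverse, SaddleConnection.reverse_source, hst.2 hpath] at h1
  simp only [C.hasAngle_iff h1 h2, C.hasAngle_iff h2 h1]
  constructor
  · rintro ⟨ha, hb⟩ m
    rcases le_total 0 (θ' - θ + m * (2 * Real.pi * (k + 1))) with hs | hs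
    · rw [abs_of_nonneg hs]
      exact ha _ ⟨hs, -m, by push_cast; ring⟩
    · rw [abs_of_nonpos hs]
      exact hb _ ⟨neg_nonneg.2 hs, m, by ring⟩
  · intro hm
    constructor
    · rintro α ⟨hα, m, hαm⟩
      have := hm (-m)
      rwa [show θ' - θ + ((-m : ℤ) : ℝ) * (2 * Real.pi * (k + 1)) = α by push_cast; linarith,
        abs_of_nonneg hα] at this
    · rintro α ⟨hα, m, hαm⟩
      have := hm m
      rwa [show θ' - θ + (m : ℝ) * (2 * Real.pi * (k + 1)) = -α by linarith, abs_neg,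
        abs_of_nonneg hα] at this

variable [CompactSpace X]

/-- Saddle connections correspond to a primitive vector, an initial singularity, and one of the
`k + 1` rays in the direction of that vector. -/
theorem exists_equiv_saddleConnection (hC : C.IsSmall q) :
    ∃ Φ : {v // q.IsPrimitive v} × S.sing × Fin (k + 1) ≃ S.SaddleConnection,
      ∀ v x j, (Φ (v, x, j)).hol = v ∧ (Φ (v, x, j)).source = x ∧
        (Φ (v, x, j)).IsOutAngle C ((v : ℂ).arg + ((j : ℕ) : ℤ) * (2 * Real.pi)) := by
  have hex : ∀ a : {v // q.IsPrimitive v} × S.sing × Fin (k + 1), ∃ e : S.SaddleConnection,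
      e.hol = a.1 ∧ e.source = a.2.1 ∧
        e.IsOutAngle C ((a.1 : ℂ).arg + ((a.2.2 : ℕ) : ℤ) * (2 * Real.pi)) := fun a =>
    SaddleConnection.exists_of_angle a.1.2 a.2.1 (by rw [polar_add_int, polar_norm_arg])
  choose Φ h1 h2 h3 using hex
  refine ⟨Equiv.ofBijective Φ ⟨?_, ?_⟩, fun v x j => ⟨h1 _, h2 _, h3 _⟩⟩
  · rintro ⟨v, x, j⟩ ⟨v', x', j'⟩ h
    have hv : v = v' := Subtype.ext ((h1 _).symm.trans ((congrArg _ h).trans (h1 _)))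
    have hx : x = x' := (h2 _).symm.trans ((congrArg _ h).trans (h2 _))
    subst hv hx
    have h4 := h3 (v, x, j')
    rw [← h] at h4
    obtain ⟨m, hm⟩ := (h3 (v, x, j)).exists_eq_add hC h4
    have hp : (2 * Real.pi) ≠ 0 := by positivity
    have : (((j' : ℕ) : ℝ) - (j : ℕ)) = m * (k + 1) := by
      apply mul_right_cancel₀ hp
      push_cast at hm
      linear_combination hm
    rw [ConeAtlas.fin_angle_injective (j := j) (j' := j') (l := m) (by exact_mod_cast this)]
  · intro e
    obtain ⟨θ, hθ⟩ := e.exists_isOutAngle hC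
    have hv := e.isPrimitive_hol q
    obtain ⟨m, hm⟩ := (polar_eq_iff (θ := e.hol.arg) (norm_pos_iff.2 hv.1)).1
      (hθ.1.trans (polar_norm_arg e.hol).symm)
    obtain ⟨j, l, rfl⟩ := ConeAtlas.exists_fin_angle k m
    refine ⟨(⟨e.hol, hv⟩, e.source, j), ?_⟩
    refine SaddleConnection.IsOutAngle.eq q (h3 _) hθ (h2 _) (h1 _) (m := l) ?_
    rw [hm]; push_cast; ring

/-- The holonomy of a saddle connection as a primitive vector. -/
def primitiveHol (q : S.TorusProjection T) (e : S.SaddleConnection) : {v // q.IsPrimitive v} :=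
  ⟨e.hol, e.isPrimitive_hol q⟩

theorem tsum_primitiveHol (hC : C.IsSmall q) (g : {v // q.IsPrimitive v} → ℝ≥0∞) :
    ∑' e, g (primitiveHol q e) = (S.sing.ncard * (k + 1) : ℕ) * ∑' v, g v := by
  obtain ⟨Φ, hΦ⟩ := exists_equiv_saddleConnection hC
  have : Finite S.sing := S.finite_sing
  have := Fintype.ofFinite S.sing
  rw [← Φ.tsum_eq, ENNReal.tsum_prod', ← ENNReal.tsum_mul_left]
  refine tsum_congr fun v => ?_
  have : ∀ a : S.sing × Fin (k + 1), g (primitiveHol q (Φ (v, a))) = g v := fun a =>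
    congrArg g (Subtype.ext (hΦ v a.1 a.2).1)
  simp only [this]
  rw [tsum_fintype, Finset.sum_const, Finset.card_univ, Fintype.card_prod, Fintype.card_fin,
    nsmul_eq_mul, ← Nat.card_eq_fintype_card, Nat.card_coe_set_eq]

/-- Only the terminal singularity of `e` contributes. There each `v` has `k` admissible rays, and
one more when `v` is the holonomy of `e`. -/
theorem tsum_isGeodesicJoin (hC : C.IsSmall q) (e : S.SaddleConnection)
    (g : {v // q.IsPrimitive v} → ℝ≥0∞) :
    ∑' e', {e' | IsGeodesicJoin e e'}.indicator (fun e' => g (primitiveHol q e')) e' =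
      k * ∑' v, g v + g (primitiveHol q e) := by
  obtain ⟨Φ, hΦ⟩ := exists_equiv_saddleConnection hC
  obtain ⟨θ, hθ⟩ := e.reverse.exists_isOutAngle hC
  have hv := e.isPrimitive_hol q
  -- `θ` is the angle of the reversed segment, so straight continuation is at `θ + π`.
  have hpol : polar (‖e.hol‖, θ + Real.pi) = e.hol := by
    have := hθ.1
    simp only [SaddleConnection.reverse, norm_neg] at this
    rw [polar_neg_radius, this, neg_neg]
  have hdir : ∀ v : {v // q.IsPrimitive v},
      (∃ l : ℤ, (v : ℂ).arg - θ = Real.pi + l * (2 * Real.pi)) ↔ v = primitiveHol q e := by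
    intro v
    constructor
    · rintro ⟨l, hl⟩
      refine Subtype.ext (v.2.eq_of_polar hv (θ := θ + Real.pi) ?_ hpol)
      rw [← polar_add_int _ _ l, show θ + Real.pi + l * (2 * Real.pi) = (v : ℂ).arg by linarith,
        polar_norm_arg]
    · rintro rfl
      obtain ⟨l, hl⟩ := (polar_eq_iff (norm_pos_iff.2 hv.1)).1
        ((polar_norm_arg e.hol).trans hpol.symm)
      exact ⟨l, by simp only [primitiveHol]; linarith⟩
  classical
  have key : ∀ v, (∑' a : S.sing × Fin (k + 1), {e' | IsGeodesicJoin e e'}.indicator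
      (fun e' => g (primitiveHol q e')) (Φ (v, a))) =
      k * g v + if v = primitiveHol q e then g v else 0 := by
    intro v
    have hg : ∀ x j, g (primitiveHol q (Φ (v, x, j))) = g v := fun x j =>
      congrArg g (Subtype.ext (hΦ v x j).1)
    set J : Set (Fin (k + 1)) := {j | ∀ m : ℤ, Real.pi ≤ |(v : ℂ).arg - θ +
      ((j : ℕ) : ℤ) * (2 * Real.pi) + m * (2 * Real.pi * (k + 1))|} with hJ
    have hjoin : ∀ x j, IsGeodesicJoin e (Φ (v, x, j)) ↔ e.target = x ∧ j ∈ J := by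
      intro x j
      rw [isGeodesicJoin_iff q hθ (hΦ v x j).2.2, (hΦ v x j).2.1]
      refine and_congr_right fun _ => forall_congr' fun m => ?_
      rw [add_sub_right_comm]
    rw [ENNReal.tsum_prod', tsum_eq_single e.target]
    · have : ∀ j, {e' | IsGeodesicJoin e e'}.indicator (fun e' => g (primitiveHol q e'))
          (Φ (v, e.target, j)) = if j ∈ J then g v else 0 := by
        intro j
        rw [Set.indicator_apply, hg]
        exact if_congr ((hjoin _ _).trans (by simp)) rfl rfl
      simp only [this]
      rw [tsum_fintype, ← Finset.sum_filter, Finset.sum_const, nsmul_eq_mul]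
      have hcard : (Finset.univ.filter (· ∈ J)).card = J.ncard := by
        rw [Set.ncard_eq_toFinset_card', Set.toFinset_card, Fintype.card_subtype]
      rw [hcard]
      by_cases hve : v = primitiveHol q e
      · rw [if_pos hve, (ncard_angles k _).1 ((hdir v).2 hve)]
        push_cast; ring
      · rw [if_neg hve, (ncard_angles k _).2 (fun h => hve ((hdir v).1 h)), add_zero]
    · intro x hx
      rw [ENNReal.tsum_eq_zero]
      intro j
      rw [Set.indicator_of_notMem]
      intro h
      exact hx ((hjoin x j).1 h).1.symm
  rw [← Φ.tsum_eq, ENNReal.tsum_prod']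
  simp only [key]
  rw [ENNReal.tsum_add, ENNReal.tsum_mul_left, tsum_ite_eq]

end TranslationStructure

/-! ### Weighted sums over chains -/

namespace ChainSum

open scoped ENNReal

variable {E V : Type*}

/-- A list is empty or has a head and a tail. -/
def listEquiv (E : Type*) : List E ≃ Unit ⊕ E × List E where
  toFun l := match l with
    | [] => Sum.inl ()
    | e :: l => Sum.inr (e, l)
  invFun o := match o with
    | Sum.inl _ => []
    | Sum.inr (e, l) => e :: l
  left_inv l := by cases l <;> rfl
  right_inv o := by rcases o with _ | ⟨e, l⟩ <;> rfl

theorem tsum_list (f : List E → ℝ≥0∞) : ∑' l, f l = f [] + ∑' e, ∑' l, f (e :: l) := by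
  rw [← (listEquiv E).symm.tsum_eq, ENNReal.summable.tsum_sum ENNReal.summable, ENNReal.tsum_prod',
    tsum_fintype]
  simp [listEquiv]

/-- The sum of `W` over the chains that begin with `e`. -/
noncomputable def chainsFrom (R : E → E → Prop) (W : List E → ℝ≥0∞) (e : E) : ℝ≥0∞ :=
  ∑' l, {l | (e :: l).IsChain R}.indicator (fun l => W (e :: l)) l

theorem tsum_chain (R : E → E → Prop) (W : List E → ℝ≥0∞) :
    ∑' l : {l : List E // l ≠ [] ∧ l.IsChain R}, W l = ∑' e, chainsFrom R W e := by
  have h := tsum_subtype {l : List E | l ≠ [] ∧ l.IsChain R} W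
  refine h.trans ?_
  classical
  rw [tsum_list]
  simp [chainsFrom, Set.indicator_apply]

theorem chainsFrom_eq (R : E → E → Prop) (W : List E → ℝ≥0∞) (e : E) :
    chainsFrom R W e = W [e] + ∑' e', {e' | R e e'}.indicator (chainsFrom R fun l => W (e :: l)) e' := by
  rw [chainsFrom, tsum_list]
  congr 1
  · simp
  · refine tsum_congr fun e' => ?_
    by_cases h : R e e'
    · rw [Set.indicator_of_mem (by exact h), chainsFrom]
      classical
      refine tsum_congr fun l => ?_
      simp [Set.indicator_apply, h]
    · rw [Set.indicator_of_notMem (by exact h), ENNReal.tsum_eq_zero]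
      intro l
      simp [h]

section Weight

variable {R : E → E → Prop} {hol : E → V} {k M : ℕ} {x : V → ℝ≥0∞}

/-- The sum of the weights of the chains of length `m + 1` that begin at an edge of type `v`. -/
noncomputable def layer (k : ℕ) (x : V → ℝ≥0∞) : ℕ → V → ℝ≥0∞
  | 0, v => x v
  | m + 1, v => x v * (k * ∑' w, layer k x m w + layer k x m v)

/-- Detaching the first edge leaves a chain one shorter; its sum depends only on the type of its
first edge, so `hR` applies. -/
theorem chainsFrom_length_eq_layer (hR : ∀ e (g : V → ℝ≥0∞),
      ∑' e', {e' | R e e'}.indicator (fun e' => g (hol e')) e' = k * ∑' v, g v + g (hol e)) (m : ℕ) :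
    ∀ e, chainsFrom R ({l | l.length = m + 1}.indicator
      fun l => (l.map fun e => x (hol e)).prod) e = layer k x m (hol e) := by
  induction m with
  | zero =>
    intro e
    rw [chainsFrom_eq, layer]
    have : ∀ e', chainsFrom R (fun l => {l : List E | l.length = 0 + 1}.indicator
        (fun l => (l.map fun e => x (hol e)).prod) (e :: l)) e' = 0 := by
      intro e'
      simp [chainsFrom]
    rw [ENNReal.tsum_eq_zero.2 fun e' => Set.indicator_apply_eq_zero.2 fun _ => this e']
    simp
  | succ m ih =>
    intro e
    rw [chainsFrom_eq, layer]
    have h1 : ∀ e', chainsFrom R (fun l => {l : List E | l.length = m + 1 + 1}.indicator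
        (fun l => (l.map fun e => x (hol e)).prod) (e :: l)) e' =
        x (hol e) * layer k x m (hol e') := by
      intro e'
      rw [← ih e', chainsFrom, chainsFrom, ← ENNReal.tsum_mul_left]
      refine tsum_congr fun l => ?_
      by_cases h1 : List.IsChain R (e' :: l) <;> by_cases h2 : l.length = m <;> simp [h1, h2]
    have h2 : ({l : List E | l.length = m + 1 + 1}.indicator
        (fun l => (l.map fun e => x (hol e)).prod) [e]) = 0 := by simp
    rw [h2, zero_add, ← hR e, ← ENNReal.tsum_mul_left]
    refine tsum_congr fun e' => ?_
    by_cases h : R e e'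
    · rw [Set.indicator_of_mem (by exact h), Set.indicator_of_mem (by exact h), h1]
    · rw [Set.indicator_of_notMem (by exact h), Set.indicator_of_notMem (by exact h), mul_zero]

theorem chainsFrom_eq_tsum_layer (hR : ∀ e (g : V → ℝ≥0∞),
      ∑' e', {e' | R e e'}.indicator (fun e' => g (hol e')) e' = k * ∑' v, g v + g (hol e)) (e : E) :
    chainsFrom R (fun l => (l.map fun e => x (hol e)).prod) e = ∑' m, layer k x m (hol e) := by
  simp only [← chainsFrom_length_eq_layer hR, chainsFrom]
  rw [ENNReal.tsum_comm]
  classical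
  refine tsum_congr fun l => ?_
  rw [tsum_eq_single l.length]
  · simp [Set.indicator_apply]
  · intro m hm
    simp [Set.indicator_apply, hm.symm]

/-- Finiteness is essential: for `x ≠ 0`, `∞` also solves the equation. -/
theorem eq_of_affine_eq {a b d x : ℝ≥0∞} (ha : a ≠ ∞) (hb : b ≠ ∞) (hx : x < 1)
    (hae : a = d + x * a) (hbe : b = d + x * b) : a = b := by
  have hd : d ≠ ∞ := ne_top_of_le_ne_top ha (hae ▸ le_self_add)
  have hx' : x ≠ ∞ := hx.ne_top
  have hx1 : x.toReal < 1 := by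
    have := (ENNReal.toReal_lt_toReal hx' ENNReal.one_ne_top).2 hx
    simpa using this
  have ha' := congrArg ENNReal.toReal hae
  have hb' := congrArg ENNReal.toReal hbe
  rw [ENNReal.toReal_add hd (ENNReal.mul_ne_top hx' ha), ENNReal.toReal_mul] at ha'
  rw [ENNReal.toReal_add hd (ENNReal.mul_ne_top hx' hb), ENNReal.toReal_mul] at hb'
  rw [← ENNReal.toReal_eq_toReal_iff' ha hb]
  have : (1 - x.toReal) * (a.toReal - b.toReal) = 0 := by linear_combination ha' - hb'
  rcases mul_eq_zero.1 this with h | h <;> linarith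

/-- With `B_v = ∑ₘ layer m v`, the recursion reads `B_v = x_v (1 + k B + B_v)`. It determines `B`
only once `B` is known to be finite, which the bound on partial sums provides. -/
theorem tsum_tsum_layer {y : V → ℝ≥0∞} {τ : ℝ≥0∞} (hx : ∀ v, x v < 1)
    (hy : ∀ v, y v = x v + x v * y v) (hyt : ∑' v, y v ≠ ∞) (hk : k * ∑' v, y v < 1) (hτ : τ ≠ ∞)
    (hτy : τ = (∑' v, y v) + k * (∑' v, y v) * τ) : ∑' v, ∑' m, layer k x m v = τ := by
  have hstep : ∀ v n, ∑ m ∈ Finset.range (n + 1), layer k x m v = x v *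
      (1 + k * ∑' w, ∑ m ∈ Finset.range n, layer k x m w + ∑ m ∈ Finset.range n, layer k x m v) := by
    intro v n
    rw [Finset.sum_range_succ']
    simp only [layer]
    rw [← Finset.mul_sum, Finset.sum_add_distrib, ← Finset.mul_sum,
      Summable.tsum_finsetSum fun _ _ => ENNReal.summable]
    ring
  -- The candidate solution `y_v (1 + kτ)` is a supersolution at every stage, because `y = x + x y`
  -- and it sums to `τ`.
  have hbound : ∀ n v, ∑ m ∈ Finset.range n, layer k x m v ≤ y v * (1 + k * τ) := by
    intro n
    induction n with
    | zero => intro v; simp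
    | succ n ih =>
      intro v
      rw [hstep]
      have h1 : ∑' w, ∑ m ∈ Finset.range n, layer k x m w ≤ τ := by
        refine (ENNReal.tsum_le_tsum ih).trans (le_of_eq ?_)
        rw [ENNReal.tsum_mul_right]
        conv_rhs => rw [hτy]
        ring
      calc x v * (1 + k * ∑' w, ∑ m ∈ Finset.range n, layer k x m w +
            ∑ m ∈ Finset.range n, layer k x m v)
          ≤ x v * (1 + k * τ + y v * (1 + k * τ)) := by gcongr; exact ih v
        _ = (x v + x v * y v) * (1 + k * τ) := by ring
        _ = y v * (1 + k * τ) := by rw [← hy]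
  have hB : ∀ v, ∑' m, layer k x m v ≤ y v * (1 + k * τ) := fun v =>
    ENNReal.tsum_le_of_sum_range_le fun n => hbound n v
  have htot : ∑' v, ∑' m, layer k x m v ≤ τ := by
    refine (ENNReal.tsum_le_tsum hB).trans (le_of_eq ?_)
    rw [ENNReal.tsum_mul_right]
    conv_rhs => rw [hτy]
    ring
  have htt : ∑' v, ∑' m, layer k x m v ≠ ∞ := ne_top_of_le_ne_top hτ htot
  have hyv : ∀ v, y v ≠ ∞ := fun v => ne_top_of_le_ne_top hyt (ENNReal.le_tsum v)
  have hc : (1 + k * ∑' v, ∑' m, layer k x m v) ≠ ∞ := by finiteness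
  have hBeq : ∀ v, ∑' m, layer k x m v = y v * (1 + k * ∑' v, ∑' m, layer k x m v) := by
    intro v
    refine eq_of_affine_eq (x := x v) (d := x v * (1 + k * ∑' v, ∑' m, layer k x m v))
      (ne_top_of_le_ne_top htt (ENNReal.le_tsum v)) (ENNReal.mul_ne_top (hyv v) hc) (hx v) ?_ ?_
    · conv_lhs => rw [tsum_eq_zero_add' ENNReal.summable]
      simp only [layer]
      rw [ENNReal.tsum_mul_left, ENNReal.tsum_add, ENNReal.tsum_mul_left, ENNReal.tsum_comm]
      ring
    · conv_lhs => rw [hy v]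
      ring
  refine eq_of_affine_eq htt hτ hk ?_ hτy
  conv_lhs => rw [tsum_congr hBeq, ENNReal.tsum_mul_right]
  ring

theorem tsum_chain_prod {y : V → ℝ≥0∞} {τ : ℝ≥0∞}
    (hM : ∀ g : V → ℝ≥0∞, ∑' e, g (hol e) = M * ∑' v, g v)
    (hR : ∀ e (g : V → ℝ≥0∞),
      ∑' e', {e' | R e e'}.indicator (fun e' => g (hol e')) e' = k * ∑' v, g v + g (hol e))
    (hx : ∀ v, x v < 1) (hy : ∀ v, y v = x v + x v * y v) (hyt : ∑' v, y v ≠ ∞)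
    (hk : k * ∑' v, y v < 1) (hτ : τ ≠ ∞) (hτy : τ = (∑' v, y v) + k * (∑' v, y v) * τ) :
    ∑' l : {l : List E // l ≠ [] ∧ l.IsChain R}, ((l : List E).map fun e => x (hol e)).prod =
      M * τ := by
  rw [tsum_chain R fun l => (l.map fun e => x (hol e)).prod]
  simp only [chainsFrom_eq_tsum_layer hR]
  rw [hM fun v => ∑' m, layer k x m v, tsum_tsum_layer hx hy hyt hk hτ hτy]

end Weight

/-! ### Exponential lower bound for the number of chains -/

section Count

variable {R : E → E → Prop} {hol : E → V} {k : ℕ} {len : V → ℝ}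

/-- The number of chains of length at most `T` that begin with `e`. -/
noncomputable def count (R : E → E → Prop) (hol : E → V) (len : V → ℝ) (T : ℝ) (e : E) : ℝ≥0∞ :=
  chainsFrom R ({l | (l.map fun e => len (hol e)).sum ≤ T}.indicator 1) e

theorem one_le_count {T : ℝ} {e : E} (h : len (hol e) ≤ T) : 1 ≤ count R hol len T e := by
  rw [count, chainsFrom_eq]
  simp [h]

/-- Prepending `e` to an admissible chain of length at most `T - len (hol e)`; only the one-edge
chain is dropped. -/
theorem tsum_count_le (T : ℝ) (e : E) :
    ∑' e', {e' | R e e'}.indicator (count R hol len (T - len (hol e))) e' ≤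
      count R hol len T e := by
  conv_rhs => rw [count, chainsFrom_eq]
  refine le_trans (le_of_eq ?_) le_add_self
  have : (fun l => {l | (l.map fun e => len (hol e)).sum ≤ T}.indicator (1 : List E → ℝ≥0∞)
      (e :: l)) = {l | (l.map fun e => len (hol e)).sum ≤ T - len (hol e)}.indicator 1 := by
    classical
    funext l
    simp [Set.indicator_apply, le_sub_iff_add_le, add_comm]
  simp only [this]
  rfl

/-- If `k ∑ y_v > 1`, where `y_v = x_v / (1 - x_v)` and `x_v = exp (-t ℓ_v)`, the number of chains
of length at most `T` grows at least like `exp (t T)`. -/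
theorem exists_le_tsum_count
    (hR : ∀ e (g : V → ℝ≥0∞),
      ∑' e', {e' | R e e'}.indicator (fun e' => g (hol e')) e' = k * ∑' v, g v + g (hol e))
    (hsurj : Function.Surjective hol) (hlen : ∀ v, 0 < len v) {t : ℝ} (ht : 0 < t) {y : V → ℝ≥0∞}
    (hy : ∀ v, y v = ENNReal.ofReal (Real.exp (-t * len v)) +
      ENNReal.ofReal (Real.exp (-t * len v)) * y v)
    (hyt : ∀ v, y v ≠ ∞) (hk : 1 < k * ∑' v, y v) :
    ∃ c : ℝ, 0 < c ∧ ∃ T₀ : ℝ, ∀ T ≥ T₀,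
      ENNReal.ofReal (c * Real.exp (t * T)) ≤ ∑' e, count R hol len T e := by
  obtain ⟨F, hF⟩ : ∃ F : Finset V, 1 < k * ∑ v ∈ F, y v := by
    rw [ENNReal.tsum_eq_iSup_sum, ENNReal.mul_iSup] at hk
    exact lt_iSup_iff.1 hk
  have hFne : F.Nonempty := by
    rw [Finset.nonempty_iff_ne_empty]
    rintro rfl
    simp at hF
  obtain ⟨v₀, hv₀⟩ := hFne
  obtain ⟨a, ha, hamin⟩ := F.exists_min_image len ⟨v₀, hv₀⟩
  obtain ⟨b, hb, hbmax⟩ := F.exists_max_image len ⟨v₀, hv₀⟩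
  set L := len b with hL
  set Y := ∑ v ∈ F, y v with hY
  have hYt : Y ≠ ∞ := ENNReal.sum_ne_top.2 fun v _ => hyt v
  have hyY : ∀ v ∈ F, y v ≤ Y := fun v hv => Finset.single_le_sum (f := y) (fun _ _ => zero_le) hv
  have hY0 : Y ≠ 0 := by rintro h; simp [h] at hF
  have hypos : ∀ v, y v ≠ 0 := fun v h => by
    have := hy v
    rw [h, mul_zero, add_zero, eq_comm, ENNReal.ofReal_eq_zero] at this
    exact absurd this (not_le.2 (Real.exp_pos _))
  -- Chosen so that `c Y exp(2tL) = 1`: for `L ≤ T ≤ 2L` the single-edge chain alone proves the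
  -- bound.
  set c : ℝ≥0∞ := ENNReal.ofReal (Real.exp (-(t * (2 * L)))) / Y with hc
  have hcY : c * Y = ENNReal.ofReal (Real.exp (-(t * (2 * L)))) := ENNReal.div_mul_cancel hY0 hYt
  have hct : c ≠ ∞ := ENNReal.div_ne_top ENNReal.ofReal_ne_top hY0
  have hc0 : c ≠ 0 := by
    rw [hc, Ne, ENNReal.div_eq_zero_iff, not_or]
    exact ⟨by simpa using Real.exp_pos _, hYt⟩
  -- Each induction step extends the range of `T` by the least length `len a`. For `T > 2L`,
  -- removing the first edge leaves at least `L`, and `k Y > 1` with `y = x + x y` reproduces the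
  -- bound.
  have key : ∀ n : ℕ, ∀ T, L ≤ T → T ≤ 2 * L + n * len a → ∀ e, hol e ∈ F →
      c * y (hol e) * ENNReal.ofReal (Real.exp (t * T)) ≤ count R hol len T e := by
    have base : ∀ T, L ≤ T → T ≤ 2 * L → ∀ e, hol e ∈ F →
        c * y (hol e) * ENNReal.ofReal (Real.exp (t * T)) ≤ count R hol len T e := by
      intro T h1 h2 e he
      refine le_trans ?_ (one_le_count ((hbmax _ he).trans h1))
      calc c * y (hol e) * ENNReal.ofReal (Real.exp (t * T))
          ≤ c * Y * ENNReal.ofReal (Real.exp (t * (2 * L))) := by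
            gcongr
            exact hyY _ he
        _ = 1 := by
          rw [hcY, ← ENNReal.ofReal_mul (Real.exp_pos _).le, ← Real.exp_add, neg_add_cancel,
            Real.exp_zero, ENNReal.ofReal_one]
    intro n
    induction n with
    | zero => intro T h1 h2; exact base T h1 (by simpa using h2)
    | succ n ih =>
      intro T h1 h2 e he
      rcases le_or_gt T (2 * L) with hT | hT
      · exact base T h1 hT e he
      have hle : len (hol e) ≤ L := hbmax _ he
      have hge : len a ≤ len (hol e) := hamin _ he
      push_cast at h2
      have ih' := ih (T - len (hol e)) (by linarith) (by linarith)
      classical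
      set D := ENNReal.ofReal (Real.exp (t * (T - len (hol e)))) with hD
      have hDx : D = ENNReal.ofReal (Real.exp (t * T)) *
          ENNReal.ofReal (Real.exp (-t * len (hol e))) := by
        rw [hD, ← ENNReal.ofReal_mul (Real.exp_pos _).le, ← Real.exp_add]
        ring_nf
      set g : V → ℝ≥0∞ := fun v => if v ∈ F then c * y v * D else 0 with hg
      have h3 : ∑' v, g v = c * Y * D := by
        rw [tsum_eq_sum (s := F) (fun v hv => by simp [hg, hv]), hY, Finset.mul_sum,
          Finset.sum_mul]
        exact Finset.sum_congr rfl fun v hv => by simp [hg, hv]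
      have h4 := hR e g
      rw [h3] at h4
      refine le_trans ?_ (tsum_count_le T e)
      calc c * y (hol e) * ENNReal.ofReal (Real.exp (t * T))
          = c * (ENNReal.ofReal (Real.exp (-t * len (hol e))) +
              ENNReal.ofReal (Real.exp (-t * len (hol e))) * y (hol e)) *
              ENNReal.ofReal (Real.exp (t * T)) := by rw [← hy]
        _ = c * D * 1 + c * y (hol e) * D := by rw [hDx]; ring
        _ ≤ c * D * (k * Y) + c * y (hol e) * D := by gcongr
        _ = k * (c * Y * D) + g (hol e) := by simp only [hg, if_pos he]; ring
        _ = _ := h4.symm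
        _ ≤ _ := by
          refine ENNReal.tsum_le_tsum fun e' => Set.indicator_le_indicator ?_
          simp only [hg]
          split_ifs with h
          · exact ih' e' h
          · exact zero_le
  obtain ⟨e, he⟩ := hsurj v₀
  have hcy : c * y v₀ ≠ ∞ := ENNReal.mul_ne_top hct (hyt v₀)
  refine ⟨(c * y v₀).toReal, ENNReal.toReal_pos (mul_ne_zero hc0 (hypos _)) hcy, L,
    fun T hT => ?_⟩
  rw [ENNReal.ofReal_mul ENNReal.toReal_nonneg, ENNReal.ofReal_toReal hcy]
  obtain ⟨n, hn⟩ := exists_nat_ge ((T - 2 * L) / len a)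
  have hn' : T ≤ 2 * L + n * len a := by
    rw [div_le_iff₀ (hlen a)] at hn
    linarith
  have := key n T hT hn' e (he ▸ hv₀)
  rw [he] at this
  exact this.trans (ENNReal.le_tsum e)

end Count

end ChainSum

/-! ### Sums of exponentials in the parameter `t`, and growth rates -/

namespace ExpSum

variable {ι : Type*} {l : ι → ℝ}

theorem hasDerivAt (hl : ∀ i, 0 ≤ l i) (hs : ∀ t : ℝ, 0 < t → Summable fun i => Real.exp (-t * l i))
    {t : ℝ} (ht : 0 < t) : Summable (fun i => l i * Real.exp (-t * l i)) ∧
      HasDerivAt (fun u : ℝ => ∑' i, Real.exp (-u * l i)) (∑' i, -(l i * Real.exp (-t * l i))) t := by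
  -- Dominating series for `u > t/2`: half of the decay `exp(-t l/2)` absorbs the factor `l` through
  -- `l ≤ (4/t) exp(t l/4)`.
  have hu : Summable fun i => 4 / t * Real.exp (-(t / 4) * l i) :=
    (hs (t / 4) (by linarith)).mul_left _
  have hbound : ∀ i, ∀ u ∈ Set.Ioi (t / 2), l i * Real.exp (-u * l i) ≤
      4 / t * Real.exp (-(t / 4) * l i) := by
    intro i u hu
    have h1 : l i ≤ 4 / t * Real.exp (t / 4 * l i) := by
      have := Real.add_one_le_exp (t / 4 * l i)
      rw [div_mul_eq_mul_div, le_div_iff₀ ht]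
      linarith
    have h2 : Real.exp (-u * l i) ≤ Real.exp (-(t / 2) * l i) := by
      apply Real.exp_le_exp.2
      nlinarith [hl i, Set.mem_Ioi.1 hu]
    calc l i * Real.exp (-u * l i)
        ≤ (4 / t * Real.exp (t / 4 * l i)) * Real.exp (-(t / 2) * l i) :=
          mul_le_mul h1 h2 (Real.exp_pos _).le (by positivity)
      _ = 4 / t * Real.exp (-(t / 4) * l i) := by
          rw [mul_assoc, ← Real.exp_add]
          ring_nf
  have hnn : ∀ i (u : ℝ), 0 ≤ l i * Real.exp (-u * l i) := fun i u =>
    mul_nonneg (hl i) (Real.exp_pos _).le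
  have htm : t ∈ Set.Ioi (t / 2) := by simp only [Set.mem_Ioi]; linarith
  refine ⟨hu.of_nonneg_of_le (fun i => hnn i t) fun i => hbound i t htm, ?_⟩
  refine hasDerivAt_tsum_of_isPreconnected (g := fun i u => Real.exp (-u * l i))
    (g' := fun i u => -(l i * Real.exp (-u * l i))) hu isOpen_Ioi isPreconnected_Ioi ?_ ?_ htm
    (hs t ht) htm
  · intro i u _
    have := (((hasDerivAt_id u).neg).mul_const (l i)).exp
    convert! this using 1
    simp; ring
  · intro i u hu
    rw [norm_neg, Real.norm_of_nonneg (hnn i u)]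
    exact hbound i u hu

theorem exists_hasDerivAt_neg [Nonempty ι] (hl : ∀ i, 0 < l i)
    (hs : ∀ t : ℝ, 0 < t → Summable fun i => Real.exp (-t * l i)) {t : ℝ} (ht : 0 < t) :
    ∃ d < 0, HasDerivAt (fun u : ℝ => ∑' i, Real.exp (-u * l i)) d t := by
  obtain ⟨hsum, hder⟩ := hasDerivAt (fun i => (hl i).le) hs ht
  refine ⟨_, ?_, hder⟩
  rw [tsum_neg, neg_lt_zero]
  obtain ⟨i⟩ := ‹Nonempty ι›
  exact hsum.tsum_pos (fun i => mul_nonneg (hl i).le (Real.exp_pos _).le) i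
    (mul_pos (hl i) (Real.exp_pos _))

theorem strictAntiOn [Nonempty ι] (hl : ∀ i, 0 < l i)
    (hs : ∀ t : ℝ, 0 < t → Summable fun i => Real.exp (-t * l i)) :
    StrictAntiOn (fun u : ℝ => ∑' i, Real.exp (-u * l i)) (Set.Ioi 0) := by
  refine strictAntiOn_of_deriv_neg (convex_Ioi 0) (fun t ht => ?_) fun t ht => ?_
  · obtain ⟨d, -, hd⟩ := exists_hasDerivAt_neg hl hs ht
    exact hd.continuousAt.continuousWithinAt
  · rw [interior_Ioi] at ht
    obtain ⟨d, hd0, hd⟩ := exists_hasDerivAt_neg hl hs ht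
    rw [hd.deriv]
    exact hd0

theorem exists_eq {i j : ι} (hij : i ≠ j) {m : ℝ} (hm : 0 < m) (hl : ∀ i, m ≤ l i)
    (hs : ∀ t : ℝ, 0 < t → Summable fun i => Real.exp (-t * l i)) {y : ℝ} (hy0 : 0 < y)
    (hy1 : y ≤ 1) : ∃ t > 0, ∑' i, Real.exp (-t * l i) = y := by
  have : Nonempty ι := ⟨i⟩
  have hl' : ∀ i, 0 < l i := fun i => hm.trans_le (hl i)
  have hcont : ContinuousOn (fun u : ℝ => ∑' i, Real.exp (-u * l i)) (Set.Ioi 0) := fun t ht => by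
    obtain ⟨d, -, hd⟩ := exists_hasDerivAt_neg hl' hs ht
    exact hd.continuousAt.continuousWithinAt
  -- Two terms tend to `1 + 1` as `t → 0`, which covers the boundary value `y = 1`, i.e. `k = 1`.
  obtain ⟨t₁, ht₁, h₁⟩ : ∃ t > 0, y ≤ ∑' i, Real.exp (-t * l i) := by
    have hlim : Tendsto (fun t : ℝ => Real.exp (-t * l i) + Real.exp (-t * l j)) (𝓝[>] 0)
        (𝓝 (1 + 1)) := by
      have hc : Continuous fun t : ℝ => Real.exp (-t * l i) + Real.exp (-t * l j) := by fun_prop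
      simpa using (hc.tendsto 0).mono_left (nhdsWithin_le_nhds (s := Set.Ioi 0))
    obtain ⟨t, ht, ht0⟩ := ((hlim.eventually (lt_mem_nhds (by norm_num : (1 : ℝ) < 1 + 1))).and
      self_mem_nhdsWithin).exists
    refine ⟨t, ht0, hy1.trans (ht.le.trans ?_)⟩
    classical
    have := (hs t ht0).sum_le_tsum {i, j} fun _ _ => (Real.exp_pos _).le
    rwa [Finset.sum_pair hij] at this
  -- The uniform gap `m` lets a factor `exp(-(t-1)m)` be taken out of the sum at `t = 1`.
  obtain ⟨t₂, ht₂, h₂⟩ : ∃ t > 0, ∑' i, Real.exp (-t * l i) ≤ y := by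
    have hle : ∀ t : ℝ, 1 ≤ t → ∑' i, Real.exp (-t * l i) ≤
        Real.exp (-(t - 1) * m) * ∑' i, Real.exp (-1 * l i) := by
      intro t ht
      rw [← tsum_mul_left]
      refine (hs t (by linarith)).tsum_le_tsum (fun i => ?_) ((hs 1 one_pos).mul_left _)
      rw [← Real.exp_add]
      apply Real.exp_le_exp.2
      nlinarith [hl i]
    have hlim : Tendsto (fun t : ℝ => Real.exp (-(t - 1) * m) * ∑' i, Real.exp (-1 * l i)) atTop
        (𝓝 (0 * ∑' i, Real.exp (-1 * l i))) := by
      refine Tendsto.mul_const _ (Real.tendsto_exp_atBot.comp ?_)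
      exact (tendsto_neg_atTop_atBot.comp (tendsto_atTop_add_const_right _ (-1) tendsto_id)).atBot_mul_const hm
    rw [zero_mul] at hlim
    obtain ⟨t, ht, ht1⟩ := ((hlim.eventually (gt_mem_nhds hy0)).and (eventually_ge_atTop 1)).exists
    exact ⟨t, one_pos.trans_le ht1, (hle t ht1).trans ht.le⟩
  obtain ⟨t, ht, hty⟩ := (isPreconnected_Ioi (a := (0 : ℝ))).intermediate_value ht₂ ht₁ hcont
    ⟨h₂, h₁⟩
  exact ⟨t, ht, hty⟩

/-- The exponential growth rate is determined by upper and lower exponential bounds. -/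
theorem tendsto_log_div {N : ℝ → ℝ} {h : ℝ} (hh : 0 < h)
    (hlow : ∀ t, 0 < t → t < h → ∃ c > 0, ∃ T₀ : ℝ, ∀ T ≥ T₀, c * Real.exp (t * T) ≤ N T)
    (hup : ∀ t, h < t → ∃ c > 0, ∀ T, N T ≤ c * Real.exp (t * T)) :
    Tendsto (fun T : ℝ => 1 / T * Real.log (N T)) atTop (𝓝 h) := by
  have hlim : ∀ c t : ℝ, Tendsto (fun T : ℝ => 1 / T * Real.log c + t) atTop (𝓝 t) := by
    intro c t
    have := (tendsto_const_nhds (x := (1 : ℝ)).div_atTop tendsto_id).mul_const (Real.log c)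
    simpa using this.add_const t
  have hlog : ∀ c t T : ℝ, 0 < c → 0 < T →
      1 / T * Real.log (c * Real.exp (t * T)) = 1 / T * Real.log c + t := by
    intro c t T hc hT
    rw [Real.log_mul hc.ne' (Real.exp_pos _).ne', Real.log_exp]
    field_simp
  have hpos : ∀ᶠ T in atTop, 0 < N T := by
    obtain ⟨c, hc, T₀, hT₀⟩ := hlow (h / 2) (by linarith) (by linarith)
    filter_upwards [eventually_ge_atTop T₀] with T hT
    exact (mul_pos hc (Real.exp_pos _)).trans_le (hT₀ T hT)
  refine tendsto_order.2 ⟨fun a ha => ?_, fun a ha => ?_⟩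
  · obtain ⟨t, hta, hth⟩ := exists_between (max_lt ha hh)
    obtain ⟨c, hc, T₀, hT₀⟩ := hlow t ((le_max_right _ _).trans_lt hta) hth
    filter_upwards [(hlim c t).eventually (lt_mem_nhds ((le_max_left _ _).trans_lt hta)),
      eventually_ge_atTop T₀, eventually_gt_atTop 0] with T h1 h2 h3
    refine h1.trans_le ?_
    rw [← hlog c t T hc h3]
    exact mul_le_mul_of_nonneg_left (Real.log_le_log (mul_pos hc (Real.exp_pos _)) (hT₀ T h2))
      (by positivity)
  · obtain ⟨t, hht, hta⟩ := exists_between ha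
    obtain ⟨c, hc, hN⟩ := hup t hht
    filter_upwards [(hlim c t).eventually (gt_mem_nhds hta), eventually_gt_atTop 0, hpos]
      with T h1 h3 h4
    refine lt_of_le_of_lt ?_ h1
    rw [← hlog c t T hc h3]
    exact mul_le_mul_of_nonneg_left (Real.log_le_log h4 (hN T)) (by positivity)

end ExpSum

/-! ### Convergence of the lattice sum -/

section Lattice

theorem summable_pow_natAbs {r : ℝ} (h0 : 0 ≤ r) (h1 : r < 1) :
    Summable fun a : ℤ => r ^ a.natAbs := by
  refine Summable.of_nat_of_neg ?_ ?_
  · simpa using summable_geometric_of_lt_one h0 h1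
  · simpa using summable_geometric_of_lt_one h0 h1

theorem exists_norm_lower_bound {n k : ℕ} (hn : 0 < n)
    (A : Matrix.SpecialLinearGroup (Fin 2) ℝ) : ∃ c > 0, ∀ a b : ℤ,
      c * (a.natAbs + b.natAbs) ≤ ‖slPlane A ⟨(a : ℝ) / Real.sqrt (n * (k + 1)),
        (b : ℝ) / Real.sqrt (n * (k + 1))⟩‖ := by
  have hs : 0 < Real.sqrt (n * (k + 1)) := by
    apply Real.sqrt_pos.2
    have : (0 : ℝ) < n := by exact_mod_cast hn
    positivity
  set s := Real.sqrt (n * (k + 1))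
  set B : ℂ →L[ℝ] ℂ := ((slPlane A).symm : ℂ →L[ℝ] ℂ)
  have hB : 0 < ‖B‖ + 1 := by positivity
  -- `|a| + |b| ≤ 2s‖z‖` and `‖z‖ ≤ ‖A⁻¹‖ ‖Az‖`; the `+ 1` makes positivity immediate.
  refine ⟨1 / (2 * s * (‖B‖ + 1)), by positivity, fun a b => ?_⟩
  set z : ℂ := ⟨(a : ℝ) / s, (b : ℝ) / s⟩ with hz
  have h1 : ‖z‖ ≤ (‖B‖ + 1) * ‖slPlane A z‖ := by
    have h2 := B.le_opNorm (slPlane A z)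
    have h3 : B (slPlane A z) = z := (slPlane A).symm_apply_apply z
    rw [h3] at h2
    nlinarith [norm_nonneg (slPlane A z)]
  have ha : (a.natAbs : ℝ) = s * |z.re| := by
    rw [Nat.cast_natAbs, Int.cast_abs, hz, abs_div, abs_of_pos hs]
    field_simp
  have hb : (b.natAbs : ℝ) = s * |z.im| := by
    rw [Nat.cast_natAbs, Int.cast_abs, hz, abs_div, abs_of_pos hs]
    field_simp
  have h4 := Complex.abs_re_le_norm z
  have h5 := Complex.abs_im_le_norm z
  rw [ha, hb, div_mul_eq_mul_div, div_le_iff₀ (by positivity)]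
  nlinarith

theorem exists_norm_le_of_mem_lattice {n k : ℕ} (hn : 0 < n)
    (A : Matrix.SpecialLinearGroup (Fin 2) ℝ) :
    ∃ m > 0, ∀ v ∈ slPlane A '' scaledLattice n k, m ≤ ‖v‖ := by
  obtain ⟨c, hc, h⟩ := exists_norm_lower_bound (k := k) hn A
  refine ⟨c, hc, ?_⟩
  rintro _ ⟨_, ⟨a, b, hab, rfl⟩, rfl⟩
  refine le_trans ?_ (h a b)
  have : 1 ≤ a.natAbs + b.natAbs := by
    by_contra hc
    refine hab (Prod.ext ?_ ?_) <;> simp only <;> omega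
  have h2 : (1 : ℝ) ≤ a.natAbs + b.natAbs := by exact_mod_cast this
  nlinarith

/-- Comparison with a product of two geometric series over `ℤ × ℤ`. -/
theorem summable_exp_lattice {n k : ℕ} (hn : 0 < n) (A : Matrix.SpecialLinearGroup (Fin 2) ℝ)
    {t : ℝ} (ht : 0 < t) :
    Summable fun v : slPlane A '' scaledLattice n k => Real.exp (-t * ‖(v : ℂ)‖) := by
  obtain ⟨c, hc, h⟩ := exists_norm_lower_bound (k := k) hn A
  have hex : ∀ v : slPlane A '' scaledLattice n k, ∃ p : ℤ × ℤ,
      (v : ℂ) = slPlane A ⟨(p.1 : ℝ) / Real.sqrt (n * (k + 1)),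
        (p.2 : ℝ) / Real.sqrt (n * (k + 1))⟩ := by
    rintro ⟨_, _, ⟨a, b, -, rfl⟩, rfl⟩
    exact ⟨(a, b), rfl⟩
  choose p hp using hex
  have hinj : Function.Injective p := fun v w hvw => Subtype.ext (by rw [hp v, hp w, hvw])
  set r := Real.exp (-t * c) with hr
  have hr1 : r < 1 := Real.exp_lt_one_iff.2 (by nlinarith)
  have hsum := summable_pow_natAbs (Real.exp_pos _).le hr1
  have hF := hsum.mul_of_nonneg hsum (fun a => by positivity) (fun a => by positivity)
  refine (hF.comp_injective hinj).of_nonneg_of_le (fun _ => (Real.exp_pos _).le) fun v => ?_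
  simp only [Function.comp]
  rw [← pow_add, ← Real.exp_nat_mul]
  apply Real.exp_le_exp.2
  have := h (p v).1 (p v).2
  rw [← hp v] at this
  push_cast
  nlinarith

theorem exists_ne_lattice {n k : ℕ} (hn : 0 < n) (A : Matrix.SpecialLinearGroup (Fin 2) ℝ) :
    ∃ v w : slPlane A '' scaledLattice n k, v ≠ w := by
  have hs : 0 < Real.sqrt (n * (k + 1)) := by
    apply Real.sqrt_pos.2
    have : (0 : ℝ) < n := by exact_mod_cast hn
    positivity
  refine ⟨⟨_, _, ⟨1, 0, by simp, rfl⟩, rfl⟩, ⟨_, _, ⟨0, 1, by simp, rfl⟩, rfl⟩, fun h => ?_⟩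
  have h1 := (slPlane A).injective (congrArg Subtype.val h)
  rw [Complex.ext_iff] at h1
  simp only [Int.cast_one, Int.cast_zero, zero_div] at h1
  exact (one_div_pos.2 hs).ne' h1.1

end Lattice

/-! ### Lattice vectors as multiples of primitive ones -/

namespace TranslationStructure.TorusProjection

open scoped ENNReal

variable {X T : Type*} [TopologicalSpace X] [TopologicalSpace T] [AddCommGroup T] [T2Space T]
  {S : TranslationStructure X} (q : S.TorusProjection T)

/-- Discreteness gives a least `t₀ > 0` with `t₀ w` in the lattice. The remainder `1 - N t₀` of
division by `t₀` again gives a lattice vector, so minimality makes it zero. -/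
theorem exists_primitive {w : ℂ} (hw : w ≠ 0) (h0 : q.cov w = 0) :
    ∃ v, q.IsPrimitive v ∧ ∃ n : ℕ, w = ((n + 1 : ℕ) : ℂ) * v := by
  obtain ⟨δ, hδ, hinj⟩ := q.exists_injectivity_radius
  have hwn : 0 < ‖w‖ := norm_pos_iff.2 hw
  have hlow : ∀ t : ℝ, 0 < t → q.cov (t * w) = 0 → δ / ‖w‖ ≤ t := by
    intro t ht h
    rw [div_le_iff₀ hwn]
    by_contra hc
    have := hinj (t * w) (by
      rw [norm_mul, Complex.norm_real, Real.norm_of_nonneg ht.le]; linarith) h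
    rcases mul_eq_zero.1 this with h | h
    · exact ht.ne' (by exact_mod_cast h)
    · exact hw h
  set K : Set ℝ := Set.Icc (δ / ‖w‖) 1 ∩ {t | q.cov (t * w) = 0} with hK
  have hKc : IsCompact K := by
    refine isCompact_Icc.inter_right ?_
    refine isClosed_singleton.preimage (f := fun t : ℝ => q.cov (t * w)) (t := {0}) ?_
    exact q.isLocalHomeomorph_cov.continuous.comp (by fun_prop)
  have h1 : q.cov (((1 : ℝ) : ℂ) * w) = 0 := by simpa using h0
  obtain ⟨t₀, ⟨⟨ht₀, ht₀1⟩, ht₀c⟩, hmin⟩ := hKc.exists_isLeast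
    ⟨1, ⟨hlow 1 one_pos h1, le_rfl⟩, h1⟩
  have hpos : 0 < t₀ := (div_pos hδ hwn).trans_le ht₀
  have hmin' : ∀ t : ℝ, 0 < t → t < t₀ → q.cov (t * w) ≠ 0 := fun t ht htt h =>
    absurd (hmin ⟨⟨hlow t ht h, htt.le.trans ht₀1⟩, h⟩) (not_le.2 htt)
  have hv : q.IsPrimitive (t₀ * w) := by
    refine ⟨mul_ne_zero (by exact_mod_cast hpos.ne') hw, ht₀c, fun u hu => ?_⟩
    rw [← mul_assoc, ← Complex.ofReal_mul]
    exact hmin' _ (mul_pos hu.1 hpos) (by nlinarith [hu.2])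
  set N := ⌊1 / t₀⌋₊ with hN
  have hN1 : N * t₀ ≤ 1 := by
    have := Nat.floor_le (one_div_pos.2 hpos).le
    rwa [le_div_iff₀ hpos] at this
  have hN2 : 1 < (N + 1) * t₀ := by
    have := Nat.lt_floor_add_one (1 / t₀)
    rwa [div_lt_iff₀ hpos] at this
  have hf : q.cov (((1 - N * t₀ : ℝ) : ℂ) * w) = 0 := by
    have e : ((1 - N * t₀ : ℝ) : ℂ) * w = w - N • (t₀ * w) := by
      rw [nsmul_eq_mul]; push_cast; ring
    rw [e, map_sub, map_nsmul, ht₀c, h0, smul_zero, sub_zero]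
  have heq : N * t₀ = 1 := by
    by_contra hne
    exact hmin' _ (sub_pos.2 (lt_of_le_of_ne hN1 hne)) (by linarith) hf
  refine ⟨_, hv, N - 1, ?_⟩
  have hNpos : 1 ≤ N := by
    rcases Nat.eq_zero_or_pos N with h | h
    · rw [h] at heq; simp at heq
    · exact h
  rw [Nat.sub_add_cancel hNpos, ← mul_assoc]
  have : (N : ℂ) * t₀ = 1 := by exact_mod_cast heq
  rw [this, one_mul]

/-- Every nonzero lattice vector is in a unique way a positive multiple of a primitive one. -/
theorem tsum_lattice (g : ℂ → ℝ≥0∞) {L : Set ℂ} (hL : ∀ w, w ∈ L ↔ w ≠ 0 ∧ q.cov w = 0) :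
    ∑' w : L, g w = ∑' v : {v // q.IsPrimitive v}, ∑' n : ℕ, g (((n + 1 : ℕ) : ℂ) * v) := by
  rw [← ENNReal.tsum_prod (f := fun (v : {v // q.IsPrimitive v}) (n : ℕ) =>
    g (((n + 1 : ℕ) : ℂ) * v))]
  let F : {v // q.IsPrimitive v} × ℕ → L := fun a => ⟨((a.2 + 1 : ℕ) : ℂ) * a.1, (hL _).2
    ⟨mul_ne_zero (by exact_mod_cast a.2.succ_ne_zero) a.1.2.1, by
      rw [← nsmul_eq_mul, map_nsmul, a.1.2.2.1, smul_zero]⟩⟩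
  have hF : Function.Bijective F := by
    constructor
    · rintro ⟨⟨v, hv⟩, n⟩ ⟨⟨v', hv'⟩, n'⟩ h
      have h1 : ((n + 1 : ℕ) : ℂ) * v = ((n' + 1 : ℕ) : ℂ) * v' := congrArg Subtype.val h
      have hn : (0 : ℝ) < (n + 1 : ℕ) := by positivity
      have hn' : (0 : ℝ) < (n' + 1 : ℕ) := by positivity
      have hnc : ((n + 1 : ℕ) : ℂ) ≠ 0 := by exact_mod_cast n.succ_ne_zero
      have h2 : v = ((((n' + 1 : ℕ) : ℝ) / ((n + 1 : ℕ) : ℝ) : ℝ) : ℂ) * v' := by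
        push_cast at h1 hnc ⊢
        rw [div_mul_eq_mul_div, ← h1]
        field_simp
      have h3 := hv.eq_of_smul hv' (div_pos hn' hn) h2
      rw [h3, Complex.ofReal_one, one_mul] at h2
      rw [div_eq_one_iff_eq hn.ne'] at h3
      have h4 : n' = n := Nat.succ_injective (by exact_mod_cast h3)
      subst h2 h4
      rfl
    · rintro ⟨w, hw⟩
      obtain ⟨hw0, hwc⟩ := (hL w).1 hw
      obtain ⟨v, hv, n, hn⟩ := q.exists_primitive hw0 hwc
      exact ⟨(⟨v, hv⟩, n), Subtype.ext hn.symm⟩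
  rw [← (Equiv.ofBijective F hF).tsum_eq]
  rfl

end TranslationStructure.TorusProjection

/-! ### Path sums and path counts -/

namespace TranslationStructure

open scoped ENNReal

section Paths

variable {X T : Type*} [TopologicalSpace X] [TopologicalSpace T] [AddCommGroup T] [T2Space T]
  {S : TranslationStructure X} {k : ℕ}
  {C : S.ConeAtlas k} {q : S.TorusProjection T}

/-- The weights `x + x² + x³ + ⋯` with `x = exp (-t ‖v‖)`. -/
noncomputable def geometricWeight (t : ℝ) (v : ℂ) : ℝ≥0∞ :=
  ∑' n : ℕ, ENNReal.ofReal (Real.exp (-t * ‖((n + 1 : ℕ) : ℂ) * v‖))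

theorem geometricWeight_eq (t : ℝ) (v : ℂ) : geometricWeight t v =
    ENNReal.ofReal (Real.exp (-t * ‖v‖)) +
      ENNReal.ofReal (Real.exp (-t * ‖v‖)) * geometricWeight t v := by
  conv_lhs => rw [geometricWeight, tsum_eq_zero_add' ENNReal.summable]
  rw [geometricWeight, ← ENNReal.tsum_mul_left]
  congr 1
  · simp
  · refine tsum_congr fun n => ?_
    rw [← ENNReal.ofReal_mul (Real.exp_pos _).le, ← Real.exp_add]
    congr 2
    rw [norm_mul, norm_mul, Complex.norm_natCast, Complex.norm_natCast]
    push_cast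
    ring

theorem tsum_geometricWeight {L : Set ℂ} (hL : ∀ w, w ∈ L ↔ w ≠ 0 ∧ q.cov w = 0) {t : ℝ}
    (hs : Summable fun w : L => Real.exp (-t * ‖(w : ℂ)‖)) :
    ∑' v : {v // q.IsPrimitive v}, geometricWeight t v =
      ENNReal.ofReal (∑' w : L, Real.exp (-t * ‖(w : ℂ)‖)) := by
  rw [ENNReal.ofReal_tsum_of_nonneg (fun _ => (Real.exp_pos _).le) hs]
  exact (q.tsum_lattice (fun w => ENNReal.ofReal (Real.exp (-t * ‖w‖))) hL).symm

variable [IsTopologicalAddGroup T]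

theorem prod_ofReal_exp (q : S.TorusProjection T) (t : ℝ) (l : List S.SaddleConnection) :
    (l.map fun e => ENNReal.ofReal (Real.exp (-t * ‖(primitiveHol q e : ℂ)‖))).prod =
      ENNReal.ofReal (Real.exp (-t * (l.map SaddleConnection.length).sum)) := by
  induction l with
  | nil => simp
  | cons e l ih =>
    rw [List.map_cons, List.prod_cons, ih, ← ENNReal.ofReal_mul (Real.exp_pos _).le,
      ← Real.exp_add, List.map_cons, List.sum_cons, mul_add]
    rfl

theorem hasSum_of_tsum_ofReal {α : Type*} {g : α → ℝ} (hg : ∀ a, 0 ≤ g a) {s : ℝ} (hs : 0 ≤ s)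
    (h : ∑' a, ENNReal.ofReal (g a) = ENNReal.ofReal s) : HasSum g s := by
  have h1 := ENNReal.hasSum_toReal (f := fun a => ENNReal.ofReal (g a))
    (by rw [h]; exact ENNReal.ofReal_ne_top)
  rw [← ENNReal.tsum_toReal_eq fun _ => ENNReal.ofReal_ne_top, h, ENNReal.toReal_ofReal hs] at h1
  simpa only [ENNReal.toReal_ofReal (hg _)] using h1

/-- Terms of a convergent sum tend to zero, while each path counted here contributes at least
`exp(-t T₀)`. -/
theorem finite_saddlePath {t : ℝ} (ht : 0 < t)
    (hs : Summable fun p : S.SaddlePath => Real.exp (-t * p.length)) (T₀ : ℝ) :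
    {p : S.SaddlePath | p.length ≤ T₀}.Finite := by
  have hev := hs.tendsto_cofinite_zero.eventually (gt_mem_nhds (Real.exp_pos (-t * T₀)))
  rw [Filter.eventually_cofinite] at hev
  refine hev.subset fun p hp => ?_
  have hp' : p.length ≤ T₀ := hp
  refine not_lt.2 (Real.exp_le_exp.2 ?_)
  nlinarith

theorem ncard_saddlePath_le {t : ℝ} {s : ℝ} (ht : 0 < t)
    (hs : HasSum (fun p : S.SaddlePath => Real.exp (-t * p.length)) s) (T₀ : ℝ) :
    ({p : S.SaddlePath | p.length ≤ T₀}.ncard : ℝ) ≤ s * Real.exp (t * T₀) := by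
  have hfin := finite_saddlePath ht hs.summable T₀
  have h1 := sum_le_hasSum hfin.toFinset (fun _ _ => (Real.exp_pos _).le) hs
  have h2 : hfin.toFinset.card • Real.exp (-t * T₀) ≤
      ∑ p ∈ hfin.toFinset, Real.exp (-t * p.length) := by
    refine Finset.card_nsmul_le_sum _ _ _ fun p hp => Real.exp_le_exp.2 ?_
    have hp' : p.length ≤ T₀ := by simpa using hp
    nlinarith
  rw [Set.ncard_eq_toFinset_card _ hfin]
  rw [nsmul_eq_mul] at h2
  have h3 := h2.trans h1
  rw [neg_mul, Real.exp_neg, ← div_eq_mul_inv, div_le_iff₀ (Real.exp_pos _)] at h3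
  exact h3

theorem tsum_count_eq (q : S.TorusProjection T) (T₀ : ℝ) :
    ∑' e, ChainSum.count IsGeodesicJoin (primitiveHol q) (fun v => ‖(v : ℂ)‖) T₀ e =
      ({p : S.SaddlePath | p.length ≤ T₀}.encard : ℝ≥0∞) := by
  have h := ChainSum.tsum_chain (IsGeodesicJoin (S := S))
    ({l | (l.map fun e => ‖(primitiveHol q e : ℂ)‖).sum ≤ T₀}.indicator 1)
  refine h.symm.trans ?_
  rw [← ENNReal.tsum_set_one, tsum_subtype {p : S.SaddlePath | p.length ≤ T₀} fun _ => 1]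
  rfl

variable [T2Space X] [CompactSpace X]

theorem hasSum_saddlePath (hC : C.IsSmall q) {L : Set ℂ}
    (hL : ∀ w, w ∈ L ↔ w ≠ 0 ∧ q.cov w = 0) {t : ℝ} (ht : 0 < t)
    (hs : Summable fun w : L => Real.exp (-t * ‖(w : ℂ)‖)) {f : ℝ}
    (hf : ∑' w : L, Real.exp (-t * ‖(w : ℂ)‖) = f) (hkf : k * f < 1) :
    HasSum (fun p : S.SaddlePath => Real.exp (-t * p.length))
      (S.sing.ncard * (k + 1) * f / (1 - k * f)) := by
  have hf0 : 0 ≤ f := hf ▸ tsum_nonneg fun _ => (Real.exp_pos _).le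
  have hY := tsum_geometricWeight hL hs
  rw [hf] at hY
  have hden : 0 < 1 - k * f := by linarith
  have hτ0 : 0 ≤ f / (1 - k * f) := by positivity
  have key := ChainSum.tsum_chain_prod (R := IsGeodesicJoin) (hol := primitiveHol q)
    (x := fun v => ENNReal.ofReal (Real.exp (-t * ‖(v : ℂ)‖))) (y := fun v => geometricWeight t v)
    (τ := ENNReal.ofReal (f / (1 - k * f)))
    (tsum_primitiveHol hC) (tsum_isGeodesicJoin hC) (fun v => by
      rw [ENNReal.ofReal_lt_one, Real.exp_lt_one_iff]
      have := norm_pos_iff.2 v.2.1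
      nlinarith) (fun v => geometricWeight_eq t v) (by rw [hY]; exact ENNReal.ofReal_ne_top) (by
      rw [hY, ← ENNReal.ofReal_natCast, ← ENNReal.ofReal_mul (by positivity)]
      exact ENNReal.ofReal_lt_one.2 hkf) ENNReal.ofReal_ne_top (by
      rw [hY, ← ENNReal.ofReal_natCast, ← ENNReal.ofReal_mul (by positivity),
        ← ENNReal.ofReal_mul (by positivity), ← ENNReal.ofReal_add hf0 (by positivity)]
      congr 1
      linear_combination div_mul_cancel₀ f hden.ne')
  simp only [prod_ofReal_exp q] at key
  refine hasSum_of_tsum_ofReal (fun _ => (Real.exp_pos _).le) (by positivity) (key.trans ?_)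
  rw [← ENNReal.ofReal_natCast, ← ENNReal.ofReal_mul (by positivity)]
  congr 1
  push_cast
  ring

theorem exists_le_ncard (hC : C.IsSmall q) (hne : S.sing.Nonempty) {L : Set ℂ}
    (hL : ∀ w, w ∈ L ↔ w ≠ 0 ∧ q.cov w = 0) {t : ℝ} (ht : 0 < t)
    (hs : Summable fun w : L => Real.exp (-t * ‖(w : ℂ)‖))
    (hkf : 1 < k * ∑' w : L, Real.exp (-t * ‖(w : ℂ)‖))
    (hfin : ∀ T₀ : ℝ, {p : S.SaddlePath | p.length ≤ T₀}.Finite) :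
    ∃ c > 0, ∃ T₁ : ℝ, ∀ T₀ ≥ T₁,
      c * Real.exp (t * T₀) ≤ ({p : S.SaddlePath | p.length ≤ T₀}.ncard : ℝ) := by
  have hY := tsum_geometricWeight hL hs
  obtain ⟨c, hc, T₁, h⟩ := ChainSum.exists_le_tsum_count (R := IsGeodesicJoin)
    (hol := primitiveHol q) (len := fun v => ‖(v : ℂ)‖) (y := fun v => geometricWeight t v)
    (tsum_isGeodesicJoin hC) (fun v => by
      obtain ⟨Φ, hΦ⟩ := exists_equiv_saddleConnection hC
      exact ⟨Φ (v, ⟨_, hne.some_mem⟩, 0), Subtype.ext (hΦ _ _ _).1⟩)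
    (fun v => norm_pos_iff.2 v.2.1) ht (fun v => geometricWeight_eq t v)
    (fun v => ne_top_of_le_ne_top (by rw [hY]; exact ENNReal.ofReal_ne_top)
      (ENNReal.le_tsum (f := fun v : {v // q.IsPrimitive v} => geometricWeight t v) v)) (by
      rw [hY, ← ENNReal.ofReal_natCast, ← ENNReal.ofReal_mul (by positivity)]
      exact ENNReal.one_lt_ofReal.2 hkf)
  refine ⟨c, hc, T₁, fun T₀ hT₀ => ?_⟩
  have h1 := h T₀ hT₀
  rw [tsum_count_eq q, ← (hfin T₀).cast_ncard_eq] at h1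
  rw [ENat.toENNReal_coe, ← ENNReal.ofReal_natCast] at h1
  exact (ENNReal.ofReal_le_ofReal_iff (by positivity)).1 h1

end Paths

/-- The area condition says `√(n(k+1)) = 1/s`, so the scaled lattice is the kernel of the torus map.
-/
theorem mem_image_scaledLattice_iff {n k : ℕ} {s : ℝ} (hs : 0 < s)
    (hns : (n : ℝ) * (k + 1) * s ^ 2 = 1) (A : Matrix.SpecialLinearGroup (Fin 2) ℝ) (w : ℂ) :
    w ∈ slPlane A '' scaledLattice n k ↔ w ≠ 0 ∧ squareCov s ((slPlane A).symm w) = 0 := by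
  have hsq : Real.sqrt (n * (k + 1)) = 1 / s := by
    rw [Real.sqrt_eq_iff_mul_self_eq_of_pos (by positivity)]
    field_simp
    linarith
  have hw : w ≠ 0 ↔ (slPlane A).symm w ≠ 0 := by simp
  rw [hw, squareCov_eq_zero_iff]
  constructor
  · rintro ⟨_, ⟨a, b, hab, rfl⟩, rfl⟩
    rw [ContinuousLinearEquiv.symm_apply_apply, hsq]
    refine ⟨fun h => hab ?_, a, b, by simp⟩
    rw [Complex.ext_iff] at h
    simpa [hs.ne'] using h
  · rintro ⟨h0, a, b, hab⟩
    refine ⟨(slPlane A).symm w, ⟨a, b, ?_, ?_⟩, by simp⟩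
    · rintro h
      rw [Prod.mk.injEq] at h
      refine h0 ?_
      rw [hab, h.1, h.2]
      apply Complex.ext <;> simp
    · rw [hsq, hab]
      simp

end TranslationStructure

/-! ### Assembly of the result -/

open TranslationStructure in
theorem lemma3p2 {X : Type*} [TopologicalSpace X] [T2Space X] [CompactSpace X] [ConnectedSpace X]
    (X₀ : TranslationStructure X) (n k : ℕ) (hk : 1 ≤ k)
    (hn : X₀.sing.ncard = n) (hcone : ∀ x ∈ X₀.sing, X₀.IsConePoint x k)
    (htiled : X₀.IsUnitAreaSquareTiled) (A : Matrix.SpecialLinearGroup (Fin 2) ℝ) :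
    (∀ t : ℝ, 0 < t →
      Summable (fun v : slPlane A '' scaledLattice n k => Real.exp (-t * ‖(v : ℂ)‖)) ∧
      ∃ d : ℝ, d < 0 ∧ HasDerivAt (fun u : ℝ => latticeSum n k u A) d t) ∧
    StrictAntiOn (fun t : ℝ => latticeSum n k t A) (Set.Ioi 0) ∧
    (∀ t : ℝ, 0 < t → latticeSum n k t A < 1 / k →
      HasSum (fun p : (X₀.act A).SaddlePath => Real.exp (-t * p.length))
        (n * (k + 1) * latticeSum n k t A / (1 - k * latticeSum n k t A))) ∧
    ∃ h : ℝ, 0 < h ∧ (X₀.act A).HasEntropy h ∧ latticeSum n k h A = 1 / k ∧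
      ∀ t : ℝ, 0 < t → latticeSum n k t A = 1 / k → t = h := by
  obtain ⟨N, s, htile, harea⟩ := htiled
  have hs := htile.1
  have hN := htile.eq_ncard_mul hcone
  rw [hn] at hN
  have hn0 : 0 < n := by
    rcases Nat.eq_zero_or_pos n with h | h
    · simp [hN, h] at harea
    · exact h
  have hk0 : (0 : ℝ) < k := by exact_mod_cast hk
  have hns : (n : ℝ) * (k + 1) * s ^ 2 = 1 := by rw [hN] at harea; exact_mod_cast harea
  obtain ⟨q₀, hq₀, -⟩ := htile.exists_torusProjection
  set q := q₀.act A with hq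
  obtain ⟨C, hC⟩ := exists_small_coneAtlas q (k := k) fun x hx => (hcone x hx).act A
  have hL : ∀ w, w ∈ slPlane A '' scaledLattice n k ↔ w ≠ 0 ∧ q.cov w = 0 := fun w => by
    rw [mem_image_scaledLattice_iff hs hns A w, hq, TorusProjection.act_cov_apply, hq₀]
  have hsum : ∀ t : ℝ, 0 < t →
      Summable fun v : slPlane A '' scaledLattice n k => Real.exp (-t * ‖(v : ℂ)‖) := fun t ht =>
    summable_exp_lattice hn0 A ht
  obtain ⟨m, hm, hmin⟩ := exists_norm_le_of_mem_lattice (k := k) hn0 A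
  obtain ⟨v, w, hvw⟩ := exists_ne_lattice (k := k) hn0 A
  have hne : Nonempty (slPlane A '' scaledLattice n k) := ⟨v⟩
  have hpos : ∀ v : slPlane A '' scaledLattice n k, 0 < ‖(v : ℂ)‖ := fun v =>
    hm.trans_le (hmin v v.2)
  have hanti : StrictAntiOn (fun t : ℝ => latticeSum n k t A) (Set.Ioi 0) :=
    ExpSum.strictAntiOn hpos hsum
  have hpaths : ∀ t : ℝ, 0 < t → latticeSum n k t A < 1 / k →
      HasSum (fun p : (X₀.act A).SaddlePath => Real.exp (-t * p.length))
        (n * (k + 1) * latticeSum n k t A / (1 - k * latticeSum n k t A)) := by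
    intro t ht htk
    have := hasSum_saddlePath hC hL ht (hsum t ht) rfl (by
      rw [lt_div_iff₀ hk0] at htk
      rw [mul_comm]; exact htk)
    rw [show (X₀.act A).sing.ncard = n from hn] at this
    exact this
  obtain ⟨h, hh, hhk⟩ := ExpSum.exists_eq hvw hm (fun v => hmin v v.2) hsum (y := 1 / k)
    (by positivity) ((div_le_one hk0).2 (by exact_mod_cast hk))
  have hhk' : latticeSum n k h A = 1 / k := hhk
  have hup : ∀ t : ℝ, h < t → latticeSum n k t A < 1 / k := fun t ht =>
    hhk' ▸ hanti hh (hh.trans ht) ht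
  -- Any parameter beyond `h` gives a convergent path sum, hence finite counts; `h + 1` is one.
  have hfin := finite_saddlePath (hh.trans (lt_add_one h))
    (hpaths (h + 1) (hh.trans (lt_add_one h)) (hup _ (lt_add_one h))).summable
  refine ⟨fun t ht => ⟨hsum t ht, ExpSum.exists_hasDerivAt_neg hpos hsum ht⟩, hanti, hpaths,
    h, hh, ⟨hfin, ?_⟩, hhk', fun t ht htk => hanti.injOn ht hh (htk.trans hhk'.symm)⟩
  refine ExpSum.tendsto_log_div hh (fun t ht hth => ?_) fun t hht => ?_
  · refine exists_le_ncard hC ?_ hL ht (hsum t ht) ?_ hfin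
    · exact Set.nonempty_of_ncard_ne_zero (by
        rw [show (X₀.act A).sing.ncard = n from hn]; exact hn0.ne')
    · have h1 : latticeSum n k h A < latticeSum n k t A := hanti ht hh hth
      rw [hhk', div_lt_iff₀ hk0, mul_comm] at h1
      exact h1
  · have ht := hh.trans hht
    have hS := hpaths t ht (hup t hht)
    refine ⟨n * (k + 1) * latticeSum n k t A / (1 - k * latticeSum n k t A), ?_,
      ncard_saddlePath_le ht hS⟩
    have h1 := hup t hht
    have h2 : 0 < latticeSum n k t A :=
      (hsum t ht).tsum_pos (fun _ => (Real.exp_pos _).le) v (Real.exp_pos _)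
    rw [lt_div_iff₀ hk0] at h1
    have h3 : (0 : ℝ) < n := by exact_mod_cast hn0
    exact div_pos (by positivity) (by linarith)
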